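/- Let $\phi$ be a probability measure on $\mathbb R_+=[0,\infty)$ with $\phi(\{0\})=0$, let $(v_i)_{i\ge1}$ be i.i.d. with law $\phi$, and put $\tau_i=1/v_i$. For $(q_0,p_0)\in[0,1)\times(0,\infty)$ let $T_0=(1-q_0)/p_0$, $T_n=T_0+\tau_1+\dots+\tau_n$, and $$(q_t,p_t)=(q_0+p_0t,\,p_0)\ \text{ if } t<T_0,\qquad (q_t,p_t)=\Big(\tfrac{t-T_{n-1}}{\tau_n},\tfrac1{\tau_n}\Big)\ \text{ if } T_{n-1}\le t<T_n,\ n\ge1 .$$ Let $\mathbf P_t^{(q_0,p_0)}$ be the law of the empirical measure $\mu_t=\frac1t\int_{[0,t)}\delta_{(q_s,p_s)}\,ds$, a random element of $\mathcal P:=\mathcal P([0,1)\times\mathbb R_+)$ with the narrow topology, and let $\mathbf P_t$ be the law of the empirical measure of the undelayed process, which is given by the second formula with $T_0=0$. For a measure $\pi$ write $\pi(f)=\int f\,d\pi$, and let $p$ also denote the function $p\mapsto p$ (or $(q,p)\mapsto p$). Let $\lambda_\ell$ be the uniform law on $[0,\ell)$ for $\ell\in(0,1]$ and $\lambda_0=\delta_0$.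 Let $\Omega\subset\mathcal P$ be the set of all $$\mu(dq,dp)=\alpha_1\,\pi(dp)\,dq+\alpha_2\,\delta_0(dp)\,dq+\alpha_3\,\delta_0(dp)\,\lambda_\ell(dq) \tag{1}$$ with $\alpha_i\ge0$, $\alpha_1+\alpha_2+\alpha_3=1$, $\pi$ a probability measure on $(0,\infty)$ with $\pi(p)<\infty$, and $\ell\in[0,1)$. Put $\tilde\pi(dp)=p\,\pi(dp)/\pi(p)$, $$\xi=\sup\{c\in\mathbb R:\phi(e^{c/p})<\infty\},\qquad \bar\xi=-\lim_{\delta\downarrow0}\liminf_{\varepsilon\downarrow0}\varepsilon\log\phi\big([\varepsilon(1-\delta),\varepsilon(1+\delta))\big),$$ both in $[0,\infty]$ (with $\log0=-\infty$). With $H$ the relative entropy and the conventions $0^{-1}=\infty$ and $0\cdot\infty=0$, define, for $\mu\in\Omega$ given by (1), $$I(\mu)=\mu(p)\,H(\tilde\pi\,|\,\phi)+(\alpha_2+\alpha_3\ell^{-1})\,\xi,\qquad \bar I(\mu)=\mu(p)\,H(\tilde\pi\,|\,\phi)+\alpha_2\,\xi+\alpha_3\ell^{-1}\,\bar\xi,$$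 and $I(\mu)=\bar I(\mu)=+\infty$ for $\mu\in\mathcal P\setminus\Omega$. **Theorem.** The functionals $I$ and $\bar I$ are lower semicontinuous, and $I$ is good (it has compact sublevel sets). For every $(q_0,p_0)\in[0,1)\times(0,\infty)$ the family $(\mathbf P^{(q_0,p_0)}_t)_{t>0}$ satisfies the following, and so does $(\mathbf P_t)_{t>0}$ (written with $\mathbf P_t$ in both cases). 1. (Upper bound, speed $t$, rate $I$.) $\limsup_{t\to\infty}\frac1t\log\mathbf P_t(C)\le-\inf_C I$ for every closed $C\subset\mathcal P$. 2. (Lower bound, speed $t$, rate $\bar I$.) $\liminf_{t\to\infty}\frac1t\log\mathbf P_t(O)\ge-\inf_O\bar I$ for every open $O\subset\mathcal P$. 3. The large deviations principle with speed $t$ and good rate $I$ (that is, both bounds with the rate $I$) holds if and only if $\xi=\bar\xi$. 4. (Optimality.) Suppose $\xi<\bar\xi$. Let $\gamma(dq,dp)=\phi(1/p)^{-1}p^{-1}\phi(dp)\,dq$ if $\phi(1/p)<\infty$, and $\gamma(dq,dp)=\delta_0(dp)\,dq$ otherwise. For $\alpha,\ell\in(0,1)$ and $\delta>0$ let $A_\delta$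 be the ball of radius $\delta$ in $\mathcal P$, for the Prohorov distance, centred at $\alpha\gamma+(1-\alpha)\delta_0(dp)\lambda_\ell(dq)$. Then there is a sequence $t_k\to\infty$ such that $$\lim_{\delta\downarrow0}\lim_{k\to\infty}\frac1{t_k}\log\mathbf P_{t_k}(A_\delta)=-(1-\alpha)\,\ell^{-1}\,\xi,$$ and for each $\delta>0$ there is a sequence $s_k=s_k^{\delta}\to\infty$ such that $$\lim_{\delta\downarrow0}\lim_{k\to\infty}\frac1{s_k^\delta}\log\mathbf P_{s_k^\delta}(A_\delta)=-(1-\alpha)\,\ell^{-1}\,\bar\xi .$$ -/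

import Mathlib

open MeasureTheory Filter Topology
open scoped ENNReal NNReal

noncomputable section

namespace HotBox

/-! ### The process and its empirical measure -/

/-- The phase space `[0,1[ × ℝ₊` (position, speed). -/
abbrev Phase : Type := Set.Ico (0 : ℝ) 1 × ℝ≥0

/-- The renewal times `T_n = T₀ + τ₁ + ⋯ + τ_n`, where `τ_{i+1} = 1 / v i`
(the speeds `v 0, v 1, …` are the `v₁, v₂, …` of the text). -/
def renewalTime (T₀ : ℝ) (v : ℕ → ℝ≥0) (n : ℕ) : ℝ :=
  T₀ + ∑ i ∈ Finset.range n, ((v i : ℝ))⁻¹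

theorem position_mem {a t : ℝ} {w : ℝ≥0} (h₁ : a ≤ t) (h₂ : t < a + (w : ℝ)⁻¹) :
    (t - a) * (w : ℝ) ∈ Set.Ico (0 : ℝ) 1 := by
  refine ⟨mul_nonneg (by linarith) w.2, ?_⟩
  rcases eq_or_ne w 0 with hw | hw
  · simp [hw]
  · have hw' : (0 : ℝ) < w := by exact_mod_cast pos_iff_ne_zero.mpr hw
    have h3 : t - a < (w : ℝ)⁻¹ := by linarith
    calc (t - a) * (w : ℝ) < (w : ℝ)⁻¹ * w := mul_lt_mul_of_pos_right h3 hw'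
      _ = 1 := inv_mul_cancel₀ hw'.ne'

theorem renewalTime_succ (T₀ : ℝ) (v : ℕ → ℝ≥0) (n : ℕ) :
    renewalTime T₀ v (n + 1) = renewalTime T₀ v n + (v n : ℝ)⁻¹ := by
  simp [renewalTime, Finset.sum_range_succ, add_assoc]

theorem renewalTime_mono (T₀ : ℝ) (v : ℕ → ℝ≥0) : Monotone (renewalTime T₀ v) :=
  monotone_nat_of_le_succ fun n => by
    rw [renewalTime_succ]
    exact le_add_of_nonneg_right (inv_nonneg.mpr (v n).2)

open Classical in
/-- The state at a time `t ≥ T₀` of the particle emitted for the first time at `T₀`: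
`((t - T_n) / τ_{n+1}, 1 / τ_{n+1})` if `T_n ≤ t < T_{n+1}`. (There is no such `n` only if `t < T₀`,
or if `T_n` stays bounded, an event of probability zero.) -/
def emittedState (T₀ : ℝ) (v : ℕ → ℝ≥0) (t : ℝ) : Phase :=
  if h : ∃ n, renewalTime T₀ v n ≤ t ∧ t < renewalTime T₀ v (n + 1) then
    (⟨(t - renewalTime T₀ v h.choose) * v h.choose,
      position_mem h.choose_spec.1 (renewalTime_succ T₀ v h.choose ▸ h.choose_spec.2)⟩,
      v h.choose)
  else (⟨0, by simp⟩, 0)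

/-- Time of the first collision, for the initial condition `(q₀, p₀)`. -/
def firstHit (q₀ : Set.Ico (0 : ℝ) 1) (p₀ : ℝ≥0) : ℝ := (1 - (q₀ : ℝ)) / (p₀ : ℝ)

theorem initial_position_mem {q₀ : Set.Ico (0 : ℝ) 1} {p₀ : ℝ≥0} {t : ℝ}
    (h : 0 ≤ t ∧ t < firstHit q₀ p₀) : (q₀ : ℝ) + p₀ * t ∈ Set.Ico (0 : ℝ) 1 := by
  refine ⟨add_nonneg q₀.2.1 (mul_nonneg p₀.2 h.1), ?_⟩
  rcases eq_or_ne p₀ 0 with hp | hp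
  · simpa [hp] using q₀.2.2
  · have hp' : (0 : ℝ) < p₀ := by exact_mod_cast pos_iff_ne_zero.mpr hp
    have := (lt_div_iff₀ hp').mp h.2
    linarith [mul_comm t (p₀ : ℝ)]

open Classical in
/-- The process `(q_t, p_t)`, `t ≥ 0`, started from `(q₀, p₀)`. -/
def state (q₀ : Set.Ico (0 : ℝ) 1) (p₀ : ℝ≥0) (v : ℕ → ℝ≥0) (t : ℝ) : Phase :=
  if h : 0 ≤ t ∧ t < firstHit q₀ p₀ then (⟨q₀ + p₀ * t, initial_position_mem h⟩, p₀)
  else emittedState (firstHit q₀ p₀) v t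

theorem measurable_emittedState (T₀ : ℝ) (v : ℕ → ℝ≥0) : Measurable (emittedState T₀ v) := by
  classical
  have huniq : ∀ {t : ℝ} {m n : ℕ},
      (renewalTime T₀ v m ≤ t ∧ t < renewalTime T₀ v (m + 1)) →
      (renewalTime T₀ v n ≤ t ∧ t < renewalTime T₀ v (n + 1)) → m = n := by
    intro t m n hm hn
    rcases lt_trichotomy m n with h | h | h
    · have := renewalTime_mono T₀ v (Nat.succ_le_of_lt h)
      simp only [Nat.succ_eq_add_one] at this
      linarith [hm.2, hn.1]
    · exact h
    · have := renewalTime_mono T₀ v (Nat.succ_le_of_lt h)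
      simp only [Nat.succ_eq_add_one] at this
      linarith [hm.1, hn.2]
  -- the pieces `[T_n, T_{n+1}[`, and the rest
  let S : Option ℕ → Set ℝ := fun o => o.elim
    (⋃ n, Set.Ico (renewalTime T₀ v n) (renewalTime T₀ v (n + 1)))ᶜ
    (fun n => Set.Ico (renewalTime T₀ v n) (renewalTime T₀ v (n + 1)))
  have hS : ∀ o, MeasurableSet (S o) := by
    rintro (_ | n)
    · exact (MeasurableSet.iUnion fun n => measurableSet_Ico).compl
    · exact measurableSet_Ico
  have hcov : ⋃ o, S o = Set.univ := by
    refine Set.eq_univ_of_forall fun t => Set.mem_iUnion.mpr ?_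
    by_cases h : ∃ n, renewalTime T₀ v n ≤ t ∧ t < renewalTime T₀ v (n + 1)
    · exact ⟨some h.choose, h.choose_spec⟩
    · refine ⟨none, fun hmem => h ?_⟩
      obtain ⟨n, hn⟩ := Set.mem_iUnion.mp hmem
      exact ⟨n, hn⟩
  have hres : ∀ o, Measurable (fun t : S o => emittedState T₀ v t) := by
    rintro (_ | n)
    · have : (fun t : S none => emittedState T₀ v t) = fun _ => (⟨0, by simp⟩, 0) := by
        funext t
        have ht : ¬ ∃ n, renewalTime T₀ v n ≤ t ∧ t < renewalTime T₀ v (n + 1) :=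
          fun ⟨n, hn⟩ => t.2 (Set.mem_iUnion.mpr ⟨n, hn⟩)
        exact dif_neg ht
      rw [this]
      exact measurable_const
    · have : (fun t : S (some n) => emittedState T₀ v t) = fun t =>
          (⟨((t : ℝ) - renewalTime T₀ v n) * v n,
            position_mem t.2.1 (renewalTime_succ T₀ v n ▸ t.2.2)⟩, v n) := by
        funext t
        have ht : ∃ n, renewalTime T₀ v n ≤ t ∧ t < renewalTime T₀ v (n + 1) := ⟨n, t.2⟩
        have hn : ht.choose = n := huniq ht.choose_spec t.2
        refine (dif_pos ht).trans ?_
        simp only [hn]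
      rw [this]
      exact Measurable.prodMk (((measurable_subtype_coe.sub_const _).mul_const _).subtype_mk)
        measurable_const
  intro A hA
  have : emittedState T₀ v ⁻¹' A =
      ⋃ o, Subtype.val '' ((fun t : S o => emittedState T₀ v t) ⁻¹' A) := by
    ext t
    simp only [Set.mem_preimage, Set.mem_iUnion, Set.mem_image]
    constructor
    · intro ht
      obtain ⟨o, ho⟩ := Set.mem_iUnion.mp (hcov ▸ Set.mem_univ t : t ∈ ⋃ o, S o)
      exact ⟨o, ⟨t, ho⟩, ht, rfl⟩
    · rintro ⟨o, x, hx, rfl⟩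
      exact hx
  rw [this]
  exact MeasurableSet.iUnion fun o => (hS o).subtype_image (hres o hA)

theorem measurable_state (q₀ : Set.Ico (0 : ℝ) 1) (p₀ : ℝ≥0) (v : ℕ → ℝ≥0) :
    Measurable (state q₀ p₀ v) := by
  classical
  refine Measurable.dite (s := {t | 0 ≤ t ∧ t < firstHit q₀ p₀})
    (f := fun t => ((⟨q₀ + p₀ * (t : ℝ), initial_position_mem t.2⟩, p₀) : Phase))
    (g := fun t => emittedState (firstHit q₀ p₀) v t) ?_ ?_ measurableSet_Ico
  · exact Measurable.prodMk ((measurable_subtype_coe.const_mul _).const_add _).subtype_mk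
      measurable_const
  · exact (measurable_emittedState _ v).comp measurable_subtype_coe

/-- The occupation measure `t⁻¹ ∫_{[0,t[} δ_{x s} ds` of a path `x`. -/
def occupation (x : ℝ → Phase) (t : ℝ) : Measure Phase :=
  ENNReal.ofReal t⁻¹ • (volume.restrict (Set.Ico 0 t)).map x

theorem isProbabilityMeasure_occupation {x : ℝ → Phase} (hx : Measurable x) {t : ℝ} (ht : 0 < t) :
    IsProbabilityMeasure (occupation x t) := by
  refine ⟨?_⟩
  rw [occupation, Measure.smul_apply, Measure.map_apply hx MeasurableSet.univ]
  simp only [Set.preimage_univ, Measure.restrict_apply_univ, Real.volume_Ico, sub_zero, smul_eq_mul]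
  rw [← ENNReal.ofReal_mul (inv_nonneg.mpr ht.le), inv_mul_cancel₀ ht.ne', ENNReal.ofReal_one]

open Classical in
/-- The occupation measure of a measurable path as a probability measure, for `t > 0`
(an irrelevant value is used for `t ≤ 0`). -/
def occupationProb (x : ℝ → Phase) (hx : Measurable x) (t : ℝ) : ProbabilityMeasure Phase :=
  if ht : 0 < t then ⟨occupation x t, isProbabilityMeasure_occupation hx ht⟩
  else ⟨Measure.dirac (⟨0, by simp⟩, 0), inferInstance⟩

/-- The empirical measure `μ_t` of `(q_s, p_s)`, started from `(q₀, p₀)`. -/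
def empirical (q₀ : Set.Ico (0 : ℝ) 1) (p₀ : ℝ≥0) (v : ℕ → ℝ≥0) (t : ℝ) :
    ProbabilityMeasure Phase :=
  occupationProb (state q₀ p₀ v) (measurable_state q₀ p₀ v) t

/-- The empirical measure of the undelayed process, which is emitted from `0` at time `0`
with speed `v₁`. -/
def undelayedEmpirical (v : ℕ → ℝ≥0) (t : ℝ) : ProbabilityMeasure Phase :=
  occupationProb (emittedState 0 v) (measurable_emittedState 0 v) t

/-- The law of the random elements `Y t`, as a function of the event: `law ℙ Y t A = ℙ(Y t ∈ A)`. -/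
def law {Ω' E : Type*} [MeasurableSpace Ω'] (ℙ : Measure Ω') (Y : Ω' → ℝ → E) (t : ℝ)
    (A : Set E) : ℝ≥0∞ :=
  ℙ {ω | Y ω t ∈ A}

/-- The law `𝐏_t` of the empirical measure of the process started from `(q₀, p₀)`. -/
def delayedLaw {Ω' : Type*} [MeasurableSpace Ω'] (ℙ : Measure Ω') (v : ℕ → Ω' → ℝ≥0)
    (q₀ : Set.Ico (0 : ℝ) 1) (p₀ : ℝ≥0) : ℝ → Set (ProbabilityMeasure Phase) → ℝ≥0∞ :=
  law ℙ fun ω => empirical q₀ p₀ (fun i => v i ω)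

/-- The law of the empirical measure of the undelayed process. -/
def undelayedLaw {Ω' : Type*} [MeasurableSpace Ω'] (ℙ : Measure Ω') (v : ℕ → Ω' → ℝ≥0) :
    ℝ → Set (ProbabilityMeasure Phase) → ℝ≥0∞ :=
  law ℙ fun ω => undelayedEmpirical (fun i => v i ω)

/-! ### Large deviations -/

section LargeDeviations

variable {E : Type*}

/-- `t⁻¹ log P_t(A)`, with `log 0 = -∞`. -/
def logRate (P : ℝ → Set E → ℝ≥0∞) (t : ℝ) (A : Set E) : EReal :=
  ((t⁻¹ : ℝ) : EReal) * ENNReal.log (P t A)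

variable [TopologicalSpace E]

/-- Large deviations upper bound with speed `t` and (lower semicontinuous) rate `J`. -/
def LDUpperBound (P : ℝ → Set E → ℝ≥0∞) (J : E → ℝ≥0∞) : Prop :=
  LowerSemicontinuous J ∧ ∀ C : Set E, IsClosed C →
    limsup (fun t : ℝ => logRate P t C) atTop ≤ -((⨅ u ∈ C, J u : ℝ≥0∞) : EReal)

/-- Large deviations lower bound with speed `t` and (lower semicontinuous) rate `J`. -/
def LDLowerBound (P : ℝ → Set E → ℝ≥0∞) (J : E → ℝ≥0∞) : Prop :=
  LowerSemicontinuous J ∧ ∀ O : Set E, IsOpen O →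
    -((⨅ u ∈ O, J u : ℝ≥0∞) : EReal) ≤ liminf (fun t : ℝ => logRate P t O) atTop

/-- Large deviations principle with speed `t` and rate `J`. -/
def LDP (P : ℝ → Set E → ℝ≥0∞) (J : E → ℝ≥0∞) : Prop :=
  LDUpperBound P J ∧ LDLowerBound P J

/-- A functional is good if its sublevel sets are compact. -/
def IsGood (J : E → ℝ≥0∞) : Prop := ∀ M : ℝ≥0, IsCompact {u | J u ≤ M}

end LargeDeviations

/-! ### The rate functionals -/

/-- `π(p) = ∫ p π(dp)`. -/
def meanSpeed (π : Measure ℝ≥0) : ℝ≥0∞ := ∫⁻ p, (p : ℝ≥0∞) ∂π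

/-- The size-biased law `π̃(dp) = p π(dp) / π(p)`. -/
def sizeBias (π : Measure ℝ≥0) : Measure ℝ≥0 :=
  (meanSpeed π)⁻¹ • π.withDensity (fun p => (p : ℝ≥0∞))

/-- Lebesgue measure `dq` on `[0,1[`. -/
def lebesgueIco : Measure (Set.Ico (0 : ℝ) 1) := (volume : Measure ℝ).comap Subtype.val

/-- `λ_ℓ`: the uniform law on `[0,ℓ[` if `ℓ ∈ ]0,1]`, the Dirac mass at `0` if `ℓ = 0`. -/
def lam (ℓ : ℝ) : Measure (Set.Ico (0 : ℝ) 1) :=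
  if ℓ = 0 then Measure.dirac ⟨0, by simp⟩
  else ENNReal.ofReal ℓ⁻¹ • lebesgueIco.restrict {q | (q : ℝ) < ℓ}

/-- The data `(α₁, α₂, α₃, π, ℓ)` of an element of the set `Ω`. -/
structure OmegaData where
  α₁ : ℝ≥0
  α₂ : ℝ≥0
  α₃ : ℝ≥0
  sum_eq : α₁ + α₂ + α₃ = 1
  π : Measure ℝ≥0
  prob : IsProbabilityMeasure π
  pos : π {0} = 0
  mean_lt : meanSpeed π < ∞
  ℓ : ℝ
  ℓ_nonneg : 0 ≤ ℓ
  ℓ_lt : ℓ < 1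

/-- `α₁ π(dp) dq + α₂ δ₀(dp) dq + α₃ δ₀(dp) λ_ℓ(dq)`. -/
def OmegaData.toMeasure (r : OmegaData) : Measure Phase :=
  r.α₁ • lebesgueIco.prod r.π
    + r.α₂ • lebesgueIco.prod (Measure.dirac 0)
    + r.α₃ • (lam r.ℓ).prod (Measure.dirac 0)

/-- `ξ = sup {c ∈ ℝ : φ(e^{c/p}) < ∞} ∈ [0, ∞]` (`c = 0` is always in the set). -/
def xi (φ : Measure ℝ≥0) : ℝ≥0∞ :=
  ⨆ (c : ℝ) (_ : ∫⁻ p, ENNReal.ofReal (Real.exp (c / (p : ℝ))) ∂φ < ∞), ENNReal.ofReal c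

/-- `liminf_{ε ↓ 0} ε log φ([ε(1-δ), ε(1+δ)[)`. -/
def windowRate (φ : Measure ℝ≥0) (δ : ℝ) : EReal :=
  liminf (fun ε : ℝ => (ε : EReal) *
    ENNReal.log (φ {p | ε * (1 - δ) ≤ (p : ℝ) ∧ (p : ℝ) < ε * (1 + δ)})) (𝓝[>] 0)

/-- `windowRate` is monotone in `δ`. -/
theorem windowRate_mono (φ : Measure ℝ≥0) : Monotone (windowRate φ) := by
  intro δ δ' h
  refine liminf_le_liminf ?_
  filter_upwards [self_mem_nhdsWithin] with ε hε
  have hε' : (0 : ℝ) < ε := hε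
  refine mul_le_mul_of_nonneg_left (ENNReal.log_monotone (measure_mono fun p hp => ?_))
    (EReal.coe_nonneg.mpr hε'.le)
  exact ⟨le_trans (by nlinarith) hp.1, lt_of_lt_of_le hp.2 (by nlinarith)⟩

/-- `-lim_{δ ↓ 0} liminf_{ε ↓ 0} ε log φ([ε(1-δ), ε(1+δ)[) ∈ [0, ∞]`. The limit in `δ`
exists, because `windowRate` is monotone; see `tendsto_windowRate`. -/
def xiBar (φ : Measure ℝ≥0) : ℝ≥0∞ :=
  (-(limUnder (𝓝[>] (0 : ℝ)) (windowRate φ))).toENNReal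

theorem tendsto_windowRate (φ : Measure ℝ≥0) :
    Tendsto (windowRate φ) (𝓝[>] 0) (𝓝 (limUnder (𝓝[>] (0 : ℝ)) (windowRate φ))) :=
  tendsto_nhds_limUnder ⟨_, (windowRate_mono φ).tendsto_nhdsGT 0⟩

/-- `μ(p) H(π̃ | φ) + (α₂ + α₃ ℓ⁻¹) ξ`, with `0⁻¹ = ∞` and `0 ⬝ ∞ = 0`. -/
def OmegaData.upperCost (φ : Measure ℝ≥0) (r : OmegaData) : ℝ≥0∞ :=
  (∫⁻ x, (x.2 : ℝ≥0∞) ∂r.toMeasure) * InformationTheory.klDiv (sizeBias r.π) φ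
    + (r.α₂ + r.α₃ * (ENNReal.ofReal r.ℓ)⁻¹) * xi φ

/-- `μ(p) H(π̃ | φ) + α₂ ξ + α₃ ℓ⁻¹ ξ̄`, with `0⁻¹ = ∞` and `0 ⬝ ∞ = 0`. -/
def OmegaData.lowerCost (φ : Measure ℝ≥0) (r : OmegaData) : ℝ≥0∞ :=
  (∫⁻ x, (x.2 : ℝ≥0∞) ∂r.toMeasure) * InformationTheory.klDiv (sizeBias r.π) φ
    + r.α₂ * xi φ + r.α₃ * (ENNReal.ofReal r.ℓ)⁻¹ * xiBar φ

/-- The rate `I`: `upperCost` if `μ ∈ Ω`, and `+∞` (infimum of the empty set) otherwise. The data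
of `μ ∈ Ω` are unique up to `π` if `α₁ = 0` and `ℓ` if `α₃ = 0`, which do not enter the cost, so
that the infimum is over a single value. -/
def rateI (φ : Measure ℝ≥0) (μ : ProbabilityMeasure Phase) : ℝ≥0∞ :=
  ⨅ (r : OmegaData) (_ : r.toMeasure = (μ : Measure Phase)), r.upperCost φ

/-- The rate `Ī`: `lowerCost` if `μ ∈ Ω`, and `+∞` otherwise. -/
def rateIBar (φ : Measure ℝ≥0) (μ : ProbabilityMeasure Phase) : ℝ≥0∞ :=
  ⨅ (r : OmegaData) (_ : r.toMeasure = (μ : Measure Phase)), r.lowerCost φ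

/-! ### Optimality -/

/-- The mean `φ(1/p)` of the return time. -/
def meanReturn (φ : Measure ℝ≥0) : ℝ≥0∞ := ∫⁻ p, (p : ℝ≥0∞)⁻¹ ∂φ

/-- The typical limit `γ` of the empirical measure:
`φ(1/p)⁻¹ p⁻¹ φ(dp) dq` if `φ(1/p) < ∞`, and `δ₀(dp) dq` otherwise. -/
def typical (φ : Measure ℝ≥0) : Measure Phase :=
  lebesgueIco.prod
    (if meanReturn φ < ∞ then (meanReturn φ)⁻¹ • φ.withDensity (fun p => (p : ℝ≥0∞)⁻¹)
      else Measure.dirac 0)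

/-- The Prohorov ball of radius `δ` centred at `α γ + (1-α) δ₀(dp) λ_ℓ(dq)`. -/
def sharpBall (φ : Measure ℝ≥0) (α ℓ δ : ℝ) : Set (ProbabilityMeasure Phase) :=
  {μ | levyProkhorovDist (μ : Measure Phase)
    (ENNReal.ofReal α • typical φ
      + ENNReal.ofReal (1 - α) • (lam ℓ).prod (Measure.dirac 0)) < δ}

/-- `-(1-α) ℓ⁻¹ x`. -/
def sharpValue (α ℓ : ℝ) (x : ℝ≥0∞) : EReal := -((ENNReal.ofReal ((1 - α) / ℓ) * x : ℝ≥0∞) : EReal)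

/-- Optimality of the upper bound: along one sequence of times `t_k → ∞`,
`lim_{δ ↓ 0} lim_k t_k⁻¹ log P_{t_k}(ball of radius δ) = -(1-α) ℓ⁻¹ ξ`. -/
def UpperOptimal (φ : Measure ℝ≥0) (P : ℝ → Set (ProbabilityMeasure Phase) → ℝ≥0∞) : Prop :=
  ∀ α ∈ Set.Ioo (0 : ℝ) 1, ∀ ℓ ∈ Set.Ioo (0 : ℝ) 1, ∃ t : ℕ → ℝ, Tendsto t atTop atTop ∧
    ∃ L : ℝ → EReal,
      (∀ δ > 0, Tendsto (fun k => logRate P (t k) (sharpBall φ α ℓ δ)) atTop (𝓝 (L δ))) ∧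
      Tendsto L (𝓝[>] 0) (𝓝 (sharpValue α ℓ (xi φ)))

/-- Optimality of the lower bound: along sequences of times `s_k^δ → ∞` (as `k → ∞`), which may
depend on the radius `δ`,
`lim_{δ ↓ 0} lim_k (s_k^δ)⁻¹ log P_{s_k^δ}(ball of radius δ) = -(1-α) ℓ⁻¹ ξ̄`. -/
def LowerOptimal (φ : Measure ℝ≥0) (P : ℝ → Set (ProbabilityMeasure Phase) → ℝ≥0∞) : Prop :=
  ∀ α ∈ Set.Ioo (0 : ℝ) 1, ∀ ℓ ∈ Set.Ioo (0 : ℝ) 1, ∃ s : ℝ → ℕ → ℝ,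
    (∀ δ > 0, Tendsto (s δ) atTop atTop) ∧
    ∃ L : ℝ → EReal,
      (∀ δ > 0, Tendsto (fun k => logRate P (s δ k) (sharpBall φ α ℓ δ)) atTop (𝓝 (L δ))) ∧
      Tendsto L (𝓝[>] 0) (𝓝 (sharpValue α ℓ (xiBar φ)))

end HotBox

end

open MeasureTheory Filter Topology
open scoped ENNReal NNReal

noncomputable section

namespace HotBox

open scoped BoundedContinuousFunction
open InformationTheory Set

/-! ### The variational formula for the relative entropy -/

section Entropy

variable {X : Type*} [MeasurableSpace X]

/-! At a large time `t` the empirical measure is determined, up to the contribution of the delay, by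
the completed cycles and the cycle in progress. A completed cycle sweeps the whole box uniformly, so
the completed cycles enter only through the occupation measure `ρ = t⁻¹ ∑ τᵢ δ_{vᵢ}` of their
speeds. The cycle in progress carries the missing mass `1 - ρ(1)` and has swept `[0, ℓ[`; its speed
is `ℓ` divided by its duration, and tends to `0` if its share of the time does not vanish. The
limits are therefore the measures `mixture (ρ, ℓ) = dq ⊗ ρ + (1 - ρ(1)) λ_ℓ ⊗ δ₀`, a continuous
image of the space `Config` of pairs `(ρ, ℓ)`, and both rates are contractions of costs on `Config`:
`rateI_eq`, `rateIBar_eq`.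

The cost of `ρ` has two forms, which agree by `dualCost_eq_cycleCost`. The dual form is the supremum
of `ρ(k)` over bounded continuous `k` with `φ(e^{k/p}) ≤ 1`; it yields lower semicontinuity and the
exponential Markov inequality. The explicit form is `ρ(p) H(ρ̃ | φ) + ρ({0}) ξ`; it is what appears
in the theorem and suits a change of measure. The equality is the variational formula for the
entropy, with an independent choice of the value of the test function at `p = 0`.

Upper bound: give each completed cycle the weight `e^{(k(vᵢ) - η)/vᵢ}` and the last one `e^{c/v}`
with `φ(e^{c/p}) < ∞`. The sum over the unknown number of cycles is a geometric series, and the last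
speed satisfies `c/v = c h/ℓ`, where `h` is the time spent in the cycle. This gives local decay
(`IsIID.exists_expDecay_nhds`); the number of cycles is at most `M t` up to a negligible event,
which gives compactness, and a finite cover concludes (`IsIID.expDecay_closed`).

Lower bound: about `ρ(p) t` speeds drawn from `ρ̃` produce `ρ`, at the entropic cost
(`attainable_of_apply_zero`). Mass at speed `0` is approximated by small positive speeds with
density proportional to `p⁻¹ e^{c/p}`, for `c` slightly above `ξ` (`exists_dualCost_le_near_dirac`).
An incomplete last cycle needs a single speed in a window around `ℓ / ((1 - ρ(1)) t)`, whose
probability is controlled from below by `ξ̄` (`IsIID.neg_lowerJ_le`).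

Optimality: the means of `q` and `q²` under the empirical measure determine the mass and the final
position of the last cycle. A small ball around the given centre thus forces the last speed into a
narrow window (`eventually_mem_window`), and the probability of the ball is comparable to that of
the window on the exponential scale. Window probabilities are infinitely often as small as `ξ̄`
says, by definition, and infinitely often as large as `ξ` says, since otherwise an exponential
moment above `ξ` would be finite (`frequently_exp_lt_measure_window`). This gives both optimality
statements and excludes a lower bound with rate `I` when `ξ < ξ̄`. -/

theorem integrable_exp_of_lintegral_lt_top {φ : Measure X} {f : X → ℝ} (hf : Measurable f)
    (h : ∫⁻ x, ENNReal.ofReal (Real.exp (f x)) ∂φ < ∞) :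
    Integrable (fun x => Real.exp (f x)) φ := by
  refine (lintegral_ofReal_ne_top_iff_integrable (by fun_prop) ?_).mp h.ne
  exact ae_of_all _ fun x => (Real.exp_pos _).le

theorem lintegral_exp_eq {φ : Measure X} {f : X → ℝ}
    (h : Integrable (fun x => Real.exp (f x)) φ) :
    ∫⁻ x, ENNReal.ofReal (Real.exp (f x)) ∂φ = ENNReal.ofReal (∫ x, Real.exp (f x) ∂φ) :=
  (ofReal_integral_eq_lintegral_ofReal h (ae_of_all _ fun _ => (Real.exp_pos _).le)).symm

/-- The entropy inequality. -/
theorem ofReal_integral_le_klDiv {σ φ : Measure X} [IsProbabilityMeasure σ]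
    [IsProbabilityMeasure φ] {f : X → ℝ} (hf : Measurable f) (hfi : Integrable f σ)
    (h : ∫⁻ x, ENNReal.ofReal (Real.exp (f x)) ∂φ ≤ 1) :
    ENNReal.ofReal (∫ x, f x ∂σ) ≤ klDiv σ φ := by
  by_cases htop : klDiv σ φ = ∞
  · simp [htop]
  obtain ⟨hac, hint⟩ := klDiv_ne_top_iff.mp htop
  have hexp := integrable_exp_of_lintegral_lt_top hf (h.trans_lt ENNReal.one_lt_top)
  have hle : ∫ x, Real.exp (f x) ∂φ ≤ 1 := by
    rw [lintegral_exp_eq hexp] at h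
    simpa using h
  -- The entropy relative to the tilted law is `H(σ|φ) - σ(f) + log φ(e^f)`. It is nonnegative and
  -- its last term is nonpositive.
  have h1 := integral_llr_tilted_right hac hfi hexp hint
  have hprob : IsProbabilityMeasure (φ.tilted f) := isProbabilityMeasure_tilted hexp
  have hac' : σ ≪ φ.tilted f := hac.trans (absolutelyContinuous_tilted hexp)
  have h2 := integral_llr_add_sub_measure_univ_nonneg hac'
    (integrable_llr_tilted_right hac hfi hint hexp)
  have h3 : Real.log (∫ x, Real.exp (f x) ∂φ) ≤ 0 :=
    Real.log_nonpos (integral_exp_pos hexp).le hle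
  rw [klDiv_of_ac_of_integrable hac hint]
  refine ENNReal.ofReal_le_ofReal ?_
  simp only [probReal_univ] at h2 ⊢
  linarith

/-- With `y` the truncation of `d` to `[n⁻¹, n]`, the expression is the tangent of `klFun` at `y`,
evaluated at `d`. Truncating moves `y` towards `1`, which keeps it nonnegative; this is the
positivity needed to apply Fatou's lemma to truncated densities. -/
theorem klFun_le_tangent {d : ℝ} (hd : 0 ≤ d) {n : ℝ} (hn : 1 ≤ n) :
    0 ≤ d * Real.log (max n⁻¹ (min n d)) + 1 - max n⁻¹ (min n d) := by
  have hn0 : 0 < n := by linarith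
  set y := max n⁻¹ (min n d) with hy
  have hy0 : 0 < y := lt_of_lt_of_le (inv_pos.mpr hn0) (le_max_left _ _)
  have hlog := Real.one_sub_inv_le_log_of_pos hy0
  have key : 0 ≤ y * Real.log y + 1 - y := klFun_nonneg hy0.le
  have hninv : n⁻¹ ≤ 1 := inv_le_one_of_one_le₀ hn
  rcases le_or_gt d n with h | h
  · rcases le_or_gt n⁻¹ d with h' | h'
    · have : y = d := by rw [hy, min_eq_right h, max_eq_right h']
      rw [← this]; exact key
    · have hyn : y = n⁻¹ := by rw [hy, min_eq_right h, max_eq_left h'.le]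
      have : Real.log y ≤ 0 := by rw [hyn]; exact Real.log_nonpos (inv_pos.mpr hn0).le hninv
      nlinarith
  · have hyn : y = n := by rw [hy, min_eq_left h.le, max_eq_right (hninv.trans hn)]
    have : 0 ≤ Real.log y := by rw [hyn]; exact Real.log_nonneg hn
    nlinarith

/-- Converse of the entropy inequality. The optimal `f` is the logarithm of the density, truncated
to be bounded and shifted to be normalized. If `σ` is not absolutely continuous, a large constant on
a `φ`-null set charged by `σ` does the job. -/
theorem exists_measurable_lt_integral {σ φ : Measure X} [IsProbabilityMeasure σ]
    [IsProbabilityMeasure φ] {M : ℝ} (hM0 : 0 ≤ M) (hM : ENNReal.ofReal M < klDiv σ φ) :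
    ∃ f : X → ℝ, Measurable f ∧ (∃ C, ∀ x, |f x| ≤ C) ∧ ∫ x, Real.exp (f x) ∂φ < 1 ∧
      M < ∫ x, f x ∂σ := by
  by_cases hac : σ ≪ φ
  · set d : X → ℝ := fun x => (σ.rnDeriv φ x).toReal with hd
    have hdm : Measurable d := (Measure.measurable_rnDeriv σ φ).ennreal_toReal
    have hdi : Integrable d φ := Measure.integrable_toReal_rnDeriv
    let y : ℕ → X → ℝ := fun n x => max ((n : ℝ) + 1)⁻¹ (min ((n : ℝ) + 1) (d x))
    have hn0 : ∀ n : ℕ, (0 : ℝ) < n + 1 := fun n => by positivity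
    have hn1 : ∀ n : ℕ, (1 : ℝ) ≤ n + 1 := fun n => by simp
    have hym : ∀ n, Measurable (y n) := fun n => by fun_prop
    have hyl : ∀ (n : ℕ) x, ((n : ℝ) + 1)⁻¹ ≤ y n x := fun n x => le_max_left _ _
    have hyu : ∀ (n : ℕ) x, y n x ≤ n + 1 := fun n x =>
      max_le ((inv_le_one_of_one_le₀ (hn1 n)).trans (hn1 n)) (min_le_left _ _)
    have hy0 : ∀ n x, 0 < y n x := fun n x => lt_of_lt_of_le (inv_pos.mpr (hn0 n)) (hyl n x)
    have hlogb : ∀ (n : ℕ) x, |Real.log (y n x)| ≤ Real.log (n + 1) := fun n x => by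
      rw [abs_le]
      refine ⟨?_, Real.log_le_log (hy0 n x) (hyu n x)⟩
      rw [← Real.log_inv]
      exact Real.log_le_log (inv_pos.mpr (hn0 n)) (hyl n x)
    have hyi : ∀ n, Integrable (y n) φ := fun n =>
      Integrable.of_bound (hym n).aestronglyMeasurable (n + 1)
        (ae_of_all _ fun x => by rw [Real.norm_eq_abs, abs_of_pos (hy0 n x)]; exact hyu n x)
    have hli : ∀ n, Integrable (fun x => d x * Real.log (y n x)) φ := fun n =>
      hdi.mul_bdd (c := Real.log (n + 1)) (hym n).log.aestronglyMeasurable (ae_of_all _ fun x => hlogb n x)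
    have hpt : ∀ x, Tendsto (fun n : ℕ => d x * Real.log (y n x) + 1 - y n x) atTop
        (𝓝 (klFun (d x))) := by
      intro x
      have hd0 : 0 ≤ d x := ENNReal.toReal_nonneg
      have hyd : Tendsto (fun n : ℕ => y n x) atTop (𝓝 (d x)) := by
        have h1 : ∀ᶠ n : ℕ in atTop, y n x = max ((n : ℝ) + 1)⁻¹ (d x) := by
          obtain ⟨N, hN⟩ := exists_nat_ge (d x)
          filter_upwards [eventually_ge_atTop N] with n hn
          have : (N : ℝ) ≤ n := by exact_mod_cast hn
          simp only [y]
          rw [min_eq_right (by linarith)]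
        refine Tendsto.congr' (EventuallyEq.symm h1) ?_
        have h2 : Tendsto (fun n : ℕ => ((n : ℝ) + 1)⁻¹) atTop (𝓝 0) := by
          simpa using tendsto_one_div_add_atTop_nhds_zero_nat (𝕜 := ℝ)
        simpa [max_eq_right hd0] using h2.max (tendsto_const_nhds (x := d x))
      rcases eq_or_ne (d x) 0 with h0 | h0
      · simp only [h0, zero_mul, klFun_zero, zero_add]
        rw [h0] at hyd
        simpa using (tendsto_const_nhds (x := (1 : ℝ))).sub hyd
      · have := ((hyd.log h0).const_mul (d x)).add_const 1 |>.sub hyd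
        simpa [klFun_apply] using this
    -- The integrands are nonnegative tangents of `klFun` and converge pointwise to `klFun (d x)`.
    have hfatou : klDiv σ φ ≤ liminf (fun n => ∫⁻ x, ENNReal.ofReal
        (d x * Real.log (y n x) + 1 - y n x) ∂φ) atTop := by
      rw [klDiv_eq_lintegral_klFun_of_ac hac]
      refine le_trans (lintegral_mono fun x => ?_) (lintegral_liminf_le fun n => by fun_prop)
      exact (ENNReal.tendsto_ofReal (hpt x)).liminf_eq.ge
    obtain ⟨n, hn⟩ := ((lt_of_lt_of_le hM hfatou) |> eventually_lt_of_lt_liminf).exists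
    have hint : Integrable (fun x => d x * Real.log (y n x) + 1 - y n x) φ :=
      ((hli n).add (integrable_const _)).sub (hyi n)
    rw [← ofReal_integral_eq_lintegral_ofReal hint
      (ae_of_all _ fun x => klFun_le_tangent ENNReal.toReal_nonneg (hn1 n)),
      ENNReal.ofReal_lt_ofReal_iff_of_nonneg hM0, integral_sub
      (f := fun x => d x * Real.log (y n x) + 1) ((hli n).add (integrable_const _))
      (hyi n), integral_add (hli n) (integrable_const _)] at hn
    have hσ : ∫ x, d x * Real.log (y n x) ∂φ = ∫ x, Real.log (y n x) ∂σ :=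
      integral_rnDeriv_smul hac
    rw [hσ] at hn
    simp only [integral_const, probReal_univ, smul_eq_mul, mul_one] at hn
    have hy_pos : 0 < ∫ x, y n x ∂φ := by
      have : ((n : ℝ) + 1)⁻¹ ≤ ∫ x, y n x ∂φ := by
        simpa using integral_mono (integrable_const _) (hyi n) (hyl n)
      exact lt_of_lt_of_le (inv_pos.mpr (hn0 n)) this
    -- By `log Z ≤ Z - 1`, dividing by `Z` costs no more than the term `1 - Z` already present. The
    -- further shift by `η` makes the exponential moment `e^{-η} < 1`.
    have hlog := Real.log_le_sub_one_of_pos hy_pos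
    set Z := ∫ x, y n x ∂φ
    obtain ⟨η, hη0, hη⟩ : ∃ η > 0, M + η < ∫ x, Real.log (y n x) ∂σ + 1 - Z :=
      ⟨(∫ x, Real.log (y n x) ∂σ + 1 - Z - M) / 2, by linarith, by linarith⟩
    refine ⟨fun x => Real.log (y n x) - (Real.log Z + η), by fun_prop,
      ⟨Real.log (n + 1) + |Real.log Z + η|, fun x => (abs_sub _ _).trans
        (by gcongr; exact hlogb n x)⟩, ?_, ?_⟩
    · have : ∀ x, Real.exp (Real.log (y n x) - (Real.log Z + η)) = (Z⁻¹ * Real.exp (-η)) * y n x := by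
        intro x
        rw [Real.exp_sub, Real.exp_add, Real.exp_log (hy0 n x), Real.exp_log hy_pos, Real.exp_neg]
        field_simp
      simp_rw [this]
      rw [integral_const_mul]
      change Z⁻¹ * Real.exp (-η) * Z < 1
      rw [mul_right_comm, inv_mul_cancel₀ hy_pos.ne', one_mul]
      simpa using hη0
    · rw [integral_sub _ (integrable_const _)]
      · simp only [integral_const, probReal_univ, smul_eq_mul, one_mul]
        linarith
      · exact Integrable.of_bound (hym n).log.aestronglyMeasurable _ (ae_of_all _ fun x => hlogb n x)
  · obtain ⟨A, hA, hφA, hσA⟩ : ∃ A, MeasurableSet A ∧ φ A = 0 ∧ σ A ≠ 0 := by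
      by_contra! hcon
      exact hac (Measure.AbsolutelyContinuous.mk fun s hs h0 => hcon s hs h0)
    have hσ0 : 0 < σ.real A := ENNReal.toReal_pos hσA (measure_ne_top _ _)
    -- The function `m 1_A - 1` equals `-1` for `φ`-almost every point and has `σ`-integral `M + 1`.
    set m := (M + 2) / σ.real A
    have hm0 : 0 ≤ m := by positivity
    refine ⟨fun x => A.indicator (fun _ => m) x - 1, (measurable_const.indicator hA).sub_const _,
      ⟨m + 1, fun x => ?_⟩, ?_, ?_⟩
    · by_cases hx : x ∈ A
      · simp only [hx, indicator_of_mem]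
        rw [abs_le]; constructor <;> linarith
      · simp only [hx, not_false_eq_true, indicator_of_notMem]
        rw [abs_le]; constructor <;> linarith
    · have : (fun x => Real.exp (A.indicator (fun _ => m) x - 1)) =ᵐ[φ] fun _ => Real.exp (-1) := by
        have : ∀ᵐ x ∂φ, x ∉ A := measure_eq_zero_iff_ae_notMem.mp hφA
        filter_upwards [this] with x hx
        simp [hx]
      rw [integral_congr_ae this]
      simp
    · rw [integral_sub ((integrable_const m).indicator hA) (integrable_const _),
        integral_indicator_const _ hA]
      simp only [integral_const, probReal_univ, smul_eq_mul, mul_one, m]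
      rw [mul_div_cancel₀ _ hσ0.ne']
      linarith

theorem abs_exp_sub_exp_le {a b C : ℝ} (ha : |a| ≤ C) (hb : |b| ≤ C) :
    |Real.exp a - Real.exp b| ≤ Real.exp C * |a - b| := by
  wlog hab : b ≤ a generalizing a b
  · rw [abs_sub_comm, abs_sub_comm a]
    exact this hb ha (le_of_not_ge hab)
  rw [abs_of_nonneg (by simpa using hab), abs_of_nonneg (by linarith)]
  have h1 : Real.exp b = Real.exp a * Real.exp (b - a) := by rw [← Real.exp_add]; congr 1; ring
  have h2 : b - a + 1 ≤ Real.exp (b - a) := Real.add_one_le_exp _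
  have h3 : Real.exp a ≤ Real.exp C := Real.exp_le_exp.mpr (le_trans (le_abs_self _) ha)
  nlinarith [Real.exp_pos a]

/-- Both inequalities for the measurable `f` are strict and survive an approximation in `L¹(φ + σ)`
by a continuous `g`. Clipping `g` to `[-C, C]` does not increase the error and makes the exponential
Lipschitz with constant `e^C`. -/
theorem exists_continuous_lt_integral [TopologicalSpace X] [TopologicalSpace.PseudoMetrizableSpace X]
    [BorelSpace X] {σ φ : Measure X} [IsProbabilityMeasure σ]
    [IsProbabilityMeasure φ] {M : ℝ} (hM0 : 0 ≤ M) (hM : ENNReal.ofReal M < klDiv σ φ) :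
    ∃ g : X →ᵇ ℝ, ∫ x, Real.exp (g x) ∂φ < 1 ∧ M < ∫ x, g x ∂σ := by
  obtain ⟨f, hfm, ⟨C, hC⟩, hexp, hlt⟩ := exists_measurable_lt_integral hM0 hM
  have hfi : ∀ μ : Measure X, IsFiniteMeasure μ → Integrable f μ := fun μ _ =>
    Integrable.of_bound hfm.aestronglyMeasurable C (ae_of_all _ hC)
  obtain ⟨ε, hε0, hε1, hε2⟩ : ∃ ε > 0, Real.exp C * ε < 1 - ∫ x, Real.exp (f x) ∂φ ∧
      ε < ∫ x, f x ∂σ - M := by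
    set A := 1 - ∫ x, Real.exp (f x) ∂φ
    set B := ∫ x, f x ∂σ - M
    have hA : 0 < A := by simp only [A]; linarith
    have hB : 0 < B := by simp only [B]; linarith
    refine ⟨min (A / Real.exp C) B / 2, by positivity, ?_, ?_⟩
    · have : min (A / Real.exp C) B ≤ A / Real.exp C := min_le_left _ _
      have := (le_div_iff₀ (Real.exp_pos C)).mp this
      nlinarith
    · have : min (A / Real.exp C) B ≤ B := min_le_right _ _
      linarith
  let _ := TopologicalSpace.pseudoMetrizableSpacePseudoMetric X
  obtain ⟨g, hg, -⟩ := (hfi (φ + σ) inferInstance).exists_boundedContinuous_integral_sub_le hε0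
  let g' : X →ᵇ ℝ := BoundedContinuousFunction.ofNormedAddCommGroup
    (fun x => max (-C) (min C (g x))) (by fun_prop) |C| (fun x => by
      rcases le_or_gt 0 C with h | h
      · rw [abs_of_nonneg h, Real.norm_eq_abs, abs_le]
        exact ⟨le_max_left _ _, max_le (by linarith) (min_le_left _ _)⟩
      · exact absurd ((abs_nonneg _).trans (hC x)) (by linarith))
  have hg' : ∀ x, g' x = max (-C) (min C (g x)) := fun x => rfl
  have hgC : ∀ x, |g' x| ≤ C := fun x => by
    have h0 := (abs_nonneg _).trans (hC x)
    rw [hg', abs_le]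
    exact ⟨le_max_left _ _, max_le (by linarith) (min_le_left _ _)⟩
  have hclose : ∀ x, |f x - g' x| ≤ ‖f x - g x‖ := fun x => by
    have h1 : f x = max (-C) (min C (f x)) := by
      have := abs_le.mp (hC x)
      rw [min_eq_right this.2, max_eq_right this.1]
    rw [hg']
    conv_lhs => rw [h1]
    refine (abs_max_sub_max_le_max _ _ _ _).trans ?_
    simp only [sub_self, abs_zero]
    refine max_le (norm_nonneg _) ((abs_min_sub_min_le_max _ _ _ _).trans ?_)
    simp
  have hI : ∀ μ : Measure X, IsFiniteMeasure μ → μ ≤ φ + σ → ∫ x, |f x - g' x| ∂μ ≤ ε := by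
    intro μ _ hμ
    refine le_trans ?_ hg
    refine (integral_mono ((hfi μ inferInstance).sub (g'.integrable μ)).abs
      ((hfi μ inferInstance).sub (g.integrable μ)).norm hclose).trans ?_
    exact integral_mono_measure hμ (ae_of_all _ fun x => norm_nonneg _)
      ((hfi _ inferInstance).sub (g.integrable _)).norm
  have hφ := hI φ inferInstance (Measure.le_add_right le_rfl)
  have hσ := hI σ inferInstance (Measure.le_add_left le_rfl)
  refine ⟨g', ?_, ?_⟩
  · have hi1 : Integrable (fun x => Real.exp (f x)) φ :=
      Integrable.of_bound (by fun_prop) (Real.exp C) (ae_of_all _ fun x => by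
        rw [Real.norm_eq_abs, Real.abs_exp]
        exact Real.exp_le_exp.mpr ((le_abs_self _).trans (hC x)))
    have hi2 : Integrable (fun x => Real.exp (g' x)) φ :=
      Integrable.of_bound (Real.continuous_exp.comp g'.continuous).aestronglyMeasurable
        (Real.exp C) (ae_of_all _ fun x => by
        rw [Real.norm_eq_abs, Real.abs_exp]
        exact Real.exp_le_exp.mpr ((le_abs_self _).trans (hgC x)))
    have : ∫ x, Real.exp (g' x) ∂φ - ∫ x, Real.exp (f x) ∂φ ≤ Real.exp C * ε := by
      rw [← integral_sub hi2 hi1]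
      refine le_trans ?_ (mul_le_mul_of_nonneg_left hφ (Real.exp_pos C).le)
      rw [← integral_const_mul]
      refine integral_mono (hi2.sub hi1)
        (((hfi φ inferInstance).sub (g'.integrable φ)).abs.const_mul _) fun x => ?_
      have := abs_exp_sub_exp_le (hgC x) (hC x)
      rw [abs_sub_comm (g' x)] at this
      exact (le_abs_self _).trans this
    linarith
  · have : ∫ x, f x ∂σ - ∫ x, g' x ∂σ ≤ ε := by
      rw [← integral_sub (hfi σ inferInstance) (g'.integrable σ)]
      exact (integral_mono ((hfi σ inferInstance).sub (g'.integrable σ))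
        ((hfi σ inferInstance).sub (g'.integrable σ)).abs fun x => le_abs_self _).trans hσ
    linarith

end Entropy

/-! ### The cost of the completed cycles, and its dual formula -/

/-- The test functions `k` with `φ(e^{k/p}) ≤ 1`. -/
def Admissible (φ : Measure ℝ≥0) (k : ℝ≥0 →ᵇ ℝ) : Prop :=
  ∫⁻ p, ENNReal.ofReal (Real.exp (k p / p)) ∂φ ≤ 1

/-- The supremum of `ρ(k)` over the admissible test functions `k`. -/
def dualCost (φ ρ : Measure ℝ≥0) : ℝ≥0∞ :=
  ⨆ (k : ℝ≥0 →ᵇ ℝ) (_ : Admissible φ k), ENNReal.ofReal (∫ p, k p ∂ρ)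

/-- The cost `ρ(p) H(ρ̃ | φ) + ρ({0}) ξ`. -/
def cycleCost (φ ρ : Measure ℝ≥0) : ℝ≥0∞ :=
  meanSpeed ρ * klDiv (sizeBias ρ) φ + ρ {0} * xi φ

theorem measurable_div_speed (k : ℝ≥0 →ᵇ ℝ) : Measurable fun p : ℝ≥0 => k p / (p : ℝ) := by
  have := k.continuous.measurable
  fun_prop

theorem le_dualCost {φ : Measure ℝ≥0} (ρ : Measure ℝ≥0) {k : ℝ≥0 →ᵇ ℝ} (hk : Admissible φ k) :
    ENNReal.ofReal (∫ p, k p ∂ρ) ≤ dualCost φ ρ :=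
  le_iSup₂ (f := fun (k : ℝ≥0 →ᵇ ℝ) (_ : Admissible φ k) => ENNReal.ofReal (∫ p, k p ∂ρ)) k hk

theorem integrable_speed {ρ : Measure ℝ≥0} (h : meanSpeed ρ < ∞) :
    Integrable (fun p : ℝ≥0 => (p : ℝ)) ρ := by
  refine (lintegral_ofReal_ne_top_iff_integrable (by fun_prop) ?_).mp ?_
  · exact ae_of_all _ fun p => p.2
  · simpa [meanSpeed, ENNReal.ofReal_coe_nnreal] using h.ne

theorem integral_sizeBias (ρ : Measure ℝ≥0) (g : ℝ≥0 → ℝ) :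
    ∫ p, g p ∂(sizeBias ρ) = (meanSpeed ρ).toReal⁻¹ * ∫ p : ℝ≥0, (p : ℝ) * g p ∂ρ := by
  rw [sizeBias, integral_smul_measure, ENNReal.toReal_inv,
    integral_withDensity_eq_integral_smul (f := fun p : ℝ≥0 => p) measurable_id]
  rfl

theorem integrable_sizeBias {ρ : Measure ℝ≥0} {g : ℝ≥0 → ℝ} (h0 : meanSpeed ρ ≠ 0)
    (hg : Integrable (fun p : ℝ≥0 => (p : ℝ) * g p) ρ) : Integrable g (sizeBias ρ) := by
  refine Integrable.smul_measure ?_ (by simpa using h0)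
  exact (integrable_withDensity_iff_integrable_smul (f := fun p : ℝ≥0 => p) measurable_id).mpr hg

theorem isProbabilityMeasure_sizeBias {ρ : Measure ℝ≥0} (h0 : meanSpeed ρ ≠ 0)
    (h : meanSpeed ρ < ∞) : IsProbabilityMeasure (sizeBias ρ) := by
  constructor
  rw [sizeBias, Measure.smul_apply, withDensity_apply _ MeasurableSet.univ, Measure.restrict_univ,
    smul_eq_mul]
  exact ENNReal.inv_mul_cancel h0 h.ne

theorem integrable_mul_bcf {ρ : Measure ℝ≥0} (h : meanSpeed ρ < ∞) (g : ℝ≥0 →ᵇ ℝ) :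
    Integrable (fun p : ℝ≥0 => (p : ℝ) * g p) ρ :=
  (integrable_speed h).mul_bdd (c := ‖g‖) g.continuous.aestronglyMeasurable
    (ae_of_all _ fun p => g.norm_coe_le_norm p)

theorem le_xi {φ : Measure ℝ≥0} {c : ℝ}
    (h : ∫⁻ p, ENNReal.ofReal (Real.exp (c / (p : ℝ))) ∂φ < ∞) : ENNReal.ofReal c ≤ xi φ :=
  le_iSup₂ (f := fun (c : ℝ) (_ : ∫⁻ p, ENNReal.ofReal (Real.exp (c / (p : ℝ))) ∂φ < ∞) =>
    ENNReal.ofReal c) c h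

/-- For `b < k 0` the function `e^{b/p}` is dominated by `e^{k(p)/p}` near `0` and is bounded
elsewhere, so `b` competes in the supremum that defines `ξ`. -/
theorem Admissible.zero_le_xi {φ : Measure ℝ≥0} [IsProbabilityMeasure φ]
    {k : ℝ≥0 →ᵇ ℝ} (hk : Admissible φ k) : ENNReal.ofReal (k 0) ≤ xi φ := by
  refine le_of_forall_lt fun a ha => ?_
  obtain ⟨b, hab, hb⟩ := exists_between ha
  have hb_top : b ≠ ∞ := (hb.trans ENNReal.ofReal_lt_top).ne
  refine hab.trans_le ?_
  rw [← ENNReal.ofReal_toReal hb_top]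
  have hb' : b.toReal < k 0 := by
    rw [← ENNReal.ofReal_toReal hb_top] at hb
    exact (ENNReal.ofReal_lt_ofReal_iff_of_nonneg ENNReal.toReal_nonneg).mp hb
  refine le_xi ?_
  have hev : ∀ᶠ p in 𝓝 (0 : ℝ≥0), b.toReal < k p :=
    (k.continuous.tendsto 0).eventually_const_lt hb'
  obtain ⟨η, hη0, hη⟩ := Metric.eventually_nhds_iff.mp hev
  calc ∫⁻ p, ENNReal.ofReal (Real.exp (b.toReal / (p : ℝ))) ∂φ
      ≤ ∫⁻ p, (ENNReal.ofReal (Real.exp (k p / p)) + ENNReal.ofReal (Real.exp (b.toReal / η))) ∂φ := by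
        refine lintegral_mono fun p => ?_
        rcases lt_or_ge (p : ℝ) η with hp | hp
        · refine le_add_right (ENNReal.ofReal_le_ofReal (Real.exp_le_exp.mpr ?_))
          refine div_le_div_of_nonneg_right (hη ?_).le p.2
          simpa [NNReal.dist_eq] using hp
        · refine le_add_left (ENNReal.ofReal_le_ofReal (Real.exp_le_exp.mpr ?_))
          exact div_le_div_of_nonneg_left ENNReal.toReal_nonneg hη0 hp
    _ = ∫⁻ p, ENNReal.ofReal (Real.exp (k p / p)) ∂φ + ENNReal.ofReal (Real.exp (b.toReal / η)) := by
        rw [lintegral_add_right _ measurable_const]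
        simp
    _ < ∞ := ENNReal.add_lt_top.mpr ⟨lt_of_le_of_lt hk ENNReal.one_lt_top, ENNReal.ofReal_lt_top⟩

/-- Size-biasing does not see the atom at `0`, which has to be treated apart. This identity links
the constraint on `k/p` under `φ` with the entropy of the size-biased law. -/
theorem integral_eq_meanSpeed_mul_add {ρ : Measure ℝ≥0} [IsFiniteMeasure ρ] (h : meanSpeed ρ < ∞)
    (h0 : meanSpeed ρ ≠ 0) (k : ℝ≥0 →ᵇ ℝ) :
    ∫ p, k p ∂ρ = (meanSpeed ρ).toReal * ∫ p, k p / (p : ℝ) ∂(sizeBias ρ) + ρ.real {0} * k 0 := by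
  rw [integral_sizeBias, ← mul_assoc, mul_inv_cancel₀ (ENNReal.toReal_ne_zero.mpr ⟨h0, h.ne⟩),
    one_mul, ← integral_add_compl (measurableSet_singleton (0 : ℝ≥0)) (k.integrable ρ),
    integral_singleton, smul_eq_mul, add_comm]
  congr 1
  rw [← integral_indicator (measurableSet_singleton _).compl]
  congr 1
  ext p
  by_cases hp : p = 0
  · simp [hp]
  · have : (p : ℝ) ≠ 0 := by exact_mod_cast hp
    rw [indicator_of_mem (by simpa using hp)]
    field_simp

theorem integrable_div_sizeBias {ρ : Measure ℝ≥0} [IsFiniteMeasure ρ]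
    (h0 : meanSpeed ρ ≠ 0) (k : ℝ≥0 →ᵇ ℝ) :
    Integrable (fun p : ℝ≥0 => k p / (p : ℝ)) (sizeBias ρ) := by
  refine integrable_sizeBias h0 ?_
  refine ((k.integrable ρ).indicator (measurableSet_singleton (0 : ℝ≥0)).compl).congr
    (ae_of_all _ fun p => ?_)
  by_cases hp : p = 0
  · simp [hp]
  · have : (p : ℝ) ≠ 0 := by exact_mod_cast hp
    simp only []
    rw [indicator_of_mem (by simpa using hp)]
    field_simp

theorem meanSpeed_eq_zero_iff {ρ : Measure ℝ≥0} : meanSpeed ρ = 0 ↔ ρ {0}ᶜ = 0 := by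
  rw [meanSpeed, lintegral_eq_zero_iff (by fun_prop), ← compl_mem_ae_iff, compl_compl]
  refine eventually_congr (ae_of_all _ fun p => ?_)
  change (p : ℝ≥0∞) = 0 ↔ p ∈ ({0} : Set ℝ≥0)
  simp

/-- The entropy inequality for `k/p` under the size-biased law bounds the part off `0`; the atom is
bounded by `k 0 ≤ ξ`. -/
theorem dualCost_le_cycleCost (φ ρ : Measure ℝ≥0) [IsProbabilityMeasure φ] [IsFiniteMeasure ρ]
    (h : meanSpeed ρ < ∞) : dualCost φ ρ ≤ cycleCost φ ρ := by
  refine iSup₂_le fun k hk => ?_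
  have hz : ENNReal.ofReal (ρ.real {0} * k 0) ≤ ρ {0} * xi φ := by
    rw [ENNReal.ofReal_mul measureReal_nonneg, measureReal_def,
      ENNReal.ofReal_toReal (measure_ne_top _ _)]
    exact mul_le_mul_right hk.zero_le_xi _
  rcases eq_or_ne (meanSpeed ρ) 0 with h0 | h0
  · have : ∫ p, k p ∂ρ = ρ.real {0} * k 0 := by
      rw [← integral_add_compl (measurableSet_singleton (0 : ℝ≥0)) (k.integrable ρ),
        integral_singleton, setIntegral_measure_zero _ (meanSpeed_eq_zero_iff.mp h0), add_zero,
        smul_eq_mul]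
    rw [this]
    exact hz.trans le_add_self
  · have := isProbabilityMeasure_sizeBias h0 h
    rw [integral_eq_meanSpeed_mul_add h h0]
    refine ENNReal.ofReal_add_le.trans (add_le_add ?_ hz)
    rw [ENNReal.ofReal_mul ENNReal.toReal_nonneg, ENNReal.ofReal_toReal h.ne]
    exact mul_le_mul_right (ofReal_integral_le_klDiv (measurable_div_speed k)
      (integrable_div_sizeBias h0 k) hk) _

/-- Truncation of `p ↦ p g(p)` at a high speed, and interpolation with the value `c` at `0`. -/
def cutoff (g : ℝ≥0 →ᵇ ℝ) (c : ℝ) (n : ℕ) : ℝ≥0 →ᵇ ℝ :=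
  BoundedContinuousFunction.ofNormedAddCommGroup
    (fun p : ℝ≥0 => min (p : ℝ) n * g p + c * max 0 (1 - n * (p : ℝ))) (by fun_prop)
    (n * ‖g‖ + |c|) (fun p => by
      refine (norm_add_le _ _).trans (add_le_add ?_ ?_)
      · rw [norm_mul]
        gcongr
        · rw [Real.norm_eq_abs, abs_of_nonneg (le_min p.coe_nonneg (Nat.cast_nonneg n))]
          exact min_le_right _ _
        · exact g.norm_coe_le_norm p
      · rw [norm_mul, Real.norm_eq_abs]
        refine mul_le_of_le_one_right (abs_nonneg _) ?_
        rw [Real.norm_eq_abs, abs_of_nonneg (le_max_left _ _)]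
        refine max_le zero_le_one ?_
        have : 0 ≤ (n : ℝ) * p := by positivity
        linarith)

theorem cutoff_apply (g : ℝ≥0 →ᵇ ℝ) (c : ℝ) (n : ℕ) (p : ℝ≥0) :
    cutoff g c n p = min (p : ℝ) n * g p + c * max 0 (1 - n * (p : ℝ)) := rfl

theorem tendsto_cutoff (g : ℝ≥0 →ᵇ ℝ) (c : ℝ) (p : ℝ≥0) :
    Tendsto (fun n => cutoff g c n p) atTop
      (𝓝 ((p : ℝ) * g p + ({0} : Set ℝ≥0).indicator (fun _ => c) p)) := by
  refine tendsto_const_nhds.congr' ?_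
  rcases eq_or_ne p 0 with hp | hp
  · filter_upwards with n
    simp [cutoff_apply, hp]
  · have hp' : (0 : ℝ) < p := by exact_mod_cast pos_iff_ne_zero.mpr hp
    obtain ⟨N, hN⟩ := exists_nat_ge (max (p : ℝ) (p : ℝ)⁻¹)
    filter_upwards [eventually_ge_atTop N] with n hn
    have hn' : (N : ℝ) ≤ n := by exact_mod_cast hn
    have h1 : (p : ℝ) ≤ n := (le_max_left _ _).trans (hN.trans hn')
    have h2 : (p : ℝ)⁻¹ ≤ n := (le_max_right _ _).trans (hN.trans hn')
    have h3 : 1 ≤ (n : ℝ) * p := by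
      have := mul_le_mul_of_nonneg_right h2 hp'.le
      rwa [inv_mul_cancel₀ hp'.ne'] at this
    rw [cutoff_apply, min_eq_left h1, max_eq_left (by linarith)]
    simp [hp]

theorem max_zero_one_sub_le (n : ℕ) (p : ℝ≥0) : max 0 (1 - n * (p : ℝ)) ≤ 1 := by
  refine max_le zero_le_one ?_
  have : 0 ≤ (n : ℝ) * p := by positivity
  linarith

/-- The desired test function is `p g(p)` for `p > 0` and `c` at `0`, which need not be continuous
or bounded; `cutoff` approximates it. Under `φ`, which has no atom at `0`, the limit of `φ(e^{k/p})`
is `φ(e^g) < 1`, dominated by a multiple of `e^{c/p}`. Under `ρ` the limit also records the value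
`c` at the atom. -/
theorem exists_admissible_lt {φ ρ : Measure ℝ≥0} [IsProbabilityMeasure φ] (hφ : φ {0} = 0)
    [IsFiniteMeasure ρ] (h : meanSpeed ρ < ∞) {g : ℝ≥0 →ᵇ ℝ} (hg : ∫ p, Real.exp (g p) ∂φ < 1)
    {c : ℝ} (hc0 : 0 ≤ c) (hc : ∫⁻ p, ENNReal.ofReal (Real.exp (c / (p : ℝ))) ∂φ < ∞)
    {L : ℝ} (hL : L < ∫ p : ℝ≥0, (p : ℝ) * g p ∂ρ + ρ.real {0} * c) :
    ∃ k, Admissible φ k ∧ L < ∫ p, k p ∂ρ := by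
  have hci := integrable_exp_of_lintegral_lt_top (f := fun p : ℝ≥0 => c / (p : ℝ))
    (by fun_prop) hc
  have hexp_le : ∀ (n : ℕ) (p : ℝ≥0), Real.exp (cutoff g c n p / p) ≤
      Real.exp ‖g‖ * Real.exp (c / p) := by
    intro n p
    rw [← Real.exp_add]
    refine Real.exp_le_exp.mpr ?_
    rcases eq_or_ne p 0 with hp | hp
    · simp [hp]
    have hp' : (0 : ℝ) < p := by exact_mod_cast pos_iff_ne_zero.mpr hp
    rw [div_le_iff₀ hp', add_mul, div_mul_cancel₀ _ hp'.ne', cutoff_apply, mul_comm ‖g‖]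
    have h1 : |g p| ≤ ‖g‖ := g.norm_coe_le_norm p
    have h2 : min (p : ℝ) n * g p ≤ p * ‖g‖ :=
      (mul_le_mul_of_nonneg_left ((le_abs_self _).trans h1) (le_min p.2 (Nat.cast_nonneg n))).trans
        (mul_le_mul_of_nonneg_right (min_le_left _ _) (norm_nonneg _))
    have h3 := mul_le_mul_of_nonneg_left (max_zero_one_sub_le n p) hc0
    linarith
  have hmeas : ∀ n, Measurable fun p : ℝ≥0 => Real.exp (cutoff g c n p / p) := fun n =>
    Real.measurable_exp.comp (measurable_div_speed _)
  have hlim1 : Tendsto (fun n => ∫ p, Real.exp (cutoff g c n p / p) ∂φ) atTop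
      (𝓝 (∫ p, Real.exp (g p) ∂φ)) := by
    refine tendsto_integral_of_dominated_convergence (fun p : ℝ≥0 => Real.exp ‖g‖ * Real.exp (c / p))
      (fun n => (hmeas n).aestronglyMeasurable) (hci.const_mul _)
      (fun n => ae_of_all _ fun p => ?_) ?_
    · rw [Real.norm_eq_abs, Real.abs_exp]
      exact hexp_le n p
    · have : ∀ᵐ p ∂φ, p ∉ ({0} : Set ℝ≥0) := measure_eq_zero_iff_ae_notMem.mp hφ
      filter_upwards [this] with p hp
      have hp' : (p : ℝ) ≠ 0 := by exact_mod_cast hp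
      have := (tendsto_cutoff g c p).div_const (p : ℝ)
      rw [indicator_of_notMem hp, add_zero, mul_div_cancel_left₀ _ hp'] at this
      exact (Real.continuous_exp.tendsto _).comp this
  have hlim2 : Tendsto (fun n => ∫ p, cutoff g c n p ∂ρ) atTop
      (𝓝 (∫ p : ℝ≥0, (p : ℝ) * g p ∂ρ + ρ.real {0} * c)) := by
    have : ∫ p : ℝ≥0, (p : ℝ) * g p ∂ρ + ρ.real {0} * c =
        ∫ p : ℝ≥0, ((p : ℝ) * g p + ({0} : Set ℝ≥0).indicator (fun _ => c) p) ∂ρ := by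
      rw [integral_add (integrable_mul_bcf h g)
        ((integrable_const c).indicator (measurableSet_singleton _)),
        integral_indicator_const _ (measurableSet_singleton _), smul_eq_mul]
    rw [this]
    refine tendsto_integral_of_dominated_convergence (fun p : ℝ≥0 => (p : ℝ) * ‖g‖ + c)
      (fun n => (cutoff g c n).continuous.aestronglyMeasurable)
      (((integrable_speed h).mul_const _).add (integrable_const _))
      (fun n => ae_of_all _ fun p => ?_) (ae_of_all _ fun p => tendsto_cutoff g c p)
    rw [cutoff_apply]
    refine (norm_add_le _ _).trans (add_le_add ?_ ?_)
    · rw [norm_mul, Real.norm_eq_abs (min _ _), abs_of_nonneg (le_min p.coe_nonneg (Nat.cast_nonneg n))]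
      exact mul_le_mul (min_le_left _ _) (g.norm_coe_le_norm p) (norm_nonneg _) p.2
    · rw [Real.norm_eq_abs, abs_of_nonneg (mul_nonneg hc0 (le_max_left _ _))]
      exact mul_le_of_le_one_right hc0 (max_zero_one_sub_le n p)
  obtain ⟨n, hn1, hn2⟩ :=
    ((hlim1.eventually_lt_const hg).and (hlim2.eventually_const_lt hL)).exists
  refine ⟨cutoff g c n, ?_, hn2⟩
  have hi : Integrable (fun p => Real.exp (cutoff g c n p / p)) φ :=
    (hci.const_mul _).mono' (hmeas n).aestronglyMeasurable (ae_of_all _ fun p => by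
      rw [Real.norm_eq_abs, Real.abs_exp]
      exact hexp_le n p)
  rw [Admissible, lintegral_exp_eq hi]
  simpa using hn1.le

theorem ofReal_le_dualCost {φ ρ : Measure ℝ≥0} [IsProbabilityMeasure φ] (hφ : φ {0} = 0)
    [IsFiniteMeasure ρ] (h : meanSpeed ρ < ∞) {g : ℝ≥0 →ᵇ ℝ} (hg : ∫ p, Real.exp (g p) ∂φ ≤ 1)
    {c : ℝ} (hc0 : 0 ≤ c) (hc : ∫⁻ p, ENNReal.ofReal (Real.exp (c / (p : ℝ))) ∂φ < ∞) :
    ENNReal.ofReal (∫ p : ℝ≥0, (p : ℝ) * g p ∂ρ + ρ.real {0} * c) ≤ dualCost φ ρ := by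
  refine ENNReal.le_of_forall_pos_le_add fun η hη _ => ?_
  set m := ∫ p : ℝ≥0, (p : ℝ) ∂ρ
  have hm : 0 ≤ m := integral_nonneg fun p => p.2
  -- Replacing `g` by `g - s` makes the constraint strict and lowers the integral by `s m < η`.
  obtain ⟨s, hs0, hs⟩ : ∃ s > 0, s * m < η := by
    refine ⟨η / (m + 1), by positivity, ?_⟩
    rw [div_mul_eq_mul_div, div_lt_iff₀ (by positivity)]
    have : (0 : ℝ) < η := hη
    nlinarith
  have hgs : ∫ p, Real.exp ((g - BoundedContinuousFunction.const ℝ≥0 s : ℝ≥0 →ᵇ ℝ) p) ∂φ < 1 := by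
    have : ∀ p, Real.exp ((g - BoundedContinuousFunction.const ℝ≥0 s : ℝ≥0 →ᵇ ℝ) p) =
        Real.exp (g p) * Real.exp (-s) := fun p => by
      rw [← Real.exp_add]; simp [sub_eq_add_neg]
    simp_rw [this]
    rw [integral_mul_const]
    have h1 : Real.exp (-s) < 1 := by simpa using hs0
    have h2 : 0 ≤ ∫ p, Real.exp (g p) ∂φ := integral_nonneg fun p => (Real.exp_pos _).le
    nlinarith [Real.exp_pos (-s)]
  have hint : ∫ p : ℝ≥0, (p : ℝ) * (g - BoundedContinuousFunction.const ℝ≥0 s : ℝ≥0 →ᵇ ℝ) p ∂ρ =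
      ∫ p : ℝ≥0, (p : ℝ) * g p ∂ρ - m * s := by
    simp only [BoundedContinuousFunction.coe_sub, Pi.sub_apply,
      BoundedContinuousFunction.const_apply, mul_sub]
    rw [integral_sub (integrable_mul_bcf h g) ((integrable_speed h).mul_const _),
      integral_mul_const]
  obtain ⟨k, hk, hlt⟩ := exists_admissible_lt hφ h hgs hc0 hc
    (L := ∫ p : ℝ≥0, (p : ℝ) * g p ∂ρ + ρ.real {0} * c - η) (by rw [hint]; linarith)
  calc ENNReal.ofReal (∫ p : ℝ≥0, (p : ℝ) * g p ∂ρ + ρ.real {0} * c)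
      ≤ ENNReal.ofReal (∫ p, k p ∂ρ + η) := ENNReal.ofReal_le_ofReal (by linarith)
    _ ≤ ENNReal.ofReal (∫ p, k p ∂ρ) + ENNReal.ofReal η := ENNReal.ofReal_add_le
    _ ≤ dualCost φ ρ + η := by
      rw [ENNReal.ofReal_coe_nnreal]
      gcongr
      exact le_dualCost ρ hk

theorem lintegral_exp_zero_div_lt_top (φ : Measure ℝ≥0) [IsFiniteMeasure φ] :
    ∫⁻ p : ℝ≥0, ENNReal.ofReal (Real.exp (0 / (p : ℝ))) ∂φ < ∞ := by
  simp

theorem klDiv_eq_iSup {σ φ : Measure ℝ≥0} [IsProbabilityMeasure σ] [IsProbabilityMeasure φ] :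
    klDiv σ φ = ⨆ g : {g : ℝ≥0 →ᵇ ℝ // ∫ p, Real.exp (g p) ∂φ ≤ 1},
      ENNReal.ofReal (∫ p, g.1 p ∂σ) := by
  have hbi : ∀ g : ℝ≥0 →ᵇ ℝ, Integrable (fun p => Real.exp (g p)) φ := fun g =>
    Integrable.of_bound (Real.continuous_exp.comp g.continuous).aestronglyMeasurable
      (Real.exp ‖g‖) (ae_of_all _ fun p => by
        rw [Real.norm_eq_abs, Real.abs_exp]
        exact Real.exp_le_exp.mpr ((le_abs_self _).trans (g.norm_coe_le_norm p)))
  refine le_antisymm (le_of_forall_lt fun a ha => ?_) (iSup_le fun g => ?_)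
  · have ha_top : a ≠ ∞ := ha.ne_top
    rw [← ENNReal.ofReal_toReal ha_top] at ha ⊢
    obtain ⟨g, hg, hlt⟩ := exists_continuous_lt_integral ENNReal.toReal_nonneg ha
    refine lt_of_lt_of_le ?_ (le_iSup (fun g : {g : ℝ≥0 →ᵇ ℝ // ∫ p, Real.exp (g p) ∂φ ≤ 1} =>
      ENNReal.ofReal (∫ p, g.1 p ∂σ)) ⟨g, hg.le⟩)
    exact (ENNReal.ofReal_lt_ofReal_iff_of_nonneg ENNReal.toReal_nonneg).mpr hlt
  · refine ofReal_integral_le_klDiv g.1.continuous.measurable (g.1.integrable σ) ?_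
    rw [lintegral_exp_eq (hbi _)]
    simpa using g.2

theorem xi_eq_iSup (φ : Measure ℝ≥0) [IsFiniteMeasure φ] :
    xi φ = ⨆ c : {c : ℝ // 0 ≤ c ∧ ∫⁻ p, ENNReal.ofReal (Real.exp (c / (p : ℝ))) ∂φ < ∞},
      ENNReal.ofReal c.1 := by
  refine le_antisymm (iSup₂_le fun c hc => ?_) (iSup_le fun c => le_xi c.2.2)
  rcases le_or_gt 0 c with h | h
  · exact le_iSup (fun c : {c : ℝ // 0 ≤ c ∧
      ∫⁻ p, ENNReal.ofReal (Real.exp (c / (p : ℝ))) ∂φ < ∞} => ENNReal.ofReal c.1) ⟨c, h, hc⟩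
  · simp [ENNReal.ofReal_of_nonpos h.le]

instance (φ : Measure ℝ≥0) [IsFiniteMeasure φ] :
    Nonempty {c : ℝ // 0 ≤ c ∧ ∫⁻ p, ENNReal.ofReal (Real.exp (c / (p : ℝ))) ∂φ < ∞} :=
  ⟨⟨0, le_rfl, lintegral_exp_zero_div_lt_top φ⟩⟩

instance (φ : Measure ℝ≥0) [IsProbabilityMeasure φ] :
    Nonempty {g : ℝ≥0 →ᵇ ℝ // ∫ p, Real.exp (g p) ∂φ ≤ 1} := ⟨⟨0, by simp⟩⟩

/-- Both the entropy and `ξ` are suprema, over `g` and over `c`. A single admissible function can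
realize any pair `(g, c)`, since `c` only prescribes the behaviour at speed `0`, so the sum of the
two suprema is reached. -/
theorem cycleCost_le_dualCost {φ : Measure ℝ≥0} (ρ : Measure ℝ≥0) [IsProbabilityMeasure φ]
    (hφ : φ {0} = 0) [IsFiniteMeasure ρ] (h : meanSpeed ρ < ∞) :
    cycleCost φ ρ ≤ dualCost φ ρ := by
  have hzero : ∀ c : {c : ℝ // 0 ≤ c ∧ ∫⁻ p, ENNReal.ofReal (Real.exp (c / (p : ℝ))) ∂φ < ∞},
      ρ {0} * ENNReal.ofReal c.1 ≤ dualCost φ ρ := by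
    intro c
    have := ofReal_le_dualCost (ρ := ρ) hφ h (g := 0) (by simp) c.2.1 c.2.2
    simpa [ENNReal.ofReal_mul, measureReal_def, ENNReal.ofReal_toReal] using this
  rw [cycleCost, xi_eq_iSup, ENNReal.mul_iSup, ENNReal.add_iSup]
  refine iSup_le fun c => ?_
  rcases eq_or_ne (meanSpeed ρ) 0 with h0 | h0
  · rw [h0, zero_mul, zero_add]
    exact hzero c
  have := isProbabilityMeasure_sizeBias h0 h
  rw [klDiv_eq_iSup, ENNReal.mul_iSup, ENNReal.iSup_add]
  refine iSup_le fun g => ?_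
  -- A `g` with negative integral contributes `0` through `ENNReal.ofReal`, as `g = 0` would.
  rcases le_or_gt 0 (∫ p, g.1 p ∂(sizeBias ρ)) with hs | hs
  · refine le_trans (le_of_eq ?_) (ofReal_le_dualCost (ρ := ρ) hφ h g.2 c.2.1 c.2.2)
    have hm : 0 < (meanSpeed ρ).toReal := ENNReal.toReal_pos h0 h.ne
    have hint : ∫ p : ℝ≥0, (p : ℝ) * g.1 p ∂ρ =
        (meanSpeed ρ).toReal * ∫ p, g.1 p ∂(sizeBias ρ) := by
      rw [integral_sizeBias, ← mul_assoc, mul_inv_cancel₀ hm.ne', one_mul]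
    rw [hint, ENNReal.ofReal_add (by positivity) (mul_nonneg measureReal_nonneg c.2.1),
      ENNReal.ofReal_mul hm.le, ENNReal.ofReal_mul measureReal_nonneg,
      ENNReal.ofReal_toReal h.ne, measureReal_def, ENNReal.ofReal_toReal (measure_ne_top _ _)]
  · rw [ENNReal.ofReal_of_nonpos hs.le, mul_zero, zero_add]
    exact hzero c

theorem dualCost_eq_cycleCost {φ : Measure ℝ≥0} (ρ : Measure ℝ≥0) [IsProbabilityMeasure φ]
    (hφ : φ {0} = 0) [IsFiniteMeasure ρ] (h : meanSpeed ρ < ∞) : dualCost φ ρ = cycleCost φ ρ :=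
  (dualCost_le_cycleCost φ ρ h).antisymm (cycleCost_le_dualCost ρ hφ h)

/-! ### Averages over the box, and occupation measures -/

instance : IsProbabilityMeasure lebesgueIco := by
  constructor
  rw [lebesgueIco, comap_subtype_coe_apply measurableSet_Ico, image_univ, Subtype.range_coe]
  simp

/-- The contraction `u ↦ ℓ u` of `[0,1[`. -/
def scale (ℓ : unitInterval) (u : Set.Ico (0 : ℝ) 1) : Set.Ico (0 : ℝ) 1 :=
  ⟨ℓ * u, mul_nonneg ℓ.2.1 u.2.1,
    lt_of_le_of_lt (mul_le_of_le_one_left u.2.1 ℓ.2.2) u.2.2⟩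

theorem continuous_scale : Continuous fun x : unitInterval × Set.Ico (0 : ℝ) 1 => scale x.1 x.2 := by
  unfold scale
  fun_prop

theorem measurable_scale (ℓ : unitInterval) : Measurable (scale ℓ) :=
  (continuous_scale.comp (Continuous.prodMk_right ℓ)).measurable

theorem scale_one (u : Set.Ico (0 : ℝ) 1) : scale 1 u = u := by
  ext; simp [scale]

/-- As images of Lebesgue measure under `u ↦ ℓ u`, the laws `λ_ℓ` depend continuously on `ℓ`, the
value `ℓ = 0` included. -/
theorem lam_eq_map (ℓ : unitInterval) : lam ℓ = lebesgueIco.map (scale ℓ) := by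
  rcases eq_or_ne (ℓ : ℝ) 0 with h0 | h0
  · have : scale ℓ = fun _ => ⟨0, by simp⟩ := by
      ext u; simp [scale, h0]
    rw [this, lam, if_pos h0, Measure.map_const]
    simp
  · have hpos : 0 < (ℓ : ℝ) := lt_of_le_of_ne ℓ.2.1 (Ne.symm h0)
    rw [lam, if_neg h0]
    ext A hA
    have hB : MeasurableSet {q : Set.Ico (0 : ℝ) 1 | (q : ℝ) < ℓ} :=
      measurableSet_lt measurable_subtype_coe measurable_const
    rw [Measure.map_apply (measurable_scale ℓ) hA, Measure.smul_apply, Measure.restrict_apply hA,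
      lebesgueIco, comap_subtype_coe_apply measurableSet_Ico,
      comap_subtype_coe_apply measurableSet_Ico, smul_eq_mul]
    have : Subtype.val '' (scale ℓ ⁻¹' A) =
        (fun x => (ℓ : ℝ) * x) ⁻¹' (Subtype.val '' (A ∩ {q : Set.Ico (0 : ℝ) 1 | (q : ℝ) < ℓ})) := by
      ext x
      constructor
      · rintro ⟨u, hu, rfl⟩
        refine ⟨scale ℓ u, ⟨hu, ?_⟩, rfl⟩
        exact mul_lt_of_lt_one_right hpos u.2.2
      · rintro ⟨q, ⟨hqA, hq⟩, hqx⟩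
        have hq0 := q.2.1
        have hq' : (q : ℝ) < ℓ := hq
        simp only at hqx
        have hx : x ∈ Set.Ico (0 : ℝ) 1 := by
          constructor <;> by_contra! hcon <;> nlinarith
        refine ⟨⟨x, hx⟩, ?_, rfl⟩
        have : scale ℓ ⟨x, hx⟩ = q := Subtype.ext hqx.symm
        simpa [this] using hqA
    rw [this, Real.volume_preimage_mul_left h0, abs_of_pos (inv_pos.mpr hpos)]

/-- The average of `f(·, p)` over `[0, ℓ[`. -/
def sweep (f : Phase → ℝ) (ℓ : unitInterval) (p : ℝ≥0) : ℝ := ∫ u, f (scale ℓ u, p) ∂lebesgueIco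

theorem continuous_sweep (f : Phase →ᵇ ℝ) :
    Continuous fun x : unitInterval × ℝ≥0 => sweep f x.1 x.2 := by
  refine continuous_of_dominated (bound := fun _ => ‖f‖) (fun x => ?_)
    (fun x => ae_of_all _ fun u => f.norm_coe_le_norm _) (integrable_const _)
    (ae_of_all _ fun u => ?_)
  · exact (f.continuous.comp ((continuous_scale.comp (Continuous.prodMk_right x.1)).prodMk
      continuous_const)).aestronglyMeasurable
  · exact f.continuous.comp ((continuous_scale.comp (continuous_fst.prodMk
      continuous_const)).prodMk continuous_snd)

theorem abs_sweep_le (f : Phase →ᵇ ℝ) (ℓ : unitInterval) (p : ℝ≥0) : |sweep f ℓ p| ≤ ‖f‖ := by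
  refine (norm_integral_le_of_norm_le_const (C := ‖f‖)
    (ae_of_all _ fun u => f.norm_coe_le_norm _)).trans ?_
  simp

/-- The average over the whole box, as a function of the speed. -/
def fullSweep (f : Phase →ᵇ ℝ) : ℝ≥0 →ᵇ ℝ :=
  BoundedContinuousFunction.ofNormedAddCommGroup (fun p => sweep f 1 p)
    ((continuous_sweep f).comp (Continuous.prodMk_right 1)) ‖f‖ fun p => abs_sweep_le f 1 p

theorem fullSweep_apply (f : Phase →ᵇ ℝ) (p : ℝ≥0) : fullSweep f p = sweep f 1 p := rfl

open Classical in
/-- Extension of `f(·, p)` to `ℝ`. -/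
def lineExt (f : Phase → ℝ) (p : ℝ≥0) (y : ℝ) : ℝ :=
  if h : y ∈ Set.Ico (0 : ℝ) 1 then f (⟨y, h⟩, p) else 0

theorem lineExt_of_mem (f : Phase → ℝ) (p : ℝ≥0) {y : ℝ} (h : y ∈ Set.Ico (0 : ℝ) 1) :
    lineExt f p y = f (⟨y, h⟩, p) := dif_pos h

theorem sweep_eq_intervalIntegral (f : Phase → ℝ) (ℓ : unitInterval) (p : ℝ≥0) :
    sweep f ℓ p = ∫ u in (0 : ℝ)..1, lineExt f p (ℓ * u) := by
  rw [intervalIntegral.integral_of_le zero_le_one, ← integral_Ico_eq_integral_Ioc,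
    ← integral_subtype_comap measurableSet_Ico (fun u => lineExt f p (ℓ * u))]
  refine integral_congr_ae (ae_of_all _ fun u => ?_)
  exact (lineExt_of_mem f p (scale ℓ u).2).symm

/-- The substitution `s = T + h u` turns a stretch of time `h` at speed `p` into an average over
`[0, ℓ[`: a cycle contributes its duration times a `sweep`. -/
theorem mul_sweep_eq (f : Phase → ℝ) {ℓ : unitInterval} {p : ℝ≥0} {h : ℝ}
    (hℓ : (ℓ : ℝ) = h * p) (T : ℝ) :
    h * sweep f ℓ p = ∫ s in T..T + h, lineExt f p ((s - T) * p) := by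
  rw [sweep_eq_intervalIntegral, intervalIntegral.integral_comp_sub_right
    (fun s => lineExt f p (s * p)), sub_self, add_sub_cancel_left, hℓ]
  have := intervalIntegral.mul_integral_comp_mul_right (a := 0) (b := 1)
    (f := fun s => lineExt f p (s * p)) h
  rw [zero_mul, one_mul] at this
  rw [← this]
  congr 2
  ext u
  congr 1
  ring

theorem emittedState_eq {T₀ : ℝ} {v : ℕ → ℝ≥0} {n : ℕ} {t : ℝ} (h1 : renewalTime T₀ v n ≤ t)
    (h2 : t < renewalTime T₀ v (n + 1)) : emittedState T₀ v t =
      (⟨(t - renewalTime T₀ v n) * v n,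
        position_mem h1 (renewalTime_succ T₀ v n ▸ h2)⟩, v n) := by
  have huniq : ∀ {m : ℕ}, (renewalTime T₀ v m ≤ t ∧ t < renewalTime T₀ v (m + 1)) → m = n := by
    intro m hm
    rcases lt_trichotomy m n with h | h | h
    · have := renewalTime_mono T₀ v (Nat.succ_le_of_lt h)
      simp only [Nat.succ_eq_add_one] at this
      linarith [hm.2]
    · exact h
    · have := renewalTime_mono T₀ v (Nat.succ_le_of_lt h)
      simp only [Nat.succ_eq_add_one] at this
      linarith [hm.1]
  have ht : ∃ n, renewalTime T₀ v n ≤ t ∧ t < renewalTime T₀ v (n + 1) := ⟨n, h1, h2⟩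
  have hn : ht.choose = n := huniq ht.choose_spec
  refine (dif_pos ht).trans ?_
  simp only [hn]

/-- The description of `Y t` by the completed cycles and the last one, up to the contribution of
times before `T₀`. -/
structure Tracks (T₀ : ℝ) (v : ℕ → ℝ≥0) (Y : ℝ → ProbabilityMeasure Phase) : Prop where
  bound_cycles : ∀ t > 0, ∀ n, renewalTime T₀ v n ≤ t → ∀ f : Phase →ᵇ ℝ,
    |t * ∫ x, f x ∂(Y t : Measure Phase) - ∑ i ∈ Finset.range n, (v i : ℝ)⁻¹ * fullSweep f (v i)|
      ≤ ‖f‖ * (T₀ + (t - renewalTime T₀ v n))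
  bound_all : ∀ t > 0, ∀ n, renewalTime T₀ v n ≤ t → t < renewalTime T₀ v (n + 1) →
    ∀ f : Phase →ᵇ ℝ, ∀ ℓ : unitInterval, (ℓ : ℝ) = (t - renewalTime T₀ v n) * v n →
    |t * ∫ x, f x ∂(Y t : Measure Phase) - ∑ i ∈ Finset.range n, (v i : ℝ)⁻¹ * fullSweep f (v i)
      - (t - renewalTime T₀ v n) * sweep f ℓ (v n)| ≤ ‖f‖ * T₀

theorem integral_occupationProb {x : ℝ → Phase} (hx : Measurable x) {t : ℝ} (ht : 0 < t)
    (f : Phase →ᵇ ℝ) :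
    t * ∫ y, f y ∂(occupationProb x hx t : Measure Phase) = ∫ s in (0 : ℝ)..t, f (x s) := by
  have : (occupationProb x hx t : Measure Phase) = occupation x t := by
    simp [occupationProb, ht]
  rw [this, occupation, integral_smul_measure, integral_map hx.aemeasurable
    f.continuous.aestronglyMeasurable, ENNReal.toReal_ofReal (inv_nonneg.mpr ht.le), smul_eq_mul,
    ← mul_assoc, mul_inv_cancel₀ ht.ne', one_mul, intervalIntegral.integral_of_le ht.le,
    integral_Ico_eq_integral_Ioc]

theorem intervalIntegrable_comp_path {x : ℝ → Phase} (hx : Measurable x) (f : Phase →ᵇ ℝ)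
    (a b : ℝ) : IntervalIntegrable (fun s => f (x s)) volume a b := by
  refine (intervalIntegrable_const (c := ‖f‖)).mono_fun
    (f.continuous.measurable.comp hx).aestronglyMeasurable (ae_of_all _ fun s => ?_)
  simpa using f.norm_coe_le_norm (x s)

theorem abs_integral_comp_path_le (x : ℝ → Phase) (f : Phase →ᵇ ℝ) {a b : ℝ} (hab : a ≤ b) :
    |∫ s in a..b, f (x s)| ≤ ‖f‖ * (b - a) := by
  have := intervalIntegral.norm_integral_le_of_norm_le_const (a := a) (b := b)
    (f := fun s => f (x s)) (C := ‖f‖) (fun s _ => f.norm_coe_le_norm _)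
  rwa [abs_of_nonneg (sub_nonneg.mpr hab)] at this

theorem integral_cycle {T₀ : ℝ} {v : ℕ → ℝ≥0} {x : ℝ → Phase}
    (hx : ∀ s, T₀ ≤ s → x s = emittedState T₀ v s) (f : Phase →ᵇ ℝ) {n : ℕ} {h : ℝ} (hh : 0 ≤ h)
    (hle : h ≤ (v n : ℝ)⁻¹) {ℓ : unitInterval} (hℓ : (ℓ : ℝ) = h * v n) :
    ∫ s in renewalTime T₀ v n..renewalTime T₀ v n + h, f (x s) = h * sweep f ℓ (v n) := by
  rw [mul_sweep_eq (f : Phase → ℝ) hℓ (renewalTime T₀ v n),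
    intervalIntegral.integral_of_le (by linarith), intervalIntegral.integral_of_le (by linarith),
    ← integral_Ico_eq_integral_Ioc, ← integral_Ico_eq_integral_Ioc]
  refine setIntegral_congr_fun measurableSet_Ico fun s hs => ?_
  have h2 : s < renewalTime T₀ v (n + 1) := by
    rw [renewalTime_succ]; linarith [hs.2]
  have h0 : T₀ ≤ renewalTime T₀ v n := by
    simpa [renewalTime] using renewalTime_mono T₀ v (Nat.zero_le n)
  have hs1 := hs.1
  rw [hx s (by linarith), emittedState_eq hs.1 h2, lineExt_of_mem]

/-- The time integral splits into `[0, T₀]`, the completed cycles and the current one; the last two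
are explicit, and the first is at most `‖f‖ T₀`. Only the path after `T₀` matters, so the delayed
and the undelayed process are treated together. -/
theorem tracks_occupationProb {T₀ : ℝ} (hT₀ : 0 ≤ T₀) {v : ℕ → ℝ≥0} {x : ℝ → Phase}
    (hxm : Measurable x) (hx : ∀ s, T₀ ≤ s → x s = emittedState T₀ v s) :
    Tracks T₀ v (occupationProb x hxm) := by
  have h00 : renewalTime T₀ v 0 = T₀ := by simp [renewalTime]
  have hT : ∀ n, T₀ ≤ renewalTime T₀ v n := fun n => by
    simpa [h00] using renewalTime_mono T₀ v (Nat.zero_le n)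
  have hcyc : ∀ (f : Phase →ᵇ ℝ) (n : ℕ), ∫ s in T₀..renewalTime T₀ v n, f (x s) =
      ∑ i ∈ Finset.range n, (v i : ℝ)⁻¹ * fullSweep f (v i) := by
    intro f n
    induction n with
    | zero => simp [h00]
    | succ n ih =>
      rw [← intervalIntegral.integral_add_adjacent_intervals
        (intervalIntegrable_comp_path hxm f _ (renewalTime T₀ v n))
        (intervalIntegrable_comp_path hxm f _ _), ih, Finset.sum_range_succ, renewalTime_succ]
      congr 1
      -- Since `0⁻¹ = 0`, a vanishing speed gives a cycle of zero length.
      rcases eq_or_ne (v n) 0 with hv | hv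
      · simp [hv]
      · exact integral_cycle hx f (inv_nonneg.mpr (v n).coe_nonneg) le_rfl (ℓ := 1)
          (by rw [inv_mul_cancel₀ (by exact_mod_cast hv)]; simp)
  have hsplit : ∀ (f : Phase →ᵇ ℝ) (n : ℕ) (t : ℝ), ∫ s in (0 : ℝ)..t, f (x s) =
      (∫ s in (0 : ℝ)..T₀, f (x s)) + ∑ i ∈ Finset.range n, (v i : ℝ)⁻¹ * fullSweep f (v i) +
      ∫ s in renewalTime T₀ v n..t, f (x s) := by
    intro f n t
    rw [← hcyc, intervalIntegral.integral_add_adjacent_intervals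
      (intervalIntegrable_comp_path hxm f _ _) (intervalIntegrable_comp_path hxm f _ _),
      intervalIntegral.integral_add_adjacent_intervals
      (intervalIntegrable_comp_path hxm f _ _) (intervalIntegrable_comp_path hxm f _ _)]
  constructor
  · intro t ht n hn f
    rw [integral_occupationProb hxm ht, hsplit f n t]
    have h1 := abs_integral_comp_path_le x f hT₀
    have h2 := abs_integral_comp_path_le x f hn
    rw [sub_zero] at h1
    calc _ = |(∫ s in (0 : ℝ)..T₀, f (x s)) + ∫ s in renewalTime T₀ v n..t, f (x s)| := by
          congr 1; ring
      _ ≤ _ := (abs_add_le _ _).trans (by rw [mul_add]; exact add_le_add h1 h2)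
  · intro t ht n hn hn' f ℓ hℓ
    rw [integral_occupationProb hxm ht, hsplit f n t]
    have h1 := abs_integral_comp_path_le x f hT₀
    have h2 := integral_cycle hx f (n := n) (sub_nonneg.mpr hn)
      (by rw [renewalTime_succ] at hn'; linarith) hℓ
    rw [add_sub_cancel] at h2
    rw [sub_zero] at h1
    rw [← h2]
    convert h1 using 2
    ring

theorem tracks_empirical (q₀ : Set.Ico (0 : ℝ) 1) (p₀ : ℝ≥0) (v : ℕ → ℝ≥0) :
    Tracks (firstHit q₀ p₀) v (empirical q₀ p₀ v) := by
  refine tracks_occupationProb (div_nonneg (by linarith [q₀.2.2]) p₀.2)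
    (measurable_state q₀ p₀ v) fun s hs => ?_
  exact dif_neg fun h => absurd h.2 (not_lt.mpr hs)

theorem tracks_undelayedEmpirical (v : ℕ → ℝ≥0) : Tracks 0 v (undelayedEmpirical v) :=
  tracks_occupationProb le_rfl (measurable_emittedState 0 v) fun _ _ => rfl

/-! ### Properties of the cost of the completed cycles -/

/-- Dominated convergence as `b → ∞`. A factor `e^{a - b τ}` per cycle rewards a large number of
cycles against the time they take; with a small mean it shows that many cycles in a short time are
unlikely. -/
theorem exists_lintegral_exp_one_sub_le (φ : Measure ℝ≥0) [IsProbabilityMeasure φ]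
    (hφ : φ {0} = 0) {ε : ℝ≥0∞} (hε : 0 < ε) (a : ℝ) :
    ∃ b : ℝ, 0 ≤ b ∧ ∫⁻ p : ℝ≥0, ENNReal.ofReal (Real.exp (a - b / p)) ∂φ ≤ ε := by
  have hlim : Tendsto (fun n : ℕ => ∫⁻ p : ℝ≥0, ENNReal.ofReal (Real.exp (a - n / p)) ∂φ) atTop
      (𝓝 (∫⁻ _, 0 ∂φ)) := by
    refine tendsto_lintegral_of_dominated_convergence (fun _ => ENNReal.ofReal (Real.exp a))
      (fun n => by fun_prop) (fun n => ae_of_all _ fun p => ?_) (by simp) ?_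
    · refine ENNReal.ofReal_le_ofReal (Real.exp_le_exp.mpr ?_)
      have : 0 ≤ (n : ℝ) / p := by positivity
      linarith
    · have : ∀ᵐ p ∂φ, p ∉ ({0} : Set ℝ≥0) := measure_eq_zero_iff_ae_notMem.mp hφ
      filter_upwards [this] with p hp
      have hp' : (0 : ℝ) < p := by exact_mod_cast pos_iff_ne_zero.mpr hp
      rw [← ENNReal.ofReal_zero]
      refine ENNReal.tendsto_ofReal (Real.tendsto_exp_atBot.comp ?_)
      exact tendsto_atBot_add_const_left _ a
        (tendsto_neg_atTop_atBot.comp (tendsto_natCast_atTop_atTop.atTop_div_const hp'))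
  rw [lintegral_zero] at hlim
  obtain ⟨n, hn⟩ := (hlim.eventually_lt_const hε).exists
  exact ⟨n, Nat.cast_nonneg n, hn.le⟩

/-- `p ↦ min(p, n) - b`. -/
def truncatedSpeed (b : ℝ) (n : ℕ) : ℝ≥0 →ᵇ ℝ :=
  BoundedContinuousFunction.ofNormedAddCommGroup (fun p : ℝ≥0 => min (p : ℝ) n - b) (by fun_prop)
    (n + |b|) (fun p => by
      refine (norm_sub_le _ _).trans (add_le_add ?_ le_rfl)
      rw [Real.norm_eq_abs, abs_of_nonneg (le_min p.coe_nonneg (Nat.cast_nonneg n))]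
      exact min_le_right _ _)

theorem truncatedSpeed_apply (b : ℝ) (n : ℕ) (p : ℝ≥0) :
    truncatedSpeed b n p = min (p : ℝ) n - b := rfl

/-- The cost controls the mean speed. -/
theorem exists_meanSpeed_le (φ : Measure ℝ≥0) [IsProbabilityMeasure φ] (hφ : φ {0} = 0) :
    ∃ b : ℝ≥0, ∀ (ρ : Measure ℝ≥0) [IsFiniteMeasure ρ],
      meanSpeed ρ ≤ dualCost φ ρ + b * ρ univ := by
  obtain ⟨b, hb0, hb⟩ := exists_lintegral_exp_one_sub_le φ hφ one_pos 1
  lift b to ℝ≥0 using hb0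
  refine ⟨b, fun ρ _ => ?_⟩
  -- For `p > 0` the exponent `(min(p, n) - b)/p` is at most `1 - b/p`, whose exponential moment is
  -- at most `1` by the choice of `b`. Letting `n → ∞` then bounds the mean speed.
  have hadm : ∀ n : ℕ, Admissible φ (truncatedSpeed b n) := by
    intro n
    refine le_trans (lintegral_mono_ae ?_) hb
    have : ∀ᵐ p ∂φ, p ∉ ({0} : Set ℝ≥0) := measure_eq_zero_iff_ae_notMem.mp hφ
    filter_upwards [this] with p hp
    have hp' : (0 : ℝ) < p := by exact_mod_cast pos_iff_ne_zero.mpr hp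
    refine ENNReal.ofReal_le_ofReal (Real.exp_le_exp.mpr ?_)
    rw [truncatedSpeed_apply, sub_div]
    have := (div_le_one hp').mpr (min_le_left (p : ℝ) n)
    linarith
  have hbound : ∀ n : ℕ, ∫⁻ p : ℝ≥0, ENNReal.ofReal (min (p : ℝ) n) ∂ρ ≤
      dualCost φ ρ + b * ρ univ := by
    intro n
    have hi : Integrable (fun p : ℝ≥0 => min (p : ℝ) n) ρ :=
      Integrable.of_bound (by fun_prop) n (ae_of_all _ fun p => by
        rw [Real.norm_eq_abs, abs_of_nonneg (le_min p.coe_nonneg (Nat.cast_nonneg n))]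
        exact min_le_right _ _)
    rw [← ofReal_integral_eq_lintegral_ofReal hi
      (ae_of_all _ fun p => le_min p.coe_nonneg (Nat.cast_nonneg n))]
    have h1 : ∫ p, truncatedSpeed b n p ∂ρ = ∫ p : ℝ≥0, min (p : ℝ) n ∂ρ - ρ.real univ * b := by
      simp_rw [truncatedSpeed_apply]
      rw [integral_sub hi (integrable_const _), integral_const, smul_eq_mul]
    have h2 : ∫ p : ℝ≥0, min (p : ℝ) n ∂ρ = ∫ p, truncatedSpeed b n p ∂ρ + ρ.real univ * b := by
      rw [h1]; ring
    rw [h2]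
    refine ENNReal.ofReal_add_le.trans (add_le_add (le_dualCost ρ (hadm n)) ?_)
    rw [ENNReal.ofReal_mul measureReal_nonneg, measureReal_def,
      ENNReal.ofReal_toReal (measure_ne_top _ _), ENNReal.ofReal_coe_nnreal, mul_comm]
  have hmono : meanSpeed ρ = ⨆ n : ℕ, ∫⁻ p : ℝ≥0, ENNReal.ofReal (min (p : ℝ) n) ∂ρ := by
    rw [← lintegral_iSup (fun n => by fun_prop) (fun m n hmn p => by gcongr)]
    refine lintegral_congr fun p => le_antisymm ?_ (iSup_le fun n => ?_)
    · obtain ⟨N, hN⟩ := exists_nat_ge (p : ℝ)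
      refine le_trans ?_ (le_iSup _ N)
      rw [min_eq_left hN, ENNReal.ofReal_coe_nnreal]
    · rw [← ENNReal.ofReal_coe_nnreal]
      gcongr
      exact min_le_left _ _
  rw [hmono]
  exact iSup_le hbound

theorem dualCost_add_le (φ ρ₁ ρ₂ : Measure ℝ≥0) [IsFiniteMeasure ρ₁] [IsFiniteMeasure ρ₂] :
    dualCost φ (ρ₁ + ρ₂) ≤ dualCost φ ρ₁ + dualCost φ ρ₂ := by
  refine iSup₂_le fun k hk => ?_
  rw [integral_add_measure (k.integrable ρ₁) (k.integrable ρ₂)]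
  exact ENNReal.ofReal_add_le.trans (add_le_add (le_dualCost _ hk) (le_dualCost _ hk))

theorem dualCost_smul_le (φ ρ : Measure ℝ≥0) (c : ℝ≥0) :
    dualCost φ (c • ρ) ≤ c * dualCost φ ρ := by
  refine iSup₂_le fun k hk => ?_
  rw [integral_smul_nnreal_measure, NNReal.smul_def, smul_eq_mul, ENNReal.ofReal_mul c.coe_nonneg,
    ENNReal.ofReal_coe_nnreal]
  exact mul_le_mul_right (le_dualCost _ hk) _

/-! ### Lower semicontinuity and compactness -/

/-- Multiplication is discontinuous at `(0, ∞)`, but a product that exceeds `a` has nonzero factors.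
It is then continuous at these factors, and slightly smaller ones still have a product above `a`. -/
theorem lowerSemicontinuous_ennreal_mul {X : Type*} [TopologicalSpace X] {f g : X → ℝ≥0∞}
    (hf : LowerSemicontinuous f) (hg : LowerSemicontinuous g) :
    LowerSemicontinuous fun x => f x * g x := by
  intro x a ha
  have ha' : a < f x * g x := ha
  have hf0 : f x ≠ 0 := by rintro h; simp [h] at ha'
  have hg0 : g x ≠ 0 := by rintro h; simp [h] at ha'
  have hlim : Tendsto (fun p : ℝ≥0∞ × ℝ≥0∞ => p.1 * p.2) (𝓝[<] (f x) ×ˢ 𝓝[<] (g x))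
      (𝓝 (f x * g x)) := by
    refine (ENNReal.tendsto_mul (Or.inl hf0) (Or.inl hg0)).mono_left ?_
    rw [nhds_prod_eq]
    exact prod_mono nhdsWithin_le_nhds nhdsWithin_le_nhds
  have h1 : (𝓝[<] (f x)).NeBot := nhdsLT_neBot_of_exists_lt ⟨0, pos_iff_ne_zero.mpr hf0⟩
  have h2 : (𝓝[<] (g x)).NeBot := nhdsLT_neBot_of_exists_lt ⟨0, pos_iff_ne_zero.mpr hg0⟩
  have h3 : ∀ᶠ p : ℝ≥0∞ × ℝ≥0∞ in 𝓝[<] (f x) ×ˢ 𝓝[<] (g x), p.1 < f x ∧ p.2 < g x :=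
    prod_mem_prod self_mem_nhdsWithin self_mem_nhdsWithin
  obtain ⟨p, hp, hp1, hp2⟩ := ((hlim.eventually_const_lt ha').and h3).exists
  filter_upwards [hf x _ hp1, hg x _ hp2] with y h1 h2
  exact hp.trans_le (mul_le_mul' h1.le h2.le)

/-- Sub-probability measures: the occupation measures of the speeds in the completed cycles. -/
abbrev SubProb : Type := {ρ : FiniteMeasure ℝ≥0 // ρ.mass ≤ 1}

/-- The occupation measure of the completed cycles, and the final position. -/
abbrev Config : Type := SubProb × unitInterval

theorem lowerSemicontinuous_dualCost (φ : Measure ℝ≥0) :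
    LowerSemicontinuous fun ρ : FiniteMeasure ℝ≥0 => dualCost φ ρ := by
  refine lowerSemicontinuous_iSup fun k => lowerSemicontinuous_iSup fun _ => ?_
  exact (ENNReal.continuous_ofReal.comp
    (FiniteMeasure.continuous_integral_boundedContinuousFunction k)).lowerSemicontinuous

/-- Markov's inequality bounds the mass of speeds above `n + 1` by `R / (n + 1)`, which is
tightness. -/
theorem isCompact_meanSpeed_le (R : ℝ≥0) :
    ∃ K : Set SubProb, IsCompact K ∧ ∀ ρ : SubProb, meanSpeed (ρ.1 : Measure ℝ≥0) ≤ R → ρ ∈ K := by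
  have hu : Tendsto (fun n : ℕ => R / ((n : ℝ≥0) + 1)) atTop (𝓝 0) := by
    have := (tendsto_one_div_add_atTop_nhds_zero_nat (𝕜 := ℝ≥0)).const_mul R
    simpa [div_eq_mul_inv] using this
  have hC := isCompact_setOfPred_finiteMeasure_mass_le_compl_isCompact_le (E := ℝ≥0)
    (K := fun n : ℕ => Icc 0 ((n : ℝ≥0) + 1)) 1 hu (fun n => isCompact_Icc) (Or.inl inferInstance)
  refine ⟨Subtype.val ⁻¹' {μ : FiniteMeasure ℝ≥0 | μ.mass ≤ 1 ∧
    ∀ n : ℕ, μ (Icc 0 ((n : ℝ≥0) + 1))ᶜ ≤ R / ((n : ℝ≥0) + 1)}, ?_, fun ρ hρ => ⟨ρ.2, fun n => ?_⟩⟩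
  · rw [Topology.IsEmbedding.subtypeVal.isCompact_iff]
    convert hC using 1
    ext μ
    constructor
    · rintro ⟨ν, hν, rfl⟩
      exact hν
    · exact fun hμ => ⟨⟨μ, hμ.1⟩, hμ, rfl⟩
  · have hn : (0 : ℝ≥0) < n + 1 := by positivity
    rw [le_div_iff₀ hn, mul_comm, ← ENNReal.coe_le_coe]
    push_cast
    rw [FiniteMeasure.ennreal_coeFn_eq_coeFn_toMeasure]
    refine le_trans ?_ hρ
    refine le_trans (mul_le_mul_right (measure_mono fun p hp => ?_) _)
      (mul_meas_ge_le_lintegral (μ := (ρ.1 : Measure ℝ≥0)) (f := fun p : ℝ≥0 => (p : ℝ≥0∞))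
        (by fun_prop) ((n : ℝ≥0∞) + 1))
    simp only [mem_compl_iff, mem_Icc, zero_le, true_and, not_le] at hp
    change (n : ℝ≥0∞) + 1 ≤ p
    exact_mod_cast hp.le

/-- Contraction principle. The infimum over a fibre is attained when finite, so the sublevel sets of
the contracted functional are the images of those of `J`. -/
theorem isGood_iInf_fiber {X E : Type*} [TopologicalSpace X] [TopologicalSpace E] [T2Space E]
    {Ψ : X → E} (hΨ : Continuous Ψ) {J : X → ℝ≥0∞} (hJ : LowerSemicontinuous J)
    (hc : ∀ M : ℝ≥0, IsCompact {x | J x ≤ M}) :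
    IsGood (fun μ => ⨅ (x) (_ : Ψ x = μ), J x) ∧
      LowerSemicontinuous fun μ => ⨅ (x) (_ : Ψ x = μ), J x := by
  have heq : ∀ M : ℝ≥0, {μ | ⨅ (x) (_ : Ψ x = μ), J x ≤ M} = Ψ '' {x | J x ≤ M} := by
    intro M
    ext μ
    constructor
    · intro hμ
      have hμ' : ⨅ (x) (_ : Ψ x = μ), J x ≤ M := hμ
      -- The level `M + 1` guarantees that the compact set on which the minimum is sought is
      -- nonempty.
      have hlt : ⨅ (x) (_ : Ψ x = μ), J x < (M + 1 : ℝ≥0) :=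
        hμ'.trans_lt (by exact_mod_cast lt_add_one M)
      simp only [iInf_lt_iff] at hlt
      obtain ⟨x₀, hx₀, hJx₀⟩ := hlt
      have hK : IsCompact ({x | J x ≤ (M + 1 : ℝ≥0)} ∩ Ψ ⁻¹' {μ}) :=
        (hc (M + 1)).inter_right (isClosed_singleton.preimage hΨ)
      have hne : ({x | J x ≤ (M + 1 : ℝ≥0)} ∩ Ψ ⁻¹' {μ}).Nonempty := ⟨x₀, hJx₀.le, hx₀⟩
      obtain ⟨x, hx, hmin⟩ := (hJ.lowerSemicontinuousOn _).exists_isMinOn hne hK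
      refine ⟨x, ?_, hx.2⟩
      refine le_trans (le_iInf₂ fun y hy => ?_) hμ'
      rcases le_or_gt (J y) (M + 1 : ℝ≥0) with h | h
      · exact hmin ⟨h, hy⟩
      · exact hx.1.trans h.le
    · rintro ⟨x, hx, rfl⟩
      exact (iInf₂_le (f := fun x' (_ : Ψ x' = Ψ x) => J x') x rfl).trans hx
  have hgood : IsGood (fun μ => ⨅ (x) (_ : Ψ x = μ), J x) := fun M => by
    rw [heq]
    exact (hc M).image hΨ
  refine ⟨hgood, lowerSemicontinuous_iff_isClosed_preimage.mpr fun y => ?_⟩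
  induction y with
  | top => simp
  | coe M => exact (hgood M).isClosed

/-! ### The parametrization of `Ω` -/

/-- The mass of the last, incomplete cycle. -/
def restMass (ρ : SubProb) : ℝ≥0 := 1 - ρ.1.mass

theorem mass_add_restMass (ρ : SubProb) : ρ.1.mass + restMass ρ = 1 := add_tsub_cancel_of_le ρ.2

theorem coe_restMass (ρ : SubProb) : (restMass ρ : ℝ) = 1 - ρ.1.mass := NNReal.coe_sub ρ.2

theorem nnreal_smul_apply {X : Type*} [MeasurableSpace X] (c : ℝ≥0) (μ : Measure X) (s : Set X) :
    (c • μ) s = c * μ s := rfl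

theorem continuous_restMass : Continuous restMass :=
  continuous_const.sub (FiniteMeasure.continuous_mass.comp continuous_subtype_val)

instance isProbabilityMeasure_lam (ℓ : unitInterval) : IsProbabilityMeasure (lam ℓ) := by
  rw [lam_eq_map]
  exact Measure.isProbabilityMeasure_map (measurable_scale ℓ).aemeasurable

/-- The measure `dq ⊗ ρ + (1 - ρ(1)) λ_ℓ ⊗ δ₀`. -/
def mixture (x : Config) : Measure Phase :=
  lebesgueIco.prod (x.1.1 : Measure ℝ≥0) + restMass x.1 • (lam x.2).prod (Measure.dirac 0)

instance (x : Config) : IsProbabilityMeasure (mixture x) := by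
  constructor
  have : ((x.1.1.mass + restMass x.1 : ℝ≥0) : ℝ≥0∞) = 1 := by rw [mass_add_restMass]; rfl
  have h : (lebesgueIco.prod (x.1.1 : Measure ℝ≥0)) univ = x.1.1.mass := by
    rw [← univ_prod_univ, Measure.prod_prod, measure_univ, one_mul, FiniteMeasure.ennreal_mass]
  rw [mixture, Measure.add_apply, nnreal_smul_apply, h, measure_univ, mul_one, ← this]
  push_cast
  rfl

/-- `mixture` as a probability measure. -/
def mixtureProb (x : Config) : ProbabilityMeasure Phase := ⟨mixture x, inferInstance⟩

theorem integral_lebesgueIco_prod (ρ : Measure ℝ≥0) [IsFiniteMeasure ρ] (f : Phase →ᵇ ℝ) :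
    ∫ x, f x ∂(lebesgueIco.prod ρ) = ∫ p, fullSweep f p ∂ρ := by
  rw [integral_prod_symm _ (f.integrable _)]
  refine integral_congr_ae (ae_of_all _ fun p => ?_)
  simp only [fullSweep_apply, sweep, scale_one]

theorem integral_lam_prod_dirac (ℓ : unitInterval) (p : ℝ≥0) (f : Phase →ᵇ ℝ) :
    ∫ x, f x ∂((lam ℓ).prod (Measure.dirac p)) = sweep f ℓ p := by
  rw [Measure.prod_dirac, lam_eq_map, integral_map (by fun_prop) f.continuous.aestronglyMeasurable,
    integral_map (f := fun y => f (y, p)) (measurable_scale ℓ).aemeasurable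
    (f.continuous.comp (Continuous.prodMk_left p)).aestronglyMeasurable]
  rfl

theorem integral_mixture (x : Config) (f : Phase →ᵇ ℝ) :
    ∫ y, f y ∂(mixture x) = ∫ p, fullSweep f p ∂(x.1.1 : Measure ℝ≥0) +
      restMass x.1 * sweep f x.2 0 := by
  rw [mixture, integral_add_measure (f.integrable _) (f.integrable _), integral_lebesgueIco_prod,
    integral_smul_nnreal_measure, integral_lam_prod_dirac]
  rfl

theorem continuous_mixtureProb : Continuous mixtureProb := by
  rw [ProbabilityMeasure.continuous_iff_forall_continuous_integral]
  intro f
  change Continuous fun x => ∫ y, f y ∂(mixture x)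
  simp_rw [integral_mixture]
  refine Continuous.add ?_ (Continuous.mul ?_ ?_)
  · exact (FiniteMeasure.continuous_integral_boundedContinuousFunction (fullSweep f)).comp
      (continuous_subtype_val.comp continuous_fst)
  · exact NNReal.continuous_coe.comp (continuous_restMass.comp continuous_fst)
  · exact (continuous_sweep f).comp (continuous_snd.prodMk continuous_const)

/-! ### Costs of configurations: semicontinuity and compactness -/

/-- The cost of a configuration in the upper bound. -/
def upperJ (φ : Measure ℝ≥0) (x : Config) : ℝ≥0∞ :=
  dualCost φ (x.1.1 : Measure ℝ≥0) + restMass x.1 * (ENNReal.ofReal x.2)⁻¹ * xi φ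

open Classical in
/-- The cost of a configuration in the lower bound. -/
def lowerJ (φ : Measure ℝ≥0) (x : Config) : ℝ≥0∞ :=
  dualCost φ (x.1.1 : Measure ℝ≥0) +
    restMass x.1 * (ENNReal.ofReal x.2)⁻¹ * (if x.2 < 1 then xiBar φ else xi φ)

theorem lowerSemicontinuous_dualCost_fst (φ : Measure ℝ≥0) :
    LowerSemicontinuous fun x : Config => dualCost φ (x.1.1 : Measure ℝ≥0) :=
  (lowerSemicontinuous_dualCost φ).comp (continuous_subtype_val.comp continuous_fst)

theorem lowerSemicontinuous_rest :
    LowerSemicontinuous fun x : Config => (restMass x.1 : ℝ≥0∞) * (ENNReal.ofReal x.2)⁻¹ := by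
  refine lowerSemicontinuous_ennreal_mul (Continuous.lowerSemicontinuous ?_)
    (Continuous.lowerSemicontinuous ?_)
  · exact ENNReal.continuous_coe.comp (continuous_restMass.comp continuous_fst)
  · exact (ENNReal.continuous_ofReal.comp (continuous_subtype_val.comp continuous_snd)).inv

theorem lowerSemicontinuous_upperJ (φ : Measure ℝ≥0) : LowerSemicontinuous (upperJ φ) :=
  (lowerSemicontinuous_dualCost_fst φ).add
    (lowerSemicontinuous_ennreal_mul lowerSemicontinuous_rest lowerSemicontinuous_const)

/-- At `ℓ = 1` the last slab is the uniform measure on the box at speed `0`, which costs `ξ` and not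
`ξ̄`. The jump of the factor at `ℓ = 1` is downwards because `ξ ≤ ξ̄`, hence harmless. -/
theorem lowerSemicontinuous_lowerJ {φ : Measure ℝ≥0} (h : xi φ ≤ xiBar φ) :
    LowerSemicontinuous (lowerJ φ) := by
  refine (lowerSemicontinuous_dualCost_fst φ).add
    (lowerSemicontinuous_ennreal_mul lowerSemicontinuous_rest fun x a ha => ?_)
  by_cases hx : x.2 < 1
  · have : ∀ᶠ y : Config in 𝓝 x, y.2 < 1 := (continuous_snd.tendsto x).eventually_lt_const hx
    filter_upwards [this] with y hy
    simpa [hx, hy] using ha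
  · filter_upwards with y
    have ha' : a < xi φ := by simpa [hx] using ha
    change a < (if y.2 < 1 then xiBar φ else xi φ)
    split_ifs
    · exact ha'.trans_le h
    · exact ha'

theorem upperJ_le_lowerJ {φ : Measure ℝ≥0} (h : xi φ ≤ xiBar φ) (x : Config) :
    upperJ φ x ≤ lowerJ φ x := by
  unfold upperJ lowerJ
  gcongr
  split_ifs
  · exact h
  · rfl

/-- The cost of the cycles bounds their mean speed, which gives tightness; the final position
already lives in a compact interval. -/
theorem isCompact_upperJ_le (φ : Measure ℝ≥0) [IsProbabilityMeasure φ] (hφ : φ {0} = 0)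
    (M : ℝ≥0) : IsCompact {x | upperJ φ x ≤ M} := by
  obtain ⟨b, hb⟩ := exists_meanSpeed_le φ hφ
  obtain ⟨K, hK, hsub⟩ := isCompact_meanSpeed_le (M + b)
  refine (hK.prod isCompact_univ).of_isClosed_subset
    ((lowerSemicontinuous_upperJ φ).isClosed_preimage M) fun x hx => ⟨hsub _ ?_, trivial⟩
  refine (hb x.1.1).trans ?_
  have h1 : dualCost φ (x.1.1 : Measure ℝ≥0) ≤ M := le_self_add.trans hx
  have h2 : (x.1.1 : Measure ℝ≥0) univ ≤ 1 := by
    rw [← FiniteMeasure.ennreal_mass]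
    exact_mod_cast x.1.2
  push_cast
  exact add_le_add h1 (mul_le_of_le_one_right' h2)

theorem isCompact_lowerJ_le {φ : Measure ℝ≥0} [IsProbabilityMeasure φ] (hφ : φ {0} = 0)
    (h : xi φ ≤ xiBar φ) (M : ℝ≥0) : IsCompact {x | lowerJ φ x ≤ M} :=
  (isCompact_upperJ_le φ hφ M).of_isClosed_subset
    ((lowerSemicontinuous_lowerJ h).isClosed_preimage M) fun _ hx => (upperJ_le_lowerJ h _).trans hx

/-! ### From elements of `Ω` to configurations and back -/

/-- The completed cycles of an element of `Ω`. -/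
def OmegaData.cycles (r : OmegaData) : Measure ℝ≥0 := r.α₁ • r.π + r.α₂ • Measure.dirac 0

instance (r : OmegaData) : IsFiniteMeasure r.cycles := by
  have := r.prob
  unfold OmegaData.cycles
  infer_instance

theorem OmegaData.cycles_univ (r : OmegaData) : r.cycles univ + r.α₃ = 1 := by
  have := r.prob
  have h : ((r.α₁ + r.α₂ + r.α₃ : ℝ≥0) : ℝ≥0∞) = 1 := by rw [r.sum_eq]; rfl
  rw [← h]
  rw [OmegaData.cycles, Measure.add_apply, nnreal_smul_apply, nnreal_smul_apply]
  simp

theorem prod_nnreal_smul_right (c : ℝ≥0) (μ : Measure (Set.Ico (0 : ℝ) 1)) [SFinite μ]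
    (ν : Measure ℝ≥0) [IsFiniteMeasure ν] : μ.prod (c • ν) = c • μ.prod ν :=
  Measure.prod_smul_right (c : ℝ≥0∞)

theorem OmegaData.toMeasure_eq (r : OmegaData) :
    r.toMeasure = lebesgueIco.prod r.cycles + r.α₃ • (lam r.ℓ).prod (Measure.dirac 0) := by
  have := r.prob
  rw [OmegaData.toMeasure, OmegaData.cycles, Measure.prod_add, prod_nnreal_smul_right,
    prod_nnreal_smul_right]

theorem meanSpeed_add (μ ν : Measure ℝ≥0) : meanSpeed (μ + ν) = meanSpeed μ + meanSpeed ν :=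
  lintegral_add_measure _ _ _

theorem meanSpeed_smul (c : ℝ≥0) (μ : Measure ℝ≥0) : meanSpeed (c • μ) = c * meanSpeed μ := by
  rw [meanSpeed, lintegral_smul_measure]
  rfl

theorem meanSpeed_dirac_zero : meanSpeed (Measure.dirac 0) = 0 := by
  simp [meanSpeed]

theorem meanSpeed_add_dirac (μ : Measure ℝ≥0) (c : ℝ≥0) :
    meanSpeed (μ + c • Measure.dirac 0) = meanSpeed μ := by
  rw [meanSpeed_add, meanSpeed_smul, meanSpeed_dirac_zero, mul_zero, add_zero]

theorem sizeBias_add_dirac (μ : Measure ℝ≥0) (c : ℝ≥0) :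
    sizeBias (μ + c • Measure.dirac 0) = sizeBias μ := by
  have h : (c • Measure.dirac (0 : ℝ≥0)).withDensity (fun p => (p : ℝ≥0∞)) = 0 := by
    rw [withDensity_eq_zero_iff (by fun_prop)]
    refine Measure.ae_smul_measure ?_ c
    simp [ae_dirac_eq]
  rw [sizeBias, sizeBias, meanSpeed_add_dirac, withDensity_add_measure, h, add_zero]

theorem sizeBias_smul {c : ℝ≥0} (hc : c ≠ 0) (μ : Measure ℝ≥0) :
    sizeBias (c • μ) = sizeBias μ := by
  have h : c • μ = (c : ℝ≥0∞) • μ := rfl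
  rw [sizeBias, sizeBias, meanSpeed_smul, h, withDensity_smul_measure, smul_smul,
    ENNReal.mul_inv (Or.inl (by simpa using hc)) (Or.inl ENNReal.coe_ne_top), mul_right_comm,
    ENNReal.inv_mul_cancel (by simpa using hc) ENNReal.coe_ne_top, one_mul]

theorem OmegaData.lintegral_speed (r : OmegaData) :
    ∫⁻ x, (x.2 : ℝ≥0∞) ∂r.toMeasure = meanSpeed r.cycles := by
  have h1 : ∀ (μ : Measure (Set.Ico (0 : ℝ) 1)) [IsProbabilityMeasure μ] (ν : Measure ℝ≥0)
      [IsFiniteMeasure ν], ∫⁻ x : Phase, (x.2 : ℝ≥0∞) ∂(μ.prod ν) = meanSpeed ν := by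
    intro μ _ ν _
    rw [lintegral_prod _ (by fun_prop)]
    simp [meanSpeed]
  have h2 : IsProbabilityMeasure (lam r.ℓ) :=
    isProbabilityMeasure_lam ⟨r.ℓ, r.ℓ_nonneg, r.ℓ_lt.le⟩
  rw [r.toMeasure_eq, lintegral_add_measure, lintegral_smul_measure, h1, h1, meanSpeed_dirac_zero,
    smul_zero, add_zero]

theorem OmegaData.cycleCost_eq (φ : Measure ℝ≥0) (r : OmegaData) :
    cycleCost φ r.cycles =
      (∫⁻ x, (x.2 : ℝ≥0∞) ∂r.toMeasure) * klDiv (sizeBias r.π) φ + r.α₂ * xi φ := by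
  rw [r.lintegral_speed, cycleCost]
  have hzero : r.cycles {0} = r.α₂ := by
    rw [OmegaData.cycles, Measure.add_apply, nnreal_smul_apply, nnreal_smul_apply, r.pos]
    simp
  rw [hzero, OmegaData.cycles, meanSpeed_add_dirac, meanSpeed_smul, sizeBias_add_dirac]
  -- If `α₁ = 0` the mean speed vanishes and the entropy is irrelevant; otherwise scaling does not
  -- change the size-biased law.
  rcases eq_or_ne r.α₁ 0 with h | h
  · simp [h]
  · rw [sizeBias_smul h]

theorem OmegaData.upperCost_eq (φ : Measure ℝ≥0) (r : OmegaData) :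
    r.upperCost φ = cycleCost φ r.cycles + r.α₃ * (ENNReal.ofReal r.ℓ)⁻¹ * xi φ := by
  rw [r.cycleCost_eq, OmegaData.upperCost]
  ring

theorem OmegaData.lowerCost_eq (φ : Measure ℝ≥0) (r : OmegaData) :
    r.lowerCost φ = cycleCost φ r.cycles + r.α₃ * (ENNReal.ofReal r.ℓ)⁻¹ * xiBar φ := by
  rw [r.cycleCost_eq, OmegaData.lowerCost]

theorem OmegaData.meanSpeed_cycles_lt (r : OmegaData) : meanSpeed r.cycles < ∞ := by
  rw [OmegaData.cycles, meanSpeed_add_dirac, meanSpeed_smul]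
  exact ENNReal.mul_lt_top ENNReal.coe_lt_top r.mean_lt

theorem exists_omegaData (ρ : Measure ℝ≥0) [IsFiniteMeasure ρ] (h : meanSpeed ρ < ∞) (α : ℝ≥0)
    (hα : ρ univ + α = 1) {ℓ : ℝ} (h0 : 0 ≤ ℓ) (h1 : ℓ < 1) :
    ∃ r : OmegaData, r.cycles = ρ ∧ r.α₃ = α ∧ r.ℓ = ℓ := by
  set A : Set ℝ≥0 := {0}ᶜ with hA
  have hAm : MeasurableSet A := (measurableSet_singleton _).compl
  have hsplit : ρ.restrict A + (ρ {0}).toNNReal • Measure.dirac 0 = ρ := by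
    conv_rhs => rw [← Measure.restrict_compl_add_restrict (μ := ρ) (measurableSet_singleton 0)]
    rw [Measure.restrict_singleton]
    congr 1
    change ((ρ {0}).toNNReal : ℝ≥0∞) • Measure.dirac (0 : ℝ≥0) = _
    rw [ENNReal.coe_toNNReal (measure_ne_top _ _)]
  have hsum : (ρ A).toNNReal + (ρ {0}).toNNReal + α = 1 := by
    rw [← ENNReal.coe_inj]
    push_cast
    rw [ENNReal.coe_toNNReal (measure_ne_top _ _), ENNReal.coe_toNNReal (measure_ne_top _ _),
      add_comm (ρ A), measure_add_measure_compl (measurableSet_singleton _), hα]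
  have hmean : meanSpeed (ρ.restrict A) < ∞ :=
    (lintegral_mono' Measure.restrict_le_self le_rfl).trans_lt h
  -- If `ρ` is carried by `0`, a probability on positive speeds is still required; the Dirac mass at
  -- `1` is an arbitrary choice, with weight `0`.
  rcases eq_or_ne (ρ A) 0 with hz | hz
  · refine ⟨⟨(ρ A).toNNReal, (ρ {0}).toNNReal, α, hsum, Measure.dirac 1, inferInstance, by simp,
      by simp [meanSpeed], ℓ, h0, h1⟩, ?_, rfl, rfl⟩
    rw [OmegaData.cycles]
    rw [Measure.restrict_eq_zero.mpr hz, zero_add] at hsplit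
    simp [hz, hsplit]
  · have hc : (ρ A).toNNReal ≠ 0 := by
      rw [Ne, ENNReal.toNNReal_eq_zero_iff]
      simp [hz, measure_ne_top]
    have hcc : ((ρ A).toNNReal : ℝ≥0∞) = ρ A := ENNReal.coe_toNNReal (measure_ne_top _ _)
    refine ⟨⟨(ρ A).toNNReal, (ρ {0}).toNNReal, α, hsum, (ρ A).toNNReal⁻¹ • ρ.restrict A,
      ⟨?_⟩, ?_, ?_, ℓ, h0, h1⟩, ?_, rfl, rfl⟩
    · rw [Measure.smul_apply, Measure.restrict_apply_univ, ENNReal.smul_def, smul_eq_mul,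
        ENNReal.coe_inv hc, hcc]
      exact ENNReal.inv_mul_cancel hz (measure_ne_top _ _)
    · simp [Measure.restrict_apply, hA]
    · rw [meanSpeed_smul]
      exact ENNReal.mul_lt_top ENNReal.coe_lt_top hmean
    · rw [OmegaData.cycles]
      simp only
      rw [smul_smul, mul_inv_cancel₀ hc, one_smul, hsplit]

/-- The configuration of an element of `Ω`. -/
def OmegaData.config (r : OmegaData) : Config :=
  (⟨⟨r.cycles, inferInstance⟩, by
    have h := r.cycles_univ
    refine ENNReal.coe_le_coe.mp ?_
    refine le_of_eq_of_le (FiniteMeasure.ennreal_mass (μ := ⟨r.cycles, inferInstance⟩)) ?_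
    exact (le_self_add).trans h.le⟩, ⟨r.ℓ, r.ℓ_nonneg, r.ℓ_lt.le⟩)

theorem restMass_eq_of_add_eq {ρ : SubProb} {α : ℝ≥0} (h : (ρ.1 : Measure ℝ≥0) univ + α = 1) :
    restMass ρ = α := by
  have h' : ρ.1.mass + α = 1 := by
    rw [← ENNReal.coe_inj]
    push_cast
    rw [FiniteMeasure.ennreal_mass, h]
  exact (tsub_eq_of_eq_add_rev h'.symm)

theorem OmegaData.restMass_config (r : OmegaData) : restMass r.config.1 = r.α₃ :=
  restMass_eq_of_add_eq r.cycles_univ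

theorem OmegaData.mixture_config (r : OmegaData) : mixture r.config = r.toMeasure := by
  rw [r.toMeasure_eq, mixture, r.restMass_config]
  rfl

theorem univ_add_restMass (ρ : SubProb) : (ρ.1 : Measure ℝ≥0) univ + restMass ρ = 1 := by
  have := congrArg (fun a : ℝ≥0 => (a : ℝ≥0∞)) (mass_add_restMass ρ)
  simpa using this

theorem mixture_of_eq_one {x : Config} (h : x.2 = 1) :
    mixture x = lebesgueIco.prod ((x.1.1 : Measure ℝ≥0) + restMass x.1 • Measure.dirac 0) := by
  have : lam ((1 : unitInterval) : ℝ) = lebesgueIco := by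
    rw [lam_eq_map]
    have : scale 1 = id := funext scale_one
    rw [this, Measure.map_id]
  rw [mixture, h, this, Measure.prod_add, prod_nnreal_smul_right]

theorem cycleCost_add_dirac (φ ρ : Measure ℝ≥0) (c : ℝ≥0) :
    cycleCost φ (ρ + c • Measure.dirac 0) = cycleCost φ ρ + c * xi φ := by
  rw [cycleCost, cycleCost, meanSpeed_add_dirac, sizeBias_add_dirac, Measure.add_apply,
    nnreal_smul_apply]
  simp [add_mul, add_assoc]

theorem meanSpeed_lt_top_of_dualCost {φ ρ : Measure ℝ≥0} [IsProbabilityMeasure φ] (hφ : φ {0} = 0)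
    [IsFiniteMeasure ρ] (h : dualCost φ ρ ≠ ∞) : meanSpeed ρ < ∞ := by
  obtain ⟨b, hb⟩ := exists_meanSpeed_le φ hφ
  exact (hb ρ).trans_lt (ENNReal.add_lt_top.mpr ⟨h.lt_top,
    ENNReal.mul_lt_top ENNReal.coe_lt_top (measure_lt_top _ _)⟩)

/-- An element of `Ω` given by a configuration of finite cost. -/
theorem exists_omegaData_of_config {φ : Measure ℝ≥0} [IsProbabilityMeasure φ] (hφ : φ {0} = 0)
    {x : Config} (h : dualCost φ (x.1.1 : Measure ℝ≥0) ≠ ∞) :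
    ∃ r : OmegaData, r.toMeasure = mixture x ∧ r.upperCost φ = upperJ φ x ∧
      r.lowerCost φ = lowerJ φ x := by
  have hm := meanSpeed_lt_top_of_dualCost hφ h
  by_cases hx : x.2 < 1
  · obtain ⟨r, hr1, hr2, hr3⟩ := exists_omegaData (x.1.1 : Measure ℝ≥0) hm (restMass x.1)
      (univ_add_restMass x.1) x.2.2.1 (ℓ := x.2) (by exact_mod_cast hx)
    refine ⟨r, ?_, ?_, ?_⟩
    · rw [r.toMeasure_eq, mixture, hr1, hr2, hr3]
    · rw [r.upperCost_eq, upperJ, hr1, hr2, hr3, dualCost_eq_cycleCost _ hφ hm]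
    · rw [r.lowerCost_eq, lowerJ, hr1, hr2, hr3, dualCost_eq_cycleCost _ hφ hm, if_pos hx]
  -- The value `ℓ = 1` is excluded from the data. Here the rest is a uniform slab at speed `0` and
  -- is moved into `α₂`; then `α₃ = 0`, and `ℓ = 0` is arbitrary because `0 * ∞ = 0`.
  · have hx1 : x.2 = 1 := le_antisymm unitInterval.le_one' (not_lt.mp hx)
    obtain ⟨r, hr1, hr2, hr3⟩ := exists_omegaData
      ((x.1.1 : Measure ℝ≥0) + restMass x.1 • Measure.dirac 0)
      (by rwa [meanSpeed_add_dirac]) 0 (by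
        rw [← univ_add_restMass x.1, Measure.add_apply, nnreal_smul_apply]
        simp) le_rfl zero_lt_one
    refine ⟨r, ?_, ?_, ?_⟩
    · rw [r.toMeasure_eq, mixture_of_eq_one hx1, hr1, hr2, zero_smul, add_zero]
    · rw [r.upperCost_eq, upperJ, hr1, hr2, hr3, dualCost_eq_cycleCost _ hφ hm, hx1,
        cycleCost_add_dirac]
      simp
    · rw [r.lowerCost_eq, lowerJ, hr1, hr2, hr3, dualCost_eq_cycleCost _ hφ hm, hx1,
        cycleCost_add_dirac]
      simp

theorem OmegaData.upperJ_config {φ : Measure ℝ≥0} [IsProbabilityMeasure φ] (hφ : φ {0} = 0)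
    (r : OmegaData) : upperJ φ r.config = r.upperCost φ := by
  rw [r.upperCost_eq, upperJ, r.restMass_config,
    ← dualCost_eq_cycleCost _ hφ r.meanSpeed_cycles_lt]
  rfl

theorem OmegaData.lowerJ_config {φ : Measure ℝ≥0} [IsProbabilityMeasure φ] (hφ : φ {0} = 0)
    (r : OmegaData) : lowerJ φ r.config = r.lowerCost φ := by
  have : r.config.2 < 1 := r.ℓ_lt
  rw [r.lowerCost_eq, lowerJ, r.restMass_config, if_pos this,
    ← dualCost_eq_cycleCost _ hφ r.meanSpeed_cycles_lt]
  rfl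

/-! ### The rates as contractions of costs on configurations -/

theorem mixtureProb_eq_iff {x : Config} {μ : ProbabilityMeasure Phase} :
    mixtureProb x = μ ↔ mixture x = (μ : Measure Phase) :=
  ⟨fun h => h ▸ rfl, fun h => Subtype.ext h⟩

/-- Configurations of infinite cycle cost do not affect the infimum, and each of the others comes
from data in `Ω` with the same measure and cost; conversely, data define a configuration. Goodness
and semicontinuity of the rate are thereby reduced to those of `upperJ`. -/
theorem rateI_eq (φ : Measure ℝ≥0) [IsProbabilityMeasure φ] (hφ : φ {0} = 0) :
    rateI φ = fun μ => ⨅ (x) (_ : mixtureProb x = μ), upperJ φ x := by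
  ext μ
  refine le_antisymm (le_iInf₂ fun x hx => ?_) (le_iInf₂ fun r hr => ?_)
  · by_cases h : dualCost φ (x.1.1 : Measure ℝ≥0) = ∞
    · simp [upperJ, h]
    · obtain ⟨r, hr, hr1, -⟩ := exists_omegaData_of_config hφ h
      rw [← hr1]
      exact iInf₂_le r (hr.trans (mixtureProb_eq_iff.mp hx))
  · rw [← r.upperJ_config hφ]
    exact iInf₂_le r.config (mixtureProb_eq_iff.mpr (r.mixture_config.trans hr))

theorem rateIBar_eq (φ : Measure ℝ≥0) [IsProbabilityMeasure φ] (hφ : φ {0} = 0) :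
    rateIBar φ = fun μ => ⨅ (x) (_ : mixtureProb x = μ), lowerJ φ x := by
  ext μ
  refine le_antisymm (le_iInf₂ fun x hx => ?_) (le_iInf₂ fun r hr => ?_)
  · by_cases h : dualCost φ (x.1.1 : Measure ℝ≥0) = ∞
    · simp [lowerJ, h]
    · obtain ⟨r, hr, -, hr1⟩ := exists_omegaData_of_config hφ h
      rw [← hr1]
      exact iInf₂_le r (hr.trans (mixtureProb_eq_iff.mp hx))
  · rw [← r.lowerJ_config hφ]
    exact iInf₂_le r.config (mixtureProb_eq_iff.mpr (r.mixture_config.trans hr))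

theorem isGood_rateI (φ : Measure ℝ≥0) [IsProbabilityMeasure φ] (hφ : φ {0} = 0) :
    IsGood (rateI φ) ∧ LowerSemicontinuous (rateI φ) := by
  rw [rateI_eq φ hφ]
  exact isGood_iInf_fiber continuous_mixtureProb (lowerSemicontinuous_upperJ φ)
    (isCompact_upperJ_le φ hφ)

theorem lowerSemicontinuous_rateIBar {φ : Measure ℝ≥0} [IsProbabilityMeasure φ] (hφ : φ {0} = 0)
    (h : xi φ ≤ xiBar φ) : LowerSemicontinuous (rateIBar φ) := by
  rw [rateIBar_eq φ hφ]
  exact (isGood_iInf_fiber continuous_mixtureProb (lowerSemicontinuous_lowerJ h)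
    (isCompact_lowerJ_le hφ h)).2

/-! ### Logarithmic rates -/

theorem coe_mul_log_ofReal_exp {s c : ℝ} :
    ((s : ℝ) : EReal) * ENNReal.log (ENNReal.ofReal (Real.exp c)) = ((s * c : ℝ) : EReal) := by
  rw [ENNReal.log_ofReal, if_neg (not_le.mpr (Real.exp_pos _)), Real.log_exp, EReal.coe_mul]

theorem coe_mul_log_le {s c : ℝ} (hs : 0 ≤ s) {p : ℝ≥0∞} (h : p ≤ ENNReal.ofReal (Real.exp c)) :
    ((s : ℝ) : EReal) * ENNReal.log p ≤ ((s * c : ℝ) : EReal) := by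
  rw [← coe_mul_log_ofReal_exp]
  exact mul_le_mul_of_nonneg_left (ENNReal.log_monotone h) (EReal.coe_nonneg.mpr hs)

theorem le_coe_mul_log {s c : ℝ} (hs : 0 ≤ s) {p : ℝ≥0∞} (h : ENNReal.ofReal (Real.exp c) ≤ p) :
    ((s * c : ℝ) : EReal) ≤ ((s : ℝ) : EReal) * ENNReal.log p := by
  rw [← coe_mul_log_ofReal_exp]
  exact mul_le_mul_of_nonneg_left (ENNReal.log_monotone h) (EReal.coe_nonneg.mpr hs)

theorem logRate_nonpos {E : Type*} {P : ℝ → Set E → ℝ≥0∞} {t : ℝ} (ht : 0 ≤ t) {A : Set E}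
    (h : P t A ≤ 1) : logRate P t A ≤ 0 := by
  have := coe_mul_log_le (c := 0) (inv_nonneg.mpr ht) (p := P t A) (by simpa using h)
  simpa [logRate] using this

/-- `p t = O(e^{-a t})` as `t → ∞`. -/
def ExpDecay (p : ℝ → ℝ≥0∞) (a : ℝ) : Prop :=
  ∃ K : ℝ≥0, ∀ᶠ t in atTop, p t ≤ K * ENNReal.ofReal (Real.exp (-(a * t)))

theorem ExpDecay.mono {p q : ℝ → ℝ≥0∞} {a : ℝ} (h : ExpDecay q a) (hpq : ∀ᶠ t in atTop, p t ≤ q t) :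
    ExpDecay p a := by
  obtain ⟨K, hK⟩ := h
  exact ⟨K, by filter_upwards [hK, hpq] with t h1 h2 using h2.trans h1⟩

theorem ExpDecay.add {p q : ℝ → ℝ≥0∞} {a : ℝ} (hp : ExpDecay p a) (hq : ExpDecay q a) :
    ExpDecay (fun t => p t + q t) a := by
  obtain ⟨K, hK⟩ := hp
  obtain ⟨L, hL⟩ := hq
  refine ⟨K + L, ?_⟩
  filter_upwards [hK, hL] with t h1 h2
  rw [ENNReal.coe_add, add_mul]
  exact add_le_add h1 h2

theorem limsup_logRate_le {E : Type*} {P : ℝ → Set E → ℝ≥0∞} {A : Set E} {a : ℝ}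
    (h : ExpDecay (fun t => P t A) a) :
    limsup (fun t => logRate P t A) atTop ≤ ((-a : ℝ) : EReal) := by
  obtain ⟨K, hK⟩ := h
  -- The prefactor is absorbed by `K ≤ e^K`, which adds `K / t` to the rate.
  have hlim : Tendsto (fun t : ℝ => ((t⁻¹ * (K - a * t) : ℝ) : EReal)) atTop
      (𝓝 ((-a : ℝ) : EReal)) := by
    rw [EReal.tendsto_coe]
    have h1 : Tendsto (fun t : ℝ => t⁻¹ * (K : ℝ) - a) atTop (𝓝 (0 * K - a)) :=
      (tendsto_inv_atTop_zero.mul_const _).sub_const a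
    rw [zero_mul, zero_sub] at h1
    refine h1.congr' ?_
    filter_upwards [eventually_gt_atTop 0] with t ht
    field_simp
  rw [← hlim.limsup_eq]
  refine limsup_le_limsup ?_
  filter_upwards [hK, eventually_gt_atTop 0] with t ht ht0
  refine coe_mul_log_le (inv_nonneg.mpr ht0.le) (ht.trans ?_)
  rw [sub_eq_add_neg, Real.exp_add, ENNReal.ofReal_mul (Real.exp_pos _).le]
  gcongr
  rw [← ENNReal.ofReal_coe_nnreal]
  refine ENNReal.ofReal_le_ofReal ?_
  linarith [Real.add_one_le_exp (K : ℝ)]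

/-! ### Comparison of `ξ` and `ξ̄` -/

/-- The window `[ε(1-δ), ε(1+δ)[`. -/
def window (δ ε : ℝ) : Set ℝ≥0 := {p | ε * (1 - δ) ≤ (p : ℝ) ∧ (p : ℝ) < ε * (1 + δ)}

theorem measurableSet_window (δ ε : ℝ) : MeasurableSet (window δ ε) :=
  (measurableSet_le measurable_const measurable_coe_nnreal_real).inter
    (measurableSet_lt measurable_coe_nnreal_real measurable_const)

/-- Markov's inequality for `e^{c/p}`, which is at least `e^{c/(ε(1+δ))}` on the window. -/
theorem measure_window_le (φ : Measure ℝ≥0) {c δ ε : ℝ} (hc : 0 ≤ c) (hδ : δ < 1) (hε : 0 < ε) :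
    φ (window δ ε) ≤ (∫⁻ p : ℝ≥0, ENNReal.ofReal (Real.exp (c / p)) ∂φ) *
      ENNReal.ofReal (Real.exp (-(c / (ε * (1 + δ))))) := by
  have h1 := mul_meas_ge_le_lintegral (μ := φ)
    (f := fun p : ℝ≥0 => ENNReal.ofReal (Real.exp (c / p))) (by fun_prop)
    (ENNReal.ofReal (Real.exp (c / (ε * (1 + δ)))))
  have h2 : window δ ε ⊆ {p : ℝ≥0 | ENNReal.ofReal (Real.exp (c / (ε * (1 + δ)))) ≤
      ENNReal.ofReal (Real.exp (c / p))} := by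
    intro p hp
    refine ENNReal.ofReal_le_ofReal (Real.exp_le_exp.mpr ?_)
    have : (0 : ℝ) < p := lt_of_lt_of_le (mul_pos hε (by linarith)) hp.1
    exact div_le_div_of_nonneg_left hc this hp.2.le
  calc φ (window δ ε)
      = ENNReal.ofReal (Real.exp (c / (ε * (1 + δ)))) * φ (window δ ε) *
        ENNReal.ofReal (Real.exp (-(c / (ε * (1 + δ))))) := by
        rw [mul_right_comm, ← ENNReal.ofReal_mul (Real.exp_pos _).le, ← Real.exp_add]
        simp
    _ ≤ _ := by
        gcongr
        exact le_trans (by gcongr) h1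

theorem windowRate_nonpos (φ : Measure ℝ≥0) [IsProbabilityMeasure φ] (δ : ℝ) :
    windowRate φ δ ≤ 0 := by
  have : windowRate φ δ ≤ liminf (fun _ : ℝ => (0 : EReal)) (𝓝[>] 0) := by
    refine liminf_le_liminf ?_
    filter_upwards [self_mem_nhdsWithin] with ε hε
    have := coe_mul_log_le (c := 0) (le_of_lt hε) (p := φ (window δ ε)) (by simpa using prob_le_one)
    rwa [mul_zero] at this
  simpa using this

theorem limsup_window_le (φ : Measure ℝ≥0) {c δ : ℝ} (hc : 0 ≤ c) (hδ0 : 0 < δ) (hδ : δ < 1)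
    (h : ∫⁻ p : ℝ≥0, ENNReal.ofReal (Real.exp (c / p)) ∂φ < ∞) :
    limsup (fun ε : ℝ => (ε : EReal) * ENNReal.log (φ (window δ ε))) (𝓝[>] 0) ≤
      ((-(c / (1 + δ)) : ℝ) : EReal) := by
  lift (∫⁻ p : ℝ≥0, ENNReal.ofReal (Real.exp (c / p)) ∂φ) to ℝ≥0 using h.ne with K hK
  have hlim : Tendsto (fun ε : ℝ => ((ε * K - c / (1 + δ) : ℝ) : EReal)) (𝓝[>] 0)
      (𝓝 ((-(c / (1 + δ)) : ℝ) : EReal)) := by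
    rw [EReal.tendsto_coe]
    have : Tendsto (fun ε : ℝ => ε * K - c / (1 + δ)) (𝓝 0) (𝓝 (0 * K - c / (1 + δ))) :=
      (tendsto_id.mul_const _).sub_const _
    rw [zero_mul, zero_sub] at this
    exact this.mono_left nhdsWithin_le_nhds
  rw [← hlim.limsup_eq]
  refine limsup_le_limsup ?_
  filter_upwards [self_mem_nhdsWithin] with ε hε
  have hε' : (0 : ℝ) < ε := hε
  have hw := measure_window_le φ hc hδ hε'
  rw [← hK] at hw
  have h2 : φ (window δ ε) ≤ ENNReal.ofReal (Real.exp (K - c / (ε * (1 + δ)))) := by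
    refine hw.trans ?_
    rw [sub_eq_add_neg, Real.exp_add, ENNReal.ofReal_mul (Real.exp_pos _).le]
    gcongr
    rw [← ENNReal.ofReal_coe_nnreal]
    exact ENNReal.ofReal_le_ofReal (by linarith [Real.add_one_le_exp (K : ℝ)])
  refine (coe_mul_log_le hε'.le h2).trans_eq ?_
  congr 1
  field_simp

theorem limUnder_windowRate_nonpos (φ : Measure ℝ≥0) [IsProbabilityMeasure φ] :
    limUnder (𝓝[>] (0 : ℝ)) (windowRate φ) ≤ 0 :=
  le_of_tendsto (tendsto_windowRate φ) (Eventually.of_forall (windowRate_nonpos φ))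

/-- The limit of `windowRate` is nonpositive, so nothing is lost by `toENNReal` in the definition of
`ξ̄`. -/
theorem tendsto_windowRate_xiBar (φ : Measure ℝ≥0) [IsProbabilityMeasure φ] :
    Tendsto (windowRate φ) (𝓝[>] 0) (𝓝 (-(xiBar φ : EReal))) := by
  have h : (-(limUnder (𝓝[>] (0 : ℝ)) (windowRate φ))) = (xiBar φ : EReal) := by
    rw [xiBar, EReal.coe_toENNReal]
    rw [EReal.le_neg, neg_zero]
    exact limUnder_windowRate_nonpos φ
  rw [← h, neg_neg]
  exact tendsto_windowRate φ

theorem neg_xiBar_le_windowRate (φ : Measure ℝ≥0) [IsProbabilityMeasure φ] {δ : ℝ} (hδ : 0 < δ) :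
    -(xiBar φ : EReal) ≤ windowRate φ δ := by
  refine le_of_tendsto (tendsto_windowRate_xiBar φ) ?_
  filter_upwards [Ioo_mem_nhdsGT hδ] with δ' hδ'
  exact windowRate_mono φ hδ'.2.le

/-- For any `c` with a finite exponential moment, Markov's inequality bounds even the limsup of the
window rates by `-c/(1+δ)`; then `δ → 0`. -/
theorem xi_le_xiBar (φ : Measure ℝ≥0) [IsProbabilityMeasure φ] : xi φ ≤ xiBar φ := by
  refine iSup₂_le fun c hc => ?_
  rcases le_or_gt c 0 with h0 | h0
  · simp [ENNReal.ofReal_of_nonpos h0]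
  have hlim : Tendsto (fun δ : ℝ => ((-(c / (1 + δ)) : ℝ) : EReal)) (𝓝[>] 0)
      (𝓝 ((-c : ℝ) : EReal)) := by
    rw [EReal.tendsto_coe]
    have h1 : Tendsto (fun δ : ℝ => -(c / (1 + δ))) (𝓝 0) (𝓝 (-(c / (1 + 0)))) :=
      ((tendsto_const_nhds (x := c)).div (tendsto_id.const_add (1 : ℝ)) (by norm_num)).neg
    rw [add_zero, div_one] at h1
    exact h1.mono_left nhdsWithin_le_nhds
  have h := le_of_tendsto_of_tendsto (tendsto_windowRate_xiBar φ) hlim (by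
    filter_upwards [Ioo_mem_nhdsGT one_pos] with δ hδ
    exact (liminf_le_limsup (f := 𝓝[>] (0 : ℝ))).trans
      (limsup_window_le φ h0.le hδ.1 hδ.2 hc))
  rw [EReal.coe_neg, EReal.neg_le_neg_iff] at h
  rw [← EReal.coe_ennreal_le_coe_ennreal_iff, EReal.coe_ennreal_ofReal, max_eq_left h0.le]
  exact h

/-! ### Exponential bounds for the sequence of speeds -/

/-- A sequence of independent variables with law `φ`. -/
structure IsIID {Ω' : Type*} [MeasurableSpace Ω'] (ℙ : Measure Ω') (φ : Measure ℝ≥0)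
    (v : ℕ → Ω' → ℝ≥0) : Prop where
  meas : ∀ i, Measurable (v i)
  law_eq : ∀ i, ℙ.map (v i) = φ
  indep : ProbabilityTheory.iIndepFun v ℙ

section Chain

variable {Ω' : Type*} [MeasurableSpace Ω'] {ℙ : Measure Ω'}
  {φ : Measure ℝ≥0} {v : ℕ → Ω' → ℝ≥0}

/-- The completed cycles and the current one carry different weights, hence the separate factor `G`
for the last variable. -/
theorem IsIID.lintegral_prod_mul (hv : IsIID ℙ φ v) {F G : ℝ≥0 → ℝ≥0∞} (hF : Measurable F)
    (hG : Measurable G) (n : ℕ) :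
    ∫⁻ ω, (∏ i ∈ Finset.range n, F (v i ω)) * G (v n ω) ∂ℙ = (∫⁻ p, F p ∂φ) ^ n * ∫⁻ p, G p ∂φ := by
  let H : ℕ → ℝ≥0 → ℝ≥0∞ := fun i => if i < n then F else G
  have hH : ∀ i, Measurable (H i) := fun i => by dsimp only [H]; split_ifs <;> assumption
  have h := ProbabilityTheory.lintegral_prod_eq_prod_lintegral_of_indepFun (Finset.range (n + 1))
    (fun i => H i ∘ v i) (hv.indep.comp H hH) (fun i => (hH i).comp (hv.meas i))
  have h1 : ∀ i, ∫⁻ ω, (H i ∘ v i) ω ∂ℙ = ∫⁻ p, H i p ∂φ := fun i => by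
    rw [← hv.law_eq i, lintegral_map (hH i) (hv.meas i)]
    rfl
  simp_rw [h1, Finset.prod_range_succ] at h
  have h2 : ∀ i ∈ Finset.range n, H i = F := fun i hi => if_pos (Finset.mem_range.mp hi)
  have h3 : H n = G := if_neg (lt_irrefl n)
  rw [h3, Finset.prod_congr rfl (fun i hi => by rw [h2 i hi])] at h
  rw [Finset.prod_const, Finset.card_range] at h
  rw [← h]
  refine lintegral_congr fun ω => ?_
  exact congrArg (· * _) (Finset.prod_congr rfl fun i hi => by rw [Function.comp_apply, h2 i hi])

theorem IsIID.measure_one_le_prod_mul (hv : IsIID ℙ φ v) {F G : ℝ≥0 → ℝ≥0∞} (hF : Measurable F)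
    (hG : Measurable G) (n : ℕ) :
    ℙ {ω | 1 ≤ (∏ i ∈ Finset.range n, F (v i ω)) * G (v n ω)} ≤
      (∫⁻ p, F p ∂φ) ^ n * ∫⁻ p, G p ∂φ := by
  rw [← hv.lintegral_prod_mul hF hG]
  have := mul_meas_ge_le_lintegral (μ := ℙ)
    (f := fun ω => (∏ i ∈ Finset.range n, F (v i ω)) * G (v n ω))
    ((Finset.measurable_prod _ fun i _ => hF.comp (hv.meas i)).mul (hG.comp (hv.meas n))) 1
  rwa [one_mul] at this

/-- The number of completed cycles is random. A union bound over all its values costs a geometric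
series, which is finite as soon as `φ(F) < 1`. -/
theorem IsIID.measure_exists_one_le_prod_mul (hv : IsIID ℙ φ v) {F G : ℝ≥0 → ℝ≥0∞}
    (hF : Measurable F) (hG : Measurable G) :
    ℙ {ω | ∃ n, 1 ≤ (∏ i ∈ Finset.range n, F (v i ω)) * G (v n ω)} ≤
      (1 - ∫⁻ p, F p ∂φ)⁻¹ * ∫⁻ p, G p ∂φ := by
  rw [ofPred_exists]
  refine (measure_iUnion_le _).trans ?_
  refine (ENNReal.tsum_le_tsum (hv.measure_one_le_prod_mul hF hG)).trans ?_
  rw [ENNReal.tsum_mul_right, ENNReal.tsum_geometric]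

theorem prod_ofReal_exp (g : ℝ≥0 → ℝ) (w : ℕ → ℝ≥0) (n : ℕ) :
    ∏ i ∈ Finset.range n, ENNReal.ofReal (Real.exp (g (w i))) =
      ENNReal.ofReal (Real.exp (∑ i ∈ Finset.range n, g (w i))) := by
  rw [Real.exp_sum, ENNReal.ofReal_prod_of_nonneg fun i _ => (Real.exp_pos _).le]

/-- Exponential bound for sums over an unspecified number of cycles. -/
theorem IsIID.measure_exists_sum_le (hv : IsIID ℙ φ v) {g : ℝ≥0 → ℝ} {G : ℝ≥0 → ℝ≥0∞}
    (hg : Measurable g) (hG : Measurable G) (a : ℝ) :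
    ℙ {ω | ∃ n, ENNReal.ofReal (Real.exp a) ≤
        ENNReal.ofReal (Real.exp (∑ i ∈ Finset.range n, g (v i ω))) * G (v n ω)} ≤
      (1 - ∫⁻ p, ENNReal.ofReal (Real.exp (g p)) ∂φ)⁻¹ * (∫⁻ p, G p ∂φ) *
        ENNReal.ofReal (Real.exp (-a)) := by
  have h := hv.measure_exists_one_le_prod_mul
    (F := fun p => ENNReal.ofReal (Real.exp (g p)))
    (G := fun p => G p * ENNReal.ofReal (Real.exp (-a))) (by fun_prop) (by fun_prop)
  rw [lintegral_mul_const _ hG, ← mul_assoc] at h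
  refine le_trans (measure_mono ?_) h
  rintro ω ⟨n, hn⟩
  refine ⟨n, ?_⟩
  rw [prod_ofReal_exp, ← mul_assoc]
  calc (1 : ℝ≥0∞) = ENNReal.ofReal (Real.exp a) * ENNReal.ofReal (Real.exp (-a)) := by
        rw [← ENNReal.ofReal_mul (Real.exp_pos _).le, ← Real.exp_add]; simp
    _ ≤ _ := by gcongr

theorem sum_inv_eq_renewalTime_sub (T₀ : ℝ) (w : ℕ → ℝ≥0) (n : ℕ) :
    ∑ i ∈ Finset.range n, (w i : ℝ)⁻¹ = renewalTime T₀ w n - T₀ := by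
  rw [renewalTime]; ring

/-- The number of cycles completed at time `t` is almost surely finite. -/
theorem IsIID.ae_exists_renewalTime [IsProbabilityMeasure φ] (hv : IsIID ℙ φ v) (hφ : φ {0} = 0)
    (T₀ : ℝ) :
    ∀ᵐ ω ∂ℙ, ∀ t, T₀ ≤ t → ∃ n, renewalTime T₀ (fun i => v i ω) n ≤ t ∧
      t < renewalTime T₀ (fun i => v i ω) (n + 1) := by
  obtain ⟨b, hb0, hb⟩ := exists_lintegral_exp_one_sub_le φ hφ (ε := 1 / 2) (by simp) 0
  have key : ∀ m : ℕ, ∀ᵐ ω ∂ℙ, ¬ ∀ n, renewalTime T₀ (fun i => v i ω) n ≤ T₀ + m := by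
    intro m
    change ℙ {ω | ¬ ¬ ∀ n, renewalTime T₀ (fun i => v i ω) n ≤ T₀ + m} = 0
    simp only [not_not]
    -- Since `φ(e^{-b/p}) ≤ 1/2`, the probability of `n` cycles within a time `m` is at most `2^{-n}
    -- e^{b m}`.
    have hbd : ∀ n : ℕ, ℙ {ω | ∀ n, renewalTime T₀ (fun i => v i ω) n ≤ T₀ + m} ≤
        (1 / 2) ^ n * ENNReal.ofReal (Real.exp (b * m)) := by
      intro n
      have h := hv.measure_one_le_prod_mul
        (F := fun p => ENNReal.ofReal (Real.exp (0 - b / p)))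
        (G := fun _ => ENNReal.ofReal (Real.exp (b * m))) (by fun_prop) (by fun_prop) n
      rw [lintegral_const, measure_univ, mul_one] at h
      refine (measure_mono fun ω hω => ?_).trans (h.trans (by gcongr))
      rw [mem_ofPred_eq, prod_ofReal_exp (fun p => 0 - b / p) (fun i => v i ω),
        ← ENNReal.ofReal_mul (Real.exp_pos _).le, ← Real.exp_add, ← ENNReal.ofReal_one]
      refine ENNReal.ofReal_le_ofReal (Real.one_le_exp ?_)
      have h1 : ∑ i ∈ Finset.range n, (0 - b / (v i ω : ℝ)) =
          -(b * (renewalTime T₀ (fun i => v i ω) n - T₀)) := by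
        rw [← sum_inv_eq_renewalTime_sub, Finset.mul_sum, ← Finset.sum_neg_distrib]
        refine Finset.sum_congr rfl fun i _ => ?_
        rw [zero_sub, div_eq_mul_inv]
      rw [h1]
      have := mul_le_mul_of_nonneg_left (hω n) hb0
      nlinarith
    have hlim : Tendsto (fun n : ℕ => (1 / 2 : ℝ≥0∞) ^ n * ENNReal.ofReal (Real.exp (b * m))) atTop
        (𝓝 (0 * ENNReal.ofReal (Real.exp (b * m)))) :=
      ENNReal.Tendsto.mul_const (ENNReal.tendsto_pow_atTop_nhds_zero_of_lt_one (by
        rw [one_div]; exact ENNReal.inv_lt_one.mpr (by norm_num)))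
        (Or.inr ENNReal.ofReal_ne_top)
    rw [zero_mul] at hlim
    exact le_antisymm (ge_of_tendsto' hlim hbd) zero_le
  filter_upwards [ae_all_iff.mpr key] with ω hω t ht
  obtain ⟨m, hm⟩ := exists_nat_ge (t - T₀)
  have hex : ∃ n, t < renewalTime T₀ (fun i => v i ω) n := by
    have := hω m
    push Not at this
    obtain ⟨n, hn⟩ := this
    exact ⟨n, by linarith⟩
  classical
  have h0 : Nat.find hex ≠ 0 := fun h => by
    have := Nat.find_spec hex
    rw [h] at this
    simp only [renewalTime, Finset.range_zero, Finset.sum_empty, add_zero] at this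
    linarith
  refine ⟨Nat.find hex - 1, not_lt.mp (Nat.find_min hex (by omega)), ?_⟩
  rw [Nat.sub_add_cancel (Nat.one_le_iff_ne_zero.mpr h0)]
  exact Nat.find_spec hex

end Chain

/-! ### Snapshots of the process -/

/-- The occupation measure of the first `n` speeds, at time `t`. -/
def cycleMeasure (w : ℕ → ℝ≥0) (t : ℝ) (n : ℕ) : Measure ℝ≥0 :=
  ∑ i ∈ Finset.range n, (t.toNNReal⁻¹ * (w i)⁻¹) • Measure.dirac (w i)

instance (w : ℕ → ℝ≥0) (t : ℝ) (n : ℕ) : IsFiniteMeasure (cycleMeasure w t n) := by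
  unfold cycleMeasure
  infer_instance

theorem integral_cycleMeasure (w : ℕ → ℝ≥0) {t : ℝ} (ht : 0 < t) (n : ℕ) (k : ℝ≥0 →ᵇ ℝ) :
    t * ∫ p, k p ∂(cycleMeasure w t n) = ∑ i ∈ Finset.range n, (w i : ℝ)⁻¹ * k (w i) := by
  rw [cycleMeasure, integral_finsetSum_measure fun i _ => k.integrable _, Finset.mul_sum]
  refine Finset.sum_congr rfl fun i _ => ?_
  rw [integral_smul_nnreal_measure, integral_dirac, NNReal.smul_def]
  push_cast
  rw [Real.coe_toNNReal t ht.le, smul_eq_mul]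
  field_simp

theorem cycleMeasure_univ (w : ℕ → ℝ≥0) (t : ℝ) (n : ℕ) :
    cycleMeasure w t n univ = ((t.toNNReal⁻¹ * ∑ i ∈ Finset.range n, (w i)⁻¹ : ℝ≥0) : ℝ≥0∞) := by
  rw [cycleMeasure, Measure.finsetSum_apply, Finset.mul_sum, ENNReal.ofNNReal_finsetSum]
  refine Finset.sum_congr rfl fun i _ => ?_
  rw [nnreal_smul_apply, measure_univ, mul_one]

/-- A cycle has weight `τ/t` and speed `1/τ`, so it contributes at most `1/t`: the mean speed counts
the cycles per unit of time. Bounding their number therefore gives compactness. -/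
theorem meanSpeed_cycleMeasure_le (w : ℕ → ℝ≥0) (t : ℝ) (n : ℕ) :
    meanSpeed (cycleMeasure w t n) ≤ ((t.toNNReal⁻¹ * n : ℝ≥0) : ℝ≥0∞) := by
  have : meanSpeed (cycleMeasure w t n) =
      ∑ i ∈ Finset.range n, ((t.toNNReal⁻¹ * (w i)⁻¹ * w i : ℝ≥0) : ℝ≥0∞) := by
    rw [meanSpeed, cycleMeasure, lintegral_finsetSum_measure]
    refine Finset.sum_congr rfl fun i _ => ?_
    rw [lintegral_smul_measure, lintegral_dirac]
    rfl
  rw [this, ← ENNReal.ofNNReal_finsetSum, ENNReal.coe_le_coe]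
  refine (Finset.sum_le_card_nsmul _ _ t.toNNReal⁻¹ fun i _ => ?_).trans_eq ?_
  · rw [mul_assoc]
    exact mul_le_of_le_one_right' (inv_mul_le_one (a := w i))
  · rw [Finset.card_range, nsmul_eq_mul, mul_comm]

/-- At time `t` the speeds `w` give the occupation measure `y.1.1` of the `n` completed cycles and
the position `y.1.2` and (truncated) speed `y.2` of the last one. -/
structure Snapshot (T₀ : ℝ) (w : ℕ → ℝ≥0) (t : ℝ) (n : ℕ) (y : Config × unitInterval) : Prop where
  le : renewalTime T₀ w n ≤ t
  lt : t < renewalTime T₀ w (n + 1)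
  cycles : (y.1.1.1 : Measure ℝ≥0) = cycleMeasure w t n
  position : (y.1.2 : ℝ) = (t - renewalTime T₀ w n) * w n
  speed : (y.2 : ℝ) = min (w n : ℝ) 1

/-- The completed cycles have mass `(T_n - T₀)/t ≤ 1`. Truncating the last speed at `1` keeps it in
a compact interval, as the covering argument requires; only its convergence to `0` will matter. -/
theorem exists_snapshot {T₀ : ℝ} (hT₀ : 0 ≤ T₀) {w : ℕ → ℝ≥0} {t : ℝ} (ht : 0 < t) {n : ℕ}
    (h1 : renewalTime T₀ w n ≤ t) (h2 : t < renewalTime T₀ w (n + 1)) :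
    ∃ y, Snapshot T₀ w t n y := by
  have hmass : FiniteMeasure.mass ⟨cycleMeasure w t n, inferInstance⟩ ≤ 1 := by
    refine ENNReal.coe_le_coe.mp (le_of_eq_of_le
      (FiniteMeasure.ennreal_mass (μ := ⟨cycleMeasure w t n, inferInstance⟩)) ?_)
    change cycleMeasure w t n univ ≤ _
    rw [cycleMeasure_univ, ENNReal.coe_le_coe, inv_mul_le_iff₀ (by simpa using ht), mul_one,
      ← NNReal.coe_le_coe, Real.coe_toNNReal t ht.le]
    push_cast
    rw [sum_inv_eq_renewalTime_sub T₀]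
    linarith
  have hp := position_mem h1 (renewalTime_succ T₀ w n ▸ h2)
  exact ⟨((⟨_, hmass⟩, ⟨_, hp.1, hp.2.le⟩), ⟨min (w n : ℝ) 1, le_min (w n).coe_nonneg zero_le_one,
    min_le_right _ _⟩), h1, h2, rfl, rfl, rfl⟩

section

variable {T₀ : ℝ} {w : ℕ → ℝ≥0} {t : ℝ} {n : ℕ} {y : Config × unitInterval}

theorem Snapshot.speed_pos (h : Snapshot T₀ w t n y) : (0 : ℝ) < w n := by
  have h1 := h.le.trans_lt h.lt
  rw [renewalTime_succ] at h1
  exact inv_pos.mp (by linarith)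

theorem Snapshot.integral_eq (h : Snapshot T₀ w t n y) (ht : 0 < t) (k : ℝ≥0 →ᵇ ℝ) :
    t * ∫ p, k p ∂(y.1.1.1 : Measure ℝ≥0) = ∑ i ∈ Finset.range n, (w i : ℝ)⁻¹ * k (w i) := by
  rw [h.cycles, integral_cycleMeasure w ht]

/-- The delay `T₀` is not recorded in the occupation measure of the cycles, and so is counted in the
remaining mass. -/
theorem Snapshot.mul_restMass (h : Snapshot T₀ w t n y) (ht : 0 < t) :
    t * restMass y.1.1 = t - renewalTime T₀ w n + T₀ := by
  have h1 : t * (y.1.1.1.mass : ℝ) = renewalTime T₀ w n - T₀ := by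
    have h2 : (y.1.1.1.mass : ℝ≥0∞) = _ :=
      (FiniteMeasure.ennreal_mass).trans ((congrArg (fun μ : Measure ℝ≥0 => μ univ) h.cycles).trans
        (cycleMeasure_univ w t n))
    rw [ENNReal.coe_inj] at h2
    rw [h2, ← sum_inv_eq_renewalTime_sub]
    push_cast
    rw [Real.coe_toNNReal t ht.le, ← mul_assoc, mul_inv_cancel₀ ht.ne', one_mul]
  rw [coe_restMass, mul_sub, h1]
  ring

/-- Speed times elapsed time is a position in the box. A last cycle of duration of order `t`
therefore has a speed of order `1/t`. -/
theorem Snapshot.speed_mul_le (h : Snapshot T₀ w t n y) :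
    (y.2 : ℝ) * (t - renewalTime T₀ w n) ≤ 1 := by
  have h1 : (y.2 : ℝ) ≤ w n := h.speed ▸ min_le_left _ _
  have h2 := y.1.2.2.2
  rw [h.position] at h2
  calc (y.2 : ℝ) * (t - renewalTime T₀ w n) ≤ w n * (t - renewalTime T₀ w n) :=
        mul_le_mul_of_nonneg_right h1 (sub_nonneg.mpr h.le)
    _ ≤ 1 := by rwa [mul_comm]

end

/-! ### Measures outside of the closure of `Ω` are not seen -/

/-- If the snapshots converge as `t → ∞`, the empirical measures converge to the corresponding
mixture. The statement is uniform in the speeds and in the number of cycles, and is proved along a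
filter of counterexamples. -/
theorem eventually_notMem_of_mixtureProb_notMem {T₀ : ℝ} {C : Set (ProbabilityMeasure Phase)}
    (hC : IsClosed C) {x : Config × unitInterval} (hx : mixtureProb x.1 ∉ C) :
    ∀ᶠ z : ℝ × (Config × unitInterval) in atTop ×ˢ 𝓝 x, ∀ w Z n, Tracks T₀ w Z →
      Snapshot T₀ w z.1 n z.2 → Z z.1 ∉ C := by
  by_contra hcon
  rw [not_eventually] at hcon
  set S : Set (ℝ × (Config × unitInterval)) := {z | ¬ ∀ w Z n, Tracks T₀ w Z →
      Snapshot T₀ w z.1 n z.2 → Z z.1 ∉ C} with hS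
  -- The filter of counterexamples is nontrivial by assumption. Along it the chosen empirical
  -- measures will be shown to converge to the mixture while they stay in `C`.
  set F : Filter (ℝ × (Config × unitInterval)) := (atTop ×ˢ 𝓝 x) ⊓ 𝓟 S with hF
  have hne : F.NeBot := frequently_mem_iff_neBot.mp hcon
  have hex : ∀ z ∈ S, ∃ w Z n, Tracks T₀ w Z ∧ Snapshot T₀ w z.1 n z.2 ∧ Z z.1 ∈ C := by
    intro z hz
    simp only [hS, mem_ofPred_eq] at hz
    push Not at hz
    exact hz
  have : Nonempty (ProbabilityMeasure Phase) := ⟨mixtureProb x.1⟩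
  choose! w Z n hZ hsnap hmem using hex
  have hSF : ∀ᶠ z in F, z ∈ S := mem_inf_of_right (mem_principal_self S)
  have hle : F ≤ atTop ×ˢ 𝓝 x := inf_le_left
  have ht : Tendsto (fun z : ℝ × (Config × unitInterval) => z.1) F atTop := tendsto_fst.mono_left hle
  have hy : Tendsto (fun z : ℝ × (Config × unitInterval) => z.2) F (𝓝 x) :=
    tendsto_snd.mono_left hle
  have htpos : ∀ᶠ z in F, (0 : ℝ) < z.1 := ht.eventually_gt_atTop 0
  have hinv : Tendsto (fun z : ℝ × (Config × unitInterval) => z.1⁻¹) F (𝓝 0) :=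
    tendsto_inv_atTop_zero.comp ht
  -- the fraction of time in the last cycle
  set β : ℝ × (Config × unitInterval) → ℝ :=
    fun z => z.1⁻¹ * (z.1 - renewalTime T₀ (w z) (n z)) with hβ
  have hrest : Tendsto (fun z : ℝ × (Config × unitInterval) => (restMass z.2.1.1 : ℝ)) F
      (𝓝 (restMass x.1.1)) :=
    ((NNReal.continuous_coe.comp (continuous_restMass.comp
      (continuous_fst.comp continuous_fst))).tendsto x).comp hy
  have hβlim : Tendsto β F (𝓝 (restMass x.1.1)) := by
    have h1 : Tendsto (fun z : ℝ × (Config × unitInterval) => (restMass z.2.1.1 : ℝ) - z.1⁻¹ * T₀)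
        F (𝓝 (restMass x.1.1 - 0 * T₀)) := hrest.sub (hinv.mul_const _)
    rw [zero_mul, sub_zero] at h1
    refine h1.congr' ?_
    filter_upwards [hSF, htpos] with z hz hz0
    have h2 := (hsnap z hz).mul_restMass hz0
    have h3 : (restMass z.2.1.1 : ℝ) = z.1⁻¹ * (z.1 * restMass z.2.1.1) := by field_simp
    rw [h3, h2, hβ]
    ring
  have hp : Tendsto (fun z : ℝ × (Config × unitInterval) => (z.2.2 : ℝ)) F (𝓝 (x.2 : ℝ)) :=
    ((continuous_subtype_val.comp continuous_snd).tendsto x).comp hy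
  -- In the limit the last cycle is negligible or its speed vanishes.
  have hprod : (x.2 : ℝ) * restMass x.1.1 ≤ 0 := by
    refine le_of_tendsto_of_tendsto (hp.mul hβlim) hinv ?_
    filter_upwards [hSF, htpos] with z hz hz0
    have h2 := (hsnap z hz).speed_mul_le
    calc (z.2.2 : ℝ) * β z = z.1⁻¹ * (z.2.2 * (z.1 - renewalTime T₀ (w z) (n z))) := by
          simp only [hβ]; ring
      _ ≤ z.1⁻¹ * 1 := mul_le_mul_of_nonneg_left h2 (inv_nonneg.mpr hz0.le)
      _ = z.1⁻¹ := mul_one _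
  have hℓ : Tendsto (fun z : ℝ × (Config × unitInterval) => z.2.1.2) F (𝓝 x.1.2) :=
    ((continuous_snd.comp continuous_fst).tendsto x).comp hy
  have hsweep : ∀ f : Phase →ᵇ ℝ, Tendsto (fun z => β z * sweep f z.2.1.2 (w z (n z))) F
      (𝓝 (restMass x.1.1 * sweep f x.1.2 0)) := by
    intro f
    -- If the mass vanishes, boundedness of `sweep` suffices, whatever the speed. Otherwise the
    -- truncated speed tends to `0`, so it is eventually the true one, and `sweep` is continuous.
    rcases eq_or_ne (restMass x.1.1) 0 with h0 | h0
    · rw [h0] at hβlim ⊢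
      rw [NNReal.coe_zero] at hβlim ⊢
      rw [zero_mul]
      refine squeeze_zero_norm (a := fun z => |β z| * ‖f‖) (fun z => ?_) ?_
      · rw [Real.norm_eq_abs, abs_mul]
        exact mul_le_mul_of_nonneg_left (abs_sweep_le f _ _) (abs_nonneg _)
      · simpa using hβlim.abs.mul_const ‖f‖
    · have hr : (0 : ℝ) < restMass x.1.1 := by exact_mod_cast pos_iff_ne_zero.mpr h0
      have hx0 : (x.2 : ℝ) = 0 := le_antisymm (by
        by_contra hlt
        push Not at hlt
        linarith [mul_pos hlt hr]) x.2.2.1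
      rw [hx0] at hp
      have hw : Tendsto (fun z => w z (n z)) F (𝓝 0) := by
        rw [← NNReal.tendsto_coe]
        refine hp.congr' ?_
        filter_upwards [hSF, hp.eventually_lt_const one_pos] with z hz hz1
        have h1 := (hsnap z hz).speed
        rw [h1] at hz1 ⊢
        exact min_eq_left (by
          by_contra hlt
          push Not at hlt
          rw [min_eq_right hlt.le] at hz1
          exact lt_irrefl _ hz1)
      exact hβlim.mul (((continuous_sweep f).tendsto (x.1.2, 0)).comp (hℓ.prodMk_nhds hw))
  have hlim : Tendsto (fun z => Z z z.1) F (𝓝 (mixtureProb x.1)) := by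
    rw [ProbabilityMeasure.tendsto_iff_forall_integral_tendsto]
    intro f
    change Tendsto _ _ (𝓝 (∫ q, f q ∂(mixture x.1)))
    rw [integral_mixture]
    have h1 : Tendsto (fun z : ℝ × (Config × unitInterval) =>
        ∫ p, fullSweep f p ∂(z.2.1.1.1 : Measure ℝ≥0)) F
        (𝓝 (∫ p, fullSweep f p ∂(x.1.1.1 : Measure ℝ≥0))) :=
      (((FiniteMeasure.continuous_integral_boundedContinuousFunction (fullSweep f)).comp
        (continuous_subtype_val.comp (continuous_fst.comp continuous_fst))).tendsto x).comp hy
    have h2 : Tendsto (fun z => ∫ q, f q ∂(Z z z.1 : Measure Phase) -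
        (∫ p, fullSweep f p ∂(z.2.1.1.1 : Measure ℝ≥0) + β z * sweep f z.2.1.2 (w z (n z)))) F
        (𝓝 0) := by
      refine squeeze_zero_norm' (a := fun z => z.1⁻¹ * (‖f‖ * T₀)) ?_
        (by simpa using hinv.mul_const (‖f‖ * T₀))
      filter_upwards [hSF, htpos] with z hz hz0
      have h3 := (hZ z hz).bound_all z.1 hz0 (n z) (hsnap z hz).le (hsnap z hz).lt f z.2.1.2
        (hsnap z hz).position
      rw [← (hsnap z hz).integral_eq hz0] at h3
      have h4 : ∫ q, f q ∂(Z z z.1 : Measure Phase) -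
        (∫ p, fullSweep f p ∂(z.2.1.1.1 : Measure ℝ≥0) + β z * sweep f z.2.1.2 (w z (n z))) =
        z.1⁻¹ * (z.1 * ∫ q, f q ∂(Z z z.1 : Measure Phase) -
        z.1 * ∫ p, fullSweep f p ∂(z.2.1.1.1 : Measure ℝ≥0) -
        (z.1 - renewalTime T₀ (w z) (n z)) * sweep f z.2.1.2 (w z (n z))) := by
        simp only [hβ]
        field_simp
        ring
      rw [Real.norm_eq_abs, h4, abs_mul, abs_of_pos (inv_pos.mpr hz0)]
      exact mul_le_mul_of_nonneg_left h3 (inv_nonneg.mpr hz0.le)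
    have h5 := h2.add (h1.add (hsweep f))
    rw [zero_add] at h5
    refine h5.congr fun z => ?_
    ring
  exact hx (hC.mem_of_tendsto hlim (hSF.mono hmem))

/-! ### Local upper bound -/

theorem admissible_zero (φ : Measure ℝ≥0) [IsProbabilityMeasure φ] : Admissible φ 0 := by
  simp [Admissible]

/-- Replaces the cost by a lower bound that is finite and continuous in the configuration: one
admissible `k`, one `c` with a finite moment, and `max ℓ m` in place of `ℓ` to avoid the singularity
at `ℓ = 0`. -/
theorem exists_lt_of_lt_upperJ {φ : Measure ℝ≥0} [IsProbabilityMeasure φ] {x : Config} {a : ℝ}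
    (ha : 0 ≤ a) (h : ENNReal.ofReal a < upperJ φ x) :
    ∃ k, Admissible φ k ∧ ∃ c : ℝ, 0 ≤ c ∧ ∫⁻ p : ℝ≥0, ENNReal.ofReal (Real.exp (c / p)) ∂φ < ∞ ∧
      ∃ m : ℝ, 0 < m ∧
        a < (∫ p, k p ∂(x.1.1 : Measure ℝ≥0)) + restMass x.1 * (c / max (x.2 : ℝ) m) := by
  by_contra! hcon
  refine absurd h (not_lt.mpr ?_)
  have key0 : ∀ k, Admissible φ k → 0 ≤ ∫ p, k p ∂(x.1.1 : Measure ℝ≥0) → ∀ c : ℝ, 0 ≤ c →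
      ∫⁻ p : ℝ≥0, ENNReal.ofReal (Real.exp (c / p)) ∂φ < ∞ →
      ENNReal.ofReal (∫ p, k p ∂(x.1.1 : Measure ℝ≥0)) +
        restMass x.1 * (ENNReal.ofReal x.2)⁻¹ * ENNReal.ofReal c ≤ ENNReal.ofReal a := by
    intro k hk hk0 c hc hcfin
    rcases eq_or_lt_of_le x.2.2.1 with hl | hl
    · by_cases hz : (restMass x.1 : ℝ) * c = 0
      · have h1 := hcon k hk c hc hcfin 1 one_pos
        rw [← mul_div_assoc, hz, zero_div, add_zero] at h1
        have h2 : (restMass x.1 : ℝ≥0∞) * (ENNReal.ofReal x.2)⁻¹ * ENNReal.ofReal c = 0 := by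
          rcases mul_eq_zero.mp hz with h3 | h3
          · rw [NNReal.coe_eq_zero.mp h3]; simp
          · rw [h3]; simp
        rw [h2, add_zero]
        exact ENNReal.ofReal_le_ofReal h1
      · have hpos : 0 < (restMass x.1 : ℝ) * c :=
          lt_of_le_of_ne (mul_nonneg (restMass x.1).coe_nonneg hc) (Ne.symm hz)
        -- This `m` makes the term of the last cycle equal to `a + 1`, which contradicts the bound
        -- by `a`.
        have h1 := hcon k hk c hc hcfin (restMass x.1 * c / (a + 1)) (by positivity)
        rw [← hl, max_eq_right (by positivity), ← mul_div_assoc, div_div_cancel₀ hpos.ne'] at h1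
        linarith
    · have h1 := hcon k hk c hc hcfin x.2 hl
      rw [max_self] at h1
      rw [← ENNReal.ofReal_coe_nnreal, ← ENNReal.ofReal_inv_of_pos hl,
        ← ENNReal.ofReal_mul (restMass x.1).coe_nonneg, ← ENNReal.ofReal_mul
        (mul_nonneg (restMass x.1).coe_nonneg (inv_nonneg.mpr hl.le)), ← ENNReal.ofReal_add hk0
        (mul_nonneg (mul_nonneg (restMass x.1).coe_nonneg (inv_nonneg.mpr hl.le)) hc)]
      refine ENNReal.ofReal_le_ofReal (le_trans (le_of_eq ?_) h1)
      rw [div_eq_mul_inv]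
      ring
  have key : ∀ k, Admissible φ k → ∀ c : ℝ, 0 ≤ c →
      ∫⁻ p : ℝ≥0, ENNReal.ofReal (Real.exp (c / p)) ∂φ < ∞ →
      ENNReal.ofReal (∫ p, k p ∂(x.1.1 : Measure ℝ≥0)) +
        restMass x.1 * (ENNReal.ofReal x.2)⁻¹ * ENNReal.ofReal c ≤ ENNReal.ofReal a := by
    intro k hk c hc hcfin
    -- A `k` with negative integral counts as `0` in the dual cost and is replaced by the admissible
    -- function `0`.
    rcases le_or_gt 0 (∫ p, k p ∂(x.1.1 : Measure ℝ≥0)) with h0 | h0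
    · exact key0 k hk h0 c hc hcfin
    · have := key0 0 (admissible_zero φ) (by simp) c hc hcfin
      rw [ENNReal.ofReal_of_nonpos h0.le]
      simpa using this
  rw [upperJ, dualCost, ENNReal.biSup_add' ⟨0, admissible_zero φ⟩]
  refine iSup₂_le fun k hk => ?_
  rw [xi_eq_iSup]
  have : Nonempty {c : ℝ // 0 ≤ c ∧
      ∫⁻ p : ℝ≥0, ENNReal.ofReal (Real.exp (c / (p : ℝ))) ∂φ < ∞} :=
    ⟨⟨0, le_rfl, lintegral_exp_zero_div_lt_top φ⟩⟩
  rw [ENNReal.mul_iSup, ENNReal.add_iSup]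
  exact iSup_le fun c => key k hk c.1 c.2.1 c.2.2

/-- Strict inequality makes the geometric series over the number of cycles converge. Its price is a
factor `e^{-η τ}` per cycle, hence at most `e^{η t}` over the whole time. -/
theorem lintegral_exp_sub_lt_one {φ : Measure ℝ≥0} [IsProbabilityMeasure φ] (hφ : φ {0} = 0)
    {k : ℝ≥0 →ᵇ ℝ} (hk : Admissible φ k) {η : ℝ} (hη : 0 < η) :
    ∫⁻ p : ℝ≥0, ENNReal.ofReal (Real.exp ((k p - η) / p)) ∂φ < 1 := by
  have hae : ∀ᵐ p ∂φ, p ∉ ({0} : Set ℝ≥0) := measure_eq_zero_iff_ae_notMem.mp hφ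
  have hlt : ∀ᵐ p : ℝ≥0 ∂φ, ENNReal.ofReal (Real.exp ((k p - η) / p)) <
      ENNReal.ofReal (Real.exp (k p / p)) := by
    filter_upwards [hae] with p hp
    have hp' : (0 : ℝ) < p := by exact_mod_cast pos_iff_ne_zero.mpr hp
    rw [ENNReal.ofReal_lt_ofReal_iff (Real.exp_pos _), Real.exp_lt_exp]
    exact div_lt_div_of_pos_right (by linarith) hp'
  have hm := measurable_div_speed k
  refine lt_of_lt_of_le (lintegral_strict_mono (NeZero.ne φ) (by fun_prop) ?_ hlt) hk
  refine ne_top_of_le_ne_top ENNReal.one_ne_top ((lintegral_mono_ae ?_).trans hk)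
  filter_upwards [hlt] with p hp using hp.le

section UpperBound

variable {Ω' : Type*} [MeasurableSpace Ω'] {ℙ : Measure Ω'}
  {φ : Measure ℝ≥0} [IsProbabilityMeasure φ] {v : ℕ → Ω' → ℝ≥0}

/-- The exponential Markov inequality with weights `e^{(k - η)/p}` for the completed cycles and
`e^{c/p}` for the last one. The loss `η = a' - a` is the margin between the two levels below the
cost. -/
theorem IsIID.exists_expDecay_nhds (hv : IsIID ℙ φ v) (hφ : φ {0} = 0) {T₀ : ℝ} (hT₀ : 0 ≤ T₀)
    {x : Config} {a : ℝ} (ha : 0 ≤ a) (h : ENNReal.ofReal a < upperJ φ x) :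
    ∃ U ∈ 𝓝 x, ExpDecay (fun t => ℙ {ω | ∃ n y, Snapshot T₀ (fun i => v i ω) t n y ∧ y.1 ∈ U})
      a := by
  obtain ⟨a', haa', ha'⟩ : ∃ a' : ℝ, a < a' ∧ ENNReal.ofReal a' < upperJ φ x := by
    obtain ⟨r, hr1, hr2⟩ := ENNReal.lt_iff_exists_nnreal_btwn.mp h
    refine ⟨r, ?_, by rwa [ENNReal.ofReal_coe_nnreal]⟩
    rw [← ENNReal.ofReal_coe_nnreal] at hr1
    exact (ENNReal.ofReal_lt_ofReal_iff_of_nonneg ha).mp hr1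
  obtain ⟨k, hk, c, hc, hcfin, m, hm, hlt⟩ := exists_lt_of_lt_upperJ (ha.trans haa'.le) ha'
  set η := a' - a with hη
  have hη0 : 0 < η := sub_pos.mpr haa'
  have hcont : Continuous fun y : Config =>
      (∫ p, k p ∂(y.1.1 : Measure ℝ≥0)) + restMass y.1 * (c / max (y.2 : ℝ) m) := by
    refine Continuous.add ?_ (Continuous.mul ?_ (Continuous.div continuous_const ?_ ?_))
    · exact (FiniteMeasure.continuous_integral_boundedContinuousFunction k).comp
        (continuous_subtype_val.comp continuous_fst)
    · exact NNReal.continuous_coe.comp (continuous_restMass.comp continuous_fst)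
    · exact (continuous_subtype_val.comp continuous_snd).max continuous_const
    · exact fun y => (lt_max_of_lt_right hm).ne'
  refine ⟨_, (isOpen_lt continuous_const hcont).mem_nhds hlt, ?_⟩
  have hF := lintegral_exp_sub_lt_one hφ hk hη0
  set A := ∫⁻ p : ℝ≥0, ENNReal.ofReal (Real.exp ((k p - η) / p)) ∂φ with hA
  set B := ∫⁻ p : ℝ≥0, ENNReal.ofReal (Real.exp (c / p)) ∂φ with hB
  have hmk : Measurable fun p : ℝ≥0 => (k p - η) / (p : ℝ) :=
    (k.continuous.measurable.sub_const η).div measurable_coe_nnreal_real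
  have hK : (1 - A)⁻¹ * B * ENNReal.ofReal (Real.exp (T₀ * c / m)) ≠ ∞ := by
    refine ENNReal.mul_ne_top (ENNReal.mul_ne_top ?_ hcfin.ne) ENNReal.ofReal_ne_top
    rw [ENNReal.inv_ne_top]
    exact (tsub_pos_of_lt hF).ne'
  refine ⟨((1 - A)⁻¹ * B * ENNReal.ofReal (Real.exp (T₀ * c / m))).toNNReal, ?_⟩
  rw [ENNReal.coe_toNNReal hK]
  filter_upwards [eventually_gt_atTop 0] with t ht
  have hbd := hv.measure_exists_sum_le hmk
    (G := fun p : ℝ≥0 => ENNReal.ofReal (Real.exp (c / p))) (by fun_prop) (a * t - T₀ * c / m)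
  rw [show -(a * t - T₀ * c / m) = T₀ * c / m + -(a * t) by ring, Real.exp_add,
    ENNReal.ofReal_mul (Real.exp_pos _).le, ← mul_assoc] at hbd
  refine (measure_mono ?_).trans hbd
  rintro ω ⟨n, y, hy, hyU⟩
  refine ⟨n, ?_⟩
  have hwn := hy.speed_pos
  rw [← ENNReal.ofReal_mul (Real.exp_pos _).le, ← Real.exp_add]
  refine ENNReal.ofReal_le_ofReal (Real.exp_le_exp.mpr ?_)
  have h1 := mul_lt_mul_of_pos_left (show a' < _ from hyU) ht
  rw [mul_add, hy.integral_eq ht, ← mul_assoc, hy.mul_restMass ht] at h1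
  set T := renewalTime T₀ (fun i => v i ω) n with hT
  have hmax : 0 < max (y.1.2 : ℝ) m := lt_max_of_lt_right hm
  -- Elapsed time times speed is the position, which is at most `max ℓ m`.
  have h2 : (t - T) * (c / max (y.1.2 : ℝ) m) ≤ c / v n ω := by
    rw [← mul_div_assoc, div_le_div_iff₀ hmax hwn, mul_right_comm, ← hy.position, mul_comm]
    exact mul_le_mul_of_nonneg_left (le_max_left _ _) hc
  have h3 : T₀ * (c / max (y.1.2 : ℝ) m) ≤ T₀ * c / m := by
    rw [mul_div_assoc]
    exact mul_le_mul_of_nonneg_left (div_le_div_of_nonneg_left hc hm (le_max_right _ _)) hT₀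
  have h4 : ∑ i ∈ Finset.range n, (k (v i ω) - η) / (v i ω : ℝ) =
      ∑ i ∈ Finset.range n, (v i ω : ℝ)⁻¹ * k (v i ω) - η * (T - T₀) := by
    rw [hT, ← sum_inv_eq_renewalTime_sub, Finset.mul_sum, ← Finset.sum_sub_distrib]
    refine Finset.sum_congr rfl fun i _ => ?_
    rw [div_eq_mul_inv]
    ring
  have h5 : η * (T - T₀) ≤ η * t := mul_le_mul_of_nonneg_left (by linarith [hy.le]) hη0.le
  rw [h4]
  have h6 : t * a' = a * t + η * t := by rw [hη]; ring
  rw [add_mul] at h1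
  linarith

/-- With `φ(e^{1 - b/p}) ≤ 1/2`, the weight of more than `(a + b) t` cycles completed by time `t` is
at least `e^{a t}`. The geometric series contributes the constant `2`. -/
theorem IsIID.exists_expDecay_numCycles (hv : IsIID ℙ φ v) (hφ : φ {0} = 0) {T₀ : ℝ} (hT₀ : 0 ≤ T₀)
    (a : ℝ) : ∃ M : ℝ≥0, ExpDecay (fun t => ℙ {ω | ∃ n : ℕ,
      renewalTime T₀ (fun i => v i ω) n ≤ t ∧ M * t < n}) a := by
  obtain ⟨b, hb0, hb⟩ := exists_lintegral_exp_one_sub_le φ hφ (ε := 1 / 2) (by simp) 1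
  refine ⟨(a + b).toNNReal, 2, ?_⟩
  filter_upwards [eventually_gt_atTop 0] with t ht
  have hbd := hv.measure_exists_sum_le (g := fun p : ℝ≥0 => 1 - b / p)
    (G := fun _ => 1) (by fun_prop) (by fun_prop) (a * t)
  rw [lintegral_const, measure_univ, mul_one, mul_one] at hbd
  refine (measure_mono ?_).trans (hbd.trans ?_)
  · rintro ω ⟨n, hn, hlt⟩
    refine ⟨n, ?_⟩
    rw [mul_one]
    refine ENNReal.ofReal_le_ofReal (Real.exp_le_exp.mpr ?_)
    have h1 : ∑ i ∈ Finset.range n, (1 - b / (v i ω : ℝ)) =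
        n - b * (renewalTime T₀ (fun i => v i ω) n - T₀) := by
      rw [← sum_inv_eq_renewalTime_sub, Finset.mul_sum, Finset.sum_sub_distrib]
      simp [div_eq_mul_inv]
    rw [h1]
    have h2 : (a + b) * t ≤ (a + b).toNNReal * t :=
      mul_le_mul_of_nonneg_right (Real.le_coe_toNNReal _) ht.le
    have h3 : b * (renewalTime T₀ (fun i => v i ω) n - T₀) ≤ b * t :=
      mul_le_mul_of_nonneg_left (by linarith) hb0
    linarith
  · gcongr
    rw [ENNReal.inv_le_iff_inv_le]
    refine le_trans ?_ (tsub_le_tsub_left hb 1)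
    rw [one_div, ENNReal.one_sub_inv_two]
    rfl

variable {T₀ : ℝ} {Y : Ω' → ℝ → ProbabilityMeasure Phase}

/-- Outside an event of small enough probability the snapshot lies in a fixed compact set. Each of
its points has a neighbourhood that either is incompatible with `C` at large times, because the
mixture is not in `C`, or is visited with probability `O(e^{-a t})`, because the cost exceeds `a`. A
finite cover suffices. -/
theorem IsIID.expDecay_closed (hv : IsIID ℙ φ v) (hφ : φ {0} = 0) (hT₀ : 0 ≤ T₀)
    (hY : ∀ ω, Tracks T₀ (fun i => v i ω) (Y ω)) {C : Set (ProbabilityMeasure Phase)}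
    (hC : IsClosed C) {a : ℝ} (ha : 0 ≤ a) (h : ENNReal.ofReal a < ⨅ μ ∈ C, rateI φ μ) :
    ExpDecay (fun t => law ℙ Y t C) a := by
  obtain ⟨M, hM⟩ := hv.exists_expDecay_numCycles hφ hT₀ a
  obtain ⟨K, hK, hKM⟩ := isCompact_meanSpeed_le M
  have hcompact : IsCompact ((K ×ˢ (univ : Set unitInterval)) ×ˢ (univ : Set unitInterval)) :=
    (hK.prod isCompact_univ).prod isCompact_univ
  have hcov : ExpDecay (fun t => ℙ {ω | ∃ n y, Snapshot T₀ (fun i => v i ω) t n y ∧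
      y ∈ (K ×ˢ (univ : Set unitInterval)) ×ˢ (univ : Set unitInterval) ∧ Y ω t ∈ C}) a := by
    refine hcompact.induction_on (p := fun S => ExpDecay (fun t => ℙ {ω | ∃ n y,
      Snapshot T₀ (fun i => v i ω) t n y ∧ y ∈ S ∧ Y ω t ∈ C}) a) ?_ ?_ ?_ ?_
    · exact ⟨0, by simp⟩
    · intro s s' hss' hs'
      refine hs'.mono (Eventually.of_forall fun t => measure_mono ?_)
      rintro ω ⟨n, y, h1, h2, h3⟩
      exact ⟨n, y, h1, hss' h2, h3⟩
    · intro s s' hs hs'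
      refine (hs.add hs').mono (Eventually.of_forall fun t => ?_)
      refine (measure_mono ?_).trans (measure_union_le _ _)
      rintro ω ⟨n, y, h1, h2, h3⟩
      rcases h2 with h2 | h2
      · exact Or.inl ⟨n, y, h1, h2, h3⟩
      · exact Or.inr ⟨n, y, h1, h2, h3⟩
    · intro x _
      by_cases hx : mixtureProb x.1 ∈ C
      · have hlt : ENNReal.ofReal a < upperJ φ x.1 := by
          refine h.trans_le ((iInf₂_le _ hx).trans ?_)
          rw [rateI_eq φ hφ]
          exact iInf₂_le (f := fun x' (_ : mixtureProb x' = mixtureProb x.1) => upperJ φ x') x.1 rfl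
        obtain ⟨U, hU, hdec⟩ := hv.exists_expDecay_nhds hφ hT₀ ha hlt
        refine ⟨Prod.fst ⁻¹' U, mem_nhdsWithin_of_mem_nhds (continuous_fst.continuousAt hU), ?_⟩
        refine hdec.mono (Eventually.of_forall fun t => measure_mono ?_)
        rintro ω ⟨n, y, h1, h2, -⟩
        exact ⟨n, y, h1, h2⟩
      · have hev := eventually_notMem_of_mixtureProb_notMem (T₀ := T₀) hC hx
        obtain ⟨pa, hpa, pb, hpb, hp⟩ := eventually_prod_iff.mp hev
        refine ⟨{y | pb y}, mem_nhdsWithin_of_mem_nhds hpb, 0, ?_⟩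
        filter_upwards [hpa] with t ht
        have : {ω | ∃ n y, Snapshot T₀ (fun i => v i ω) t n y ∧ pb y ∧ Y ω t ∈ C} = ∅ := by
          refine eq_empty_of_forall_notMem ?_
          rintro ω ⟨n, y, h1, h2, h3⟩
          exact hp ht h2 _ (Y ω) n (hY ω) h1 h3
        exact (measure_mono_null this.subset measure_empty).trans_le zero_le
  refine (hM.add hcov).mono ?_
  filter_upwards [eventually_gt_atTop 0, eventually_ge_atTop T₀] with t ht htT
  refine le_trans (measure_mono_ae ?_) (measure_union_le _ _)
  filter_upwards [hv.ae_exists_renewalTime hφ T₀] with ω hω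
  intro hmem
  obtain ⟨n, hn1, hn2⟩ := hω t htT
  obtain ⟨y, hy⟩ := exists_snapshot hT₀ ht hn1 hn2
  by_cases hlt : M * t < n
  · exact Or.inl ⟨n, hn1, hlt⟩
  · refine Or.inr ⟨n, y, hy, ⟨⟨hKM _ ?_, trivial⟩, trivial⟩, hmem⟩
    rw [hy.cycles]
    refine (meanSpeed_cycleMeasure_le _ _ _).trans ?_
    rw [ENNReal.coe_le_coe, inv_mul_le_iff₀ (by simpa using ht), ← NNReal.coe_le_coe]
    push_cast
    rw [Real.coe_toNNReal t ht.le]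
    linarith

theorem IsIID.ldUpperBound [IsProbabilityMeasure ℙ] (hv : IsIID ℙ φ v) (hφ : φ {0} = 0) (hT₀ : 0 ≤ T₀)
    (hY : ∀ ω, Tracks T₀ (fun i => v i ω) (Y ω)) : LDUpperBound (law ℙ Y) (rateI φ) := by
  refine ⟨(isGood_rateI φ hφ).2, fun C hC => ?_⟩
  by_contra! hcon
  set s := limsup (fun t : ℝ => logRate (law ℙ Y) t C) atTop with hs
  have hs0 : s ≤ 0 := by
    rw [hs]
    have : limsup (fun t : ℝ => logRate (law ℙ Y) t C) atTop ≤
        limsup (fun _ : ℝ => (0 : EReal)) atTop := by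
      refine limsup_le_limsup ?_
      filter_upwards [eventually_gt_atTop 0] with t ht
      exact logRate_nonpos ht.le prob_le_one
    simpa using this
  have h1 : -s < ((⨅ μ ∈ C, rateI φ μ : ℝ≥0∞) : EReal) := EReal.neg_lt_comm.mp hcon
  obtain ⟨a, ha1, ha2⟩ := EReal.lt_iff_exists_real_btwn.mp h1
  have ha0 : 0 ≤ a := by
    have : (0 : EReal) ≤ -s := by rwa [EReal.le_neg, neg_zero]
    exact_mod_cast (this.trans ha1.le)
  have ha3 : ENNReal.ofReal a < ⨅ μ ∈ C, rateI φ μ := by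
    rw [← EReal.coe_ennreal_lt_coe_ennreal_iff, EReal.coe_ennreal_ofReal, max_eq_left ha0]
    exact ha2
  have h2 : s ≤ ((-a : ℝ) : EReal) := limsup_logRate_le (hv.expDecay_closed hφ hT₀ hY hC ha0 ha3)
  have h3 : ((-a : ℝ) : EReal) < s := by
    rw [EReal.coe_neg]
    exact EReal.neg_lt_comm.mp ha1
  exact absurd h2 (not_le.mpr h3)

end UpperBound

/-! ### Change of measure -/

theorem pi_withDensity {N : ℕ} (φ : Measure ℝ≥0) [IsProbabilityMeasure φ] {D : ℝ≥0 → ℝ≥0∞}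
    (hD : Measurable D) [IsProbabilityMeasure (φ.withDensity D)] :
    Measure.pi (fun _ : Fin N => φ.withDensity D) =
      (Measure.pi fun _ : Fin N => φ).withDensity (fun x => ∏ i, D (x i)) := by
  refine Measure.pi_eq fun s hs => ?_
  have hm : ∀ i, Measurable ((s i).indicator D) := fun i => hD.indicator (hs i)
  have hind := ProbabilityTheory.iIndepFun_pi (μ := fun _ : Fin N => φ)
    (X := fun i p => (s i).indicator D p) fun i => (hm i).aemeasurable
  have h := ProbabilityTheory.lintegral_prod_eq_prod_lintegral_of_indepFun Finset.univ
    (fun (i : Fin N) (x : Fin N → ℝ≥0) => (s i).indicator D (x i)) hind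
    fun i => (hm i).comp (measurable_pi_apply i)
  rw [withDensity_apply _ (MeasurableSet.univ_pi hs),
    ← lintegral_indicator (MeasurableSet.univ_pi hs)]
  have h1 : ∀ x : Fin N → ℝ≥0, (univ.pi s).indicator (fun x => ∏ i, D (x i)) x =
      ∏ i, (s i).indicator D (x i) := by
    intro x
    by_cases hx : x ∈ univ.pi s
    · rw [indicator_of_mem hx]
      exact Finset.prod_congr rfl fun i _ => (indicator_of_mem (hx i trivial) _).symm
    · rw [indicator_of_notMem hx]
      simp only [Set.mem_pi, mem_univ, true_implies, not_forall] at hx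
      obtain ⟨i, hi⟩ := hx
      exact (Finset.prod_eq_zero (Finset.mem_univ i) (indicator_of_notMem hi _)).symm
  simp_rw [h1]
  rw [h]
  refine Finset.prod_congr rfl fun i _ => ?_
  rw [withDensity_apply _ (hs i), ← lintegral_indicator (hs i)]
  have h2 := (measurePreserving_eval (fun _ : Fin N => φ) i)
  conv_rhs => rw [← h2.map_eq]
  rw [lintegral_map (hm i) (measurable_pi_apply i)]

/-- Used with `c = e^{t(C + η/2)}`: a set which is likely under the tilted product law and on which
the likelihood ratio is at most `c` has `φ`-probability at least of order `c⁻¹`. -/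
theorem pi_le_mul_of_density_le {N : ℕ} {φ σ : Measure ℝ≥0} [IsProbabilityMeasure φ]
    [IsProbabilityMeasure σ] {D : ℝ≥0 → ℝ≥0∞} (hD : Measurable D) (hσ : σ = φ.withDensity D)
    {A : Set (Fin N → ℝ≥0)} (hA : MeasurableSet A) {c : ℝ≥0∞}
    (h : ∀ x ∈ A, ∏ i, D (x i) ≤ c) :
    Measure.pi (fun _ : Fin N => σ) A ≤ c * Measure.pi (fun _ : Fin N => φ) A := by
  subst hσ
  rw [pi_withDensity φ hD, withDensity_apply _ hA, ← setLIntegral_const]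
  exact setLIntegral_mono measurable_const h

/-! ### Independent sequences: finite marginals and the law of large numbers -/

section

variable {Ω' : Type*} [MeasurableSpace Ω'] {ℙ : Measure Ω'} {φ : Measure ℝ≥0} {v : ℕ → Ω' → ℝ≥0}

theorem isIID_infinitePi (σ : Measure ℝ≥0) [IsProbabilityMeasure σ] :
    IsIID (Measure.infinitePi fun _ : ℕ => σ) σ (fun i x => x i) :=
  ⟨fun i => measurable_pi_apply i, fun i => Measure.infinitePi_map_eval _ i,
    ProbabilityTheory.iIndepFun_infinitePi (X := fun _ p => p) fun _ => measurable_id⟩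

theorem IsIID.map_fin [IsProbabilityMeasure ℙ] (hv : IsIID ℙ φ v) (N : ℕ) :
    ℙ.map (fun ω (i : Fin N) => v i ω) = Measure.pi fun _ : Fin N => φ := by
  have h := (ProbabilityTheory.iIndepFun_iff_map_fun_eq_pi_map
    (fun i : Fin N => (hv.meas i).aemeasurable)).mp
    (hv.indep.precomp (g := fun i : Fin N => (i : ℕ)) Fin.val_injective)
  rw [h]
  congr 1
  ext1 i
  exact hv.law_eq i

theorem IsIID.tendsto_average (hv : IsIID ℙ φ v) {h : ℝ≥0 → ℝ} (hm : Measurable h)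
    (hi : Integrable h φ) : ∀ᵐ ω ∂ℙ,
      Tendsto (fun n : ℕ => (∑ i ∈ Finset.range n, h (v i ω)) / n) atTop (𝓝 (∫ p, h p ∂φ)) := by
  have h0 : ∫ p, h p ∂φ = ∫ ω, h (v 0 ω) ∂ℙ := by
    rw [← hv.law_eq 0, integral_map (hv.meas 0).aemeasurable hm.aestronglyMeasurable]
  rw [h0]
  refine ProbabilityTheory.strong_law_ae_real (fun i ω => h (v i ω)) ?_ ?_ ?_
  · have := (hv.law_eq 0).symm ▸ hi
    exact this.comp_measurable (hv.meas 0)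
  · intro i j hij
    exact (hv.indep.indepFun hij).comp hm hm
  · intro i
    refine ProbabilityTheory.IdentDistrib.comp ⟨(hv.meas i).aemeasurable, (hv.meas 0).aemeasurable,
      ?_⟩ hm
    rw [hv.law_eq, hv.law_eq]

theorem IsIID.tendsto_average_floor (hv : IsIID ℙ φ v) {h : ℝ≥0 → ℝ} (hm : Measurable h)
    (hi : Integrable h φ) {r : ℝ} (hr : 0 < r) : ∀ᵐ ω ∂ℙ,
      Tendsto (fun t : ℝ => t⁻¹ * ∑ i ∈ Finset.range ⌊r * t⌋₊, h (v i ω)) atTop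
        (𝓝 (r * ∫ p, h p ∂φ)) := by
  filter_upwards [hv.tendsto_average hm hi] with ω hω
  have h1 : Tendsto (fun t : ℝ => (⌊r * t⌋₊ : ℝ) / t) atTop (𝓝 r) :=
    tendsto_nat_floor_mul_div_atTop hr.le
  have h2 : Tendsto (fun t : ℝ => ⌊r * t⌋₊) atTop atTop :=
    tendsto_nat_floor_atTop.comp (tendsto_id.const_mul_atTop hr)
  refine (h1.mul (hω.comp h2)).congr' ?_
  filter_upwards [h2.eventually_gt_atTop 0] with t ht
  have h3 : (⌊r * t⌋₊ : ℝ) ≠ 0 := by exact_mod_cast ht.ne'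
  simp only [Function.comp_apply]
  field_simp

end

/-! ### Attainable occupation measures -/

/-- `cycleMeasure` as a finite measure. -/
def cycleFM (w : ℕ → ℝ≥0) (t : ℝ) (n : ℕ) : FiniteMeasure ℝ≥0 := ⟨cycleMeasure w t n, inferInstance⟩

/-- The weak topology is induced by the integrals of test functions, so a neighbourhood is
controlled by finitely many of them. -/
theorem exists_finset_of_mem_nhds {ρ : FiniteMeasure ℝ≥0} {U : Set (FiniteMeasure ℝ≥0)}
    (hU : U ∈ 𝓝 ρ) : ∃ s : Finset (ℝ≥0 →ᵇ ℝ), ∃ ε > 0, ∀ ρ' : FiniteMeasure ℝ≥0,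
      (∀ k ∈ s, |∫ p, k p ∂(ρ' : Measure ℝ≥0) - ∫ p, k p ∂(ρ : Measure ℝ≥0)| < ε) → ρ' ∈ U := by
  classical
  let Φ : FiniteMeasure ℝ≥0 → (ℝ≥0 →ᵇ ℝ) → ℝ := fun ρ' k => ∫ p, k p ∂(ρ' : Measure ℝ≥0)
  have hle : comap Φ (𝓝 (Φ ρ)) ≤ 𝓝 ρ := by
    have : Tendsto (fun ρ' : FiniteMeasure ℝ≥0 => ρ') (comap Φ (𝓝 (Φ ρ))) (𝓝 ρ) := by
      rw [FiniteMeasure.tendsto_iff_forall_integral_tendsto]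
      intro k
      exact ((continuous_apply k).tendsto (Φ ρ)).comp tendsto_comap
    exact this
  obtain ⟨V, hV, hVU⟩ := mem_comap.mp (hle hU)
  rw [nhds_pi, Filter.mem_pi] at hV
  obtain ⟨I, hI, T, hT, hTV⟩ := hV
  have hε : ∀ k, ∃ ε > 0, Metric.ball (Φ ρ k) ε ⊆ T k := fun k => Metric.mem_nhds_iff.mp (hT k)
  choose ε hε0 hεT using hε
  obtain ⟨e, he0, he⟩ : ∃ e > 0, ∀ k ∈ I, e ≤ ε k := by
    rcases I.eq_empty_or_nonempty with h | h
    · exact ⟨1, one_pos, by simp [h]⟩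
    · obtain ⟨k, hk, hmin⟩ := exists_min_image I ε hI h
      exact ⟨ε k, hε0 k, hmin⟩
  refine ⟨hI.toFinset, e, he0, fun ρ' hρ' => hVU (hTV fun k hk => hεT k ?_)⟩
  rw [Metric.mem_ball, Real.dist_eq]
  exact (hρ' k (hI.mem_toFinset.mpr hk)).trans_le (he k hk)

/-- With speeds of law `φ`, the occupation measure of the completed cycles is close to `ρ` at an
exponential cost at most `C`. -/
def Attainable (φ : Measure ℝ≥0) (ρ : FiniteMeasure ℝ≥0) (C : ℝ) : Prop :=
  ∀ U ∈ 𝓝 ρ, ∀ η > 0, ∀ᶠ t : ℝ in atTop, ∃ N : ℕ, ∃ A : Set (Fin N → ℝ≥0), MeasurableSet A ∧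
    (∀ w : ℕ → ℝ≥0, (fun i : Fin N => w i) ∈ A → cycleFM w t N ∈ U) ∧
    ENNReal.ofReal (Real.exp (-(t * (C + η)))) ≤ Measure.pi (fun _ : Fin N => φ) A

/-- Attainability passes to limits with converging costs. This allows an atom at `0`, a speed which
`φ` never produces, to be approximated by small positive speeds. -/
theorem Attainable.of_approx {φ : Measure ℝ≥0} {ρ : FiniteMeasure ℝ≥0} {C : ℝ}
    (h : ∀ U ∈ 𝓝 ρ, ∀ η > 0, ∃ ρ' ∈ U, ∃ C' ≤ C + η, Attainable φ ρ' C') : Attainable φ ρ C := by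
  intro U hU η hη
  obtain ⟨V, hVU, hV, hρV⟩ := mem_nhds_iff.mp hU
  obtain ⟨ρ', hρ', C', hC', hatt⟩ := h V (hV.mem_nhds hρV) (η / 2) (by positivity)
  filter_upwards [hatt V (hV.mem_nhds hρ') (η / 2) (by positivity), eventually_gt_atTop 0]
    with t ht ht0
  obtain ⟨N, A, hA, hAU, hbd⟩ := ht
  refine ⟨N, A, hA, fun w hw => hVU (hAU w hw), le_trans ?_ hbd⟩
  refine ENNReal.ofReal_le_ofReal (Real.exp_le_exp.mpr (neg_le_neg ?_))
  exact mul_le_mul_of_nonneg_left (by linarith) ht0.le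

theorem attainable_zero (φ : Measure ℝ≥0) [IsProbabilityMeasure φ] : Attainable φ 0 0 := by
  intro U hU η hη
  filter_upwards [eventually_gt_atTop 0] with t ht
  refine ⟨0, univ, MeasurableSet.univ, fun w _ => ?_, ?_⟩
  · have : cycleFM w t 0 = 0 := by
      refine Subtype.ext ?_
      simp [cycleFM, cycleMeasure]
    rw [this]
    exact mem_of_mem_nhds hU
  · rw [measure_univ, ← ENNReal.ofReal_one]
    refine ENNReal.ofReal_le_ofReal (Real.exp_le_one_iff.mpr ?_)
    have : 0 < t * (0 + η) := by positivity
    linarith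

/-- With `r = ρ(p)`, draw `⌊r t⌋` speeds from `ρ̃`. By the law of large numbers their occupation
measure integrates `k` to nearly `r ρ̃(k/p) = ρ(k)`, and the log-likelihood relative to `φ` is about
`t r H(ρ̃|φ)`, which is `t` times the cost. -/
theorem attainable_of_apply_zero {φ : Measure ℝ≥0} [IsProbabilityMeasure φ] (hφ : φ {0} = 0)
    (ρ : FiniteMeasure ℝ≥0) (h0 : (ρ : Measure ℝ≥0) {0} = 0) (h : dualCost φ ρ ≠ ∞) :
    Attainable φ ρ (dualCost φ ρ).toReal := by
  have hfin := meanSpeed_lt_top_of_dualCost hφ h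
  have hcost : dualCost φ ρ = meanSpeed (ρ : Measure ℝ≥0) * klDiv (sizeBias ρ) φ := by
    rw [dualCost_eq_cycleCost _ hφ hfin, cycleCost, h0, zero_mul, add_zero]
  by_cases hm : meanSpeed (ρ : Measure ℝ≥0) = 0
  · rw [hcost, hm, zero_mul]
    have : ρ = 0 := by
      refine Subtype.ext ?_
      change (ρ : Measure ℝ≥0) = 0
      rw [← Measure.measure_univ_eq_zero, ← union_compl_self ({0} : Set ℝ≥0)]
      exact measure_union_null h0 (meanSpeed_eq_zero_iff.mp hm)
    rw [this]
    exact attainable_zero φ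
  have hprob := isProbabilityMeasure_sizeBias hm hfin
  set σ := sizeBias (ρ : Measure ℝ≥0) with hσ
  set r := (meanSpeed (ρ : Measure ℝ≥0)).toReal with hr
  have hr0 : 0 < r := ENNReal.toReal_pos hm hfin.ne
  have hkl : klDiv σ φ ≠ ∞ := fun hkl => h (by rw [hcost, hkl, ENNReal.mul_top hm])
  obtain ⟨hac, hint⟩ := klDiv_ne_top_iff.mp hkl
  have hllr : (klDiv σ φ).toReal = ∫ p, llr σ φ p ∂σ := toReal_klDiv_of_measure_eq hac (by simp)
  have hC : (dualCost φ ρ).toReal = r * ∫ p, llr σ φ p ∂σ := by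
    rw [hcost, ENNReal.toReal_mul, hllr]
  intro U hU η hη
  obtain ⟨s, ε, hε, hs⟩ := exists_finset_of_mem_nhds hU
  set C := (dualCost φ ρ).toReal with hCdef
  have hX := isIID_infinitePi σ
  set Q := Measure.infinitePi fun _ : ℕ => σ with hQ
  -- The event that the required averages and the log-likelihood are close to their limits; its
  -- probability under the tilted law tends to `1`.
  let A : ∀ t : ℝ, Set (Fin ⌊r * t⌋₊ → ℝ≥0) := fun t =>
    (⋂ k ∈ s, {x | |t⁻¹ * ∑ i, k (x i) / (x i : ℝ) - ∫ p, k p ∂(ρ : Measure ℝ≥0)| < ε}) ∩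
      {x | t⁻¹ * ∑ i, llr σ φ (x i) < C + η / 2}
  have hAm : ∀ t, MeasurableSet (A t) := by
    intro t
    refine MeasurableSet.inter (Finset.measurableSet_biInter _ fun k _ => ?_) ?_
    · refine measurableSet_lt (Measurable.abs ?_) measurable_const
      refine ((Finset.measurable_sum _ fun i _ => ?_).const_mul _).sub_const _
      exact (measurable_div_speed k).comp (measurable_pi_apply i)
    · refine measurableSet_lt ((Finset.measurable_sum _ fun i _ => ?_).const_mul _) measurable_const
      exact (measurable_llr σ φ).comp (measurable_pi_apply i)
  have hmeas : ∀ t, Measurable fun (x : ℕ → ℝ≥0) (i : Fin ⌊r * t⌋₊) => x i := fun t =>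
    measurable_pi_lambda _ fun i => measurable_pi_apply _
  have hlim : Tendsto (fun t => Q ((fun (x : ℕ → ℝ≥0) (i : Fin ⌊r * t⌋₊) => x i) ⁻¹' A t)) atTop
      (𝓝 (Q univ)) := by
    refine tendsto_measure_of_ae_tendsto_indicator_of_isFiniteMeasure atTop MeasurableSet.univ
      (fun t => hmeas t (hAm t)) ?_
    have h1 : ∀ᵐ x ∂Q, ∀ k ∈ s, Tendsto (fun t : ℝ => t⁻¹ *
        ∑ i ∈ Finset.range ⌊r * t⌋₊, k (x i) / (x i : ℝ)) atTop
        (𝓝 (∫ p, k p ∂(ρ : Measure ℝ≥0))) := by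
      refine (ae_ball_iff s.countable_toSet).mpr fun k _ => ?_
      have := hX.tendsto_average_floor (measurable_div_speed k) (integrable_div_sizeBias hm k) hr0
      rw [integral_eq_meanSpeed_mul_add hfin hm k, measureReal_def, h0, ENNReal.toReal_zero,
        zero_mul, add_zero]
      exact this
    have h2 := hX.tendsto_average_floor (measurable_llr σ φ) hint hr0
    filter_upwards [h1, h2] with x hx1 hx2
    have h3 : ∀ᶠ t : ℝ in atTop, ∀ k ∈ s, |t⁻¹ *
        ∑ i ∈ Finset.range ⌊r * t⌋₊, k (x i) / (x i : ℝ) - ∫ p, k p ∂(ρ : Measure ℝ≥0)| < ε := by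
      rw [eventually_all_finset]
      intro k hk
      have := (hx1 k hk).eventually (Metric.ball_mem_nhds _ hε)
      simpa only [Metric.mem_ball, Real.dist_eq] using this
    have h4 := hx2.eventually_lt_const (show _ < C + η / 2 by rw [hC]; linarith)
    filter_upwards [h3, h4] with t ht3 ht4
    refine iff_of_true ?_ trivial
    refine ⟨mem_iInter₂.mpr fun k hk => ?_, ?_⟩
    · have := ht3 k hk
      rwa [Finset.sum_range] at this
    · rw [Finset.sum_range] at ht4
      exact ht4
  rw [measure_univ] at hlim
  have hhalf : ∀ᶠ t in atTop, ENNReal.ofReal (1 / 2) <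
      Q ((fun (x : ℕ → ℝ≥0) (i : Fin ⌊r * t⌋₊) => x i) ⁻¹' A t) :=
    hlim.eventually_const_lt (by
      rw [← ENNReal.ofReal_one]
      exact (ENNReal.ofReal_lt_ofReal_iff one_pos).mpr (by norm_num))
  -- The tilted probability is only bounded below by `1/2`; half of the margin `η` absorbs this
  -- factor.
  have hexp : ∀ᶠ t : ℝ in atTop, 2 ≤ Real.exp (t * (η / 2)) :=
    (Real.tendsto_exp_atTop.comp (tendsto_id.atTop_mul_const (half_pos hη))).eventually_ge_atTop 2
  filter_upwards [hhalf, hexp, eventually_gt_atTop 0] with t ht hexpt ht0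
  refine ⟨⌊r * t⌋₊, A t, hAm t, fun w hw => hs _ fun k hk => ?_, ?_⟩
  · have h1 := mem_iInter₂.mp hw.1 k hk
    have h2 : ∫ p, k p ∂(cycleFM w t ⌊r * t⌋₊ : Measure ℝ≥0) =
        t⁻¹ * ∑ i : Fin ⌊r * t⌋₊, k (w i) / (w i : ℝ) := by
      have := integral_cycleMeasure w ht0 ⌊r * t⌋₊ k
      rw [← Finset.sum_range (fun i => k (w i) / (w i : ℝ))]
      rw [eq_inv_mul_iff_mul_eq₀ ht0.ne']
      refine this.trans (Finset.sum_congr rfl fun i _ => ?_)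
      rw [div_eq_inv_mul]
    rw [h2]
    exact h1
  · have hmap := hX.map_fin ⌊r * t⌋₊
    rw [← Measure.map_apply (hmeas t) (hAm t), hmap] at ht
    -- This finite version of the density is at most `e^{llr}` everywhere, also where it vanishes
    -- and the logarithm takes the value `0`.
    have hD : σ = φ.withDensity (fun p => ENNReal.ofReal (σ.rnDeriv φ p).toReal) := by
      conv_lhs => rw [← Measure.withDensity_rnDeriv_eq σ φ hac]
      refine withDensity_congr_ae ?_
      filter_upwards [Measure.rnDeriv_ne_top σ φ] with p hp
      rw [ENNReal.ofReal_toReal hp]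
    have hle := pi_le_mul_of_density_le (N := ⌊r * t⌋₊) (by fun_prop) hD (hAm t)
      (c := ENNReal.ofReal (Real.exp (t * (C + η / 2)))) (fun x hx => by
        have h1 : ∀ i, ENNReal.ofReal (σ.rnDeriv φ (x i)).toReal ≤
            ENNReal.ofReal (Real.exp (llr σ φ (x i))) := fun i =>
          ENNReal.ofReal_le_ofReal (Real.le_exp_log _)
        refine (Finset.prod_le_prod' fun i _ => h1 i).trans ?_
        rw [← ENNReal.ofReal_prod_of_nonneg fun i _ => (Real.exp_pos _).le, ← Real.exp_sum]
        refine ENNReal.ofReal_le_ofReal (Real.exp_le_exp.mpr ?_)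
        have := hx.2
        rw [mem_ofPred_eq, inv_mul_lt_iff₀ ht0] at this
        exact this.le)
    have h5 : ENNReal.ofReal (1 / 2) * ENNReal.ofReal (Real.exp (-(t * (C + η / 2)))) ≤
        Measure.pi (fun _ : Fin ⌊r * t⌋₊ => φ) (A t) := by
      calc _ ≤ (ENNReal.ofReal (Real.exp (t * (C + η / 2))) *
            Measure.pi (fun _ : Fin ⌊r * t⌋₊ => φ) (A t)) *
            ENNReal.ofReal (Real.exp (-(t * (C + η / 2)))) := by
            gcongr
            exact ht.le.trans hle
        _ = _ := by
            rw [mul_right_comm, ← ENNReal.ofReal_mul (Real.exp_pos _).le, ← Real.exp_add]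
            simp
    refine le_trans ?_ h5
    rw [← ENNReal.ofReal_mul (by norm_num)]
    refine ENNReal.ofReal_le_ofReal ?_
    have h6 : -(t * (C + η)) = -(t * (η / 2)) + -(t * (C + η / 2)) := by ring
    rw [h6, Real.exp_add]
    refine mul_le_mul_of_nonneg_right ?_ (Real.exp_pos _).le
    rw [Real.exp_neg, ← one_div]
    exact one_div_le_one_div_of_le two_pos hexpt

/-! ### Approximation of the Dirac mass at zero -/

/-- Speeds that are at least `1 / (K + 1)`. -/
def fastSpeeds (K : ℕ) : Set ℝ≥0 := Ici ((K : ℝ≥0) + 1)⁻¹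

theorem measurableSet_fastSpeeds (K : ℕ) : MeasurableSet (fastSpeeds K) := measurableSet_Ici

theorem monotone_fastSpeeds : Monotone fastSpeeds := by
  intro m n h
  refine Ici_subset_Ici.mpr (inv_anti₀ (by positivity) ?_)
  gcongr

theorem iUnion_fastSpeeds : ⋃ K, fastSpeeds K = {0}ᶜ := by
  ext p
  simp only [mem_iUnion, fastSpeeds, mem_Ici, mem_compl_iff, mem_singleton_iff]
  constructor
  · rintro ⟨K, hK⟩ rfl
    exact absurd hK (not_le.mpr (by positivity))
  · intro hp
    obtain ⟨K, hK⟩ := exists_nat_ge p⁻¹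
    refine ⟨K, inv_le_of_inv_le₀ (pos_iff_ne_zero.mpr hp) (hK.trans ?_)⟩
    exact le_self_add

theorem inv_speed_le {p : ℝ≥0} {r : ℝ} (hr : 0 < r) (hp : r ≤ p) {c : ℝ} (hc : 0 ≤ c) :
    (p : ℝ)⁻¹ * Real.exp (c / p) ≤ r⁻¹ * Real.exp (c / r) := by
  have : (p : ℝ)⁻¹ ≤ r⁻¹ := inv_anti₀ hr hp
  refine mul_le_mul this (Real.exp_le_exp.mpr ?_) (Real.exp_pos _).le (inv_pos.mpr hr).le
  exact div_le_div_of_nonneg_left hc hr hp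

theorem tendsto_measure_fastSpeeds {μ : Measure ℝ≥0} (h0 : μ {0} = 0) :
    Tendsto (fun K => μ (fastSpeeds K)) atTop (𝓝 (μ univ)) := by
  have h := tendsto_measure_iUnion_atTop (μ := μ) monotone_fastSpeeds
  rwa [iUnion_fastSpeeds, measure_compl_singleton_eq h0] at h
where
  measure_compl_singleton_eq {μ : Measure ℝ≥0} (h0 : μ {0} = 0) : μ {0}ᶜ = μ univ := by
    rw [← measure_add_measure_compl (measurableSet_singleton (0 : ℝ≥0)), h0, zero_add]

/-- The Dirac mass at zero. -/
def diracZero : FiniteMeasure ℝ≥0 := ⟨Measure.dirac 0, inferInstance⟩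

/-- Take `κ` proportional to `p⁻¹ e^{c/p} φ` restricted to `p ≥ 1/(K+1)`. The normalization diverges
with `K` while the mass of `{p ≥ r}` before normalization stays bounded, so `κ` concentrates at `0`.
Its size-biased law is an exponential tilt of `φ` with parameter `c`, which is why the cost is at
most `c`. -/
theorem exists_dualCost_le_near_dirac {φ : Measure ℝ≥0} [IsProbabilityMeasure φ] (hφ : φ {0} = 0)
    {c : ℝ} (hc : 0 < c) (hinf : ∫⁻ p : ℝ≥0, ENNReal.ofReal (Real.exp (c / p)) ∂φ = ∞)
    {U : Set (FiniteMeasure ℝ≥0)} (hU : U ∈ 𝓝 diracZero) :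
    ∃ κ ∈ U, (κ : Measure ℝ≥0) {0} = 0 ∧ dualCost φ κ ≤ ENNReal.ofReal c := by
  set e : ℝ≥0 → ℝ≥0∞ := fun p => ENNReal.ofReal (Real.exp (c / p)) with he
  set g : ℝ≥0 → ℝ≥0∞ := fun p => ENNReal.ofReal ((p : ℝ)⁻¹ * Real.exp (c / p)) with hg
  have hem : Measurable e := by fun_prop
  have hgm : Measurable g := by fun_prop
  have hnull : ∀ f : ℝ≥0 → ℝ≥0∞, φ.withDensity f {0} = 0 := fun f =>
    withDensity_absolutelyContinuous φ f hφ
  have hexp : Tendsto (fun K => φ.withDensity e (fastSpeeds K)) atTop (𝓝 ∞) := by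
    have := tendsto_measure_fastSpeeds (hnull e)
    rwa [withDensity_apply _ MeasurableSet.univ, Measure.restrict_univ, hinf] at this
  -- The factor `p⁻¹` is at least `1` for `p ≤ 1`, and `e^{c/p} ≤ e^c` for `p ≥ 1`.
  have hginf : ∫⁻ p, g p ∂φ = ∞ := by
    by_contra hfin
    have hle : ∫⁻ p, e p ∂φ ≤ ∫⁻ p, (g p + ENNReal.ofReal (Real.exp c)) ∂φ := by
      refine lintegral_mono_ae ?_
      filter_upwards [measure_eq_zero_iff_ae_notMem.mp hφ] with p hp
      have hp' : (0 : ℝ) < p := by exact_mod_cast pos_iff_ne_zero.mpr hp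
      rcases le_or_gt 1 (p : ℝ) with h1 | h1
      · refine le_add_left (ENNReal.ofReal_le_ofReal (Real.exp_le_exp.mpr ?_))
        exact div_le_self hc.le h1
      · refine le_add_right (ENNReal.ofReal_le_ofReal ?_)
        exact le_mul_of_one_le_left (Real.exp_pos _).le ((one_le_inv₀ hp').mpr h1.le)
    rw [hinf, lintegral_add_right _ measurable_const, lintegral_const, measure_univ, mul_one] at hle
    exact absurd (top_le_iff.mp hle) (ENNReal.add_ne_top.mpr ⟨hfin, ENNReal.ofReal_ne_top⟩)
  have hgexp : Tendsto (fun K => φ.withDensity g (fastSpeeds K)) atTop (𝓝 ∞) := by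
    have := tendsto_measure_fastSpeeds (hnull g)
    rwa [withDensity_apply _ MeasurableSet.univ, Measure.restrict_univ, hginf] at this
  -- mass of the speeds which are not small
  have htail : ∀ r : ℝ, 0 < r → ∀ S : Set ℝ≥0, MeasurableSet S → (∀ p ∈ S, r ≤ (p : ℝ)) →
      φ.withDensity g S ≤ ENNReal.ofReal (r⁻¹ * Real.exp (c / r)) := by
    intro r hr S hS hSr
    rw [withDensity_apply _ hS]
    refine (setLIntegral_mono measurable_const fun p hp =>
      ENNReal.ofReal_le_ofReal (inv_speed_le hr (hSr p hp) hc.le)).trans ?_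
    rw [setLIntegral_const]
    exact mul_le_of_le_one_right' prob_le_one
  have hfast : ∀ K, ∀ p ∈ fastSpeeds K, ((K : ℝ) + 1)⁻¹ ≤ p := fun K p hp => by
    have := NNReal.coe_le_coe.mpr (mem_Ici.mp hp)
    push_cast at this
    exact this
  have hZtop : ∀ K, φ.withDensity g (fastSpeeds K) ≠ ∞ := fun K =>
    ne_top_of_le_ne_top ENNReal.ofReal_ne_top
      (htail _ (by positivity) _ (measurableSet_fastSpeeds K) (hfast K))
  set Z : ℕ → ℝ≥0∞ := fun K => φ.withDensity g (fastSpeeds K) with hZ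
  let ν : ℕ → Measure ℝ≥0 := fun K => (Z K)⁻¹ • (φ.withDensity g).restrict (fastSpeeds K)
  have hνuniv : ∀ K, Z K ≠ 0 → ν K univ = 1 := fun K hK => by
    simp only [ν, Measure.smul_apply, Measure.restrict_apply_univ, smul_eq_mul]
    exact ENNReal.inv_mul_cancel hK (hZtop K)
  have hνfin : ∀ K, IsFiniteMeasure (ν K) := fun K => by
    refine ⟨?_⟩
    by_cases hK : Z K = 0
    · have : (φ.withDensity g).restrict (fastSpeeds K) = 0 := Measure.restrict_eq_zero.mpr hK
      simp [ν, this]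
    · rw [hνuniv K hK]
      exact ENNReal.one_lt_top
  have hZpos : ∀ᶠ K in atTop, Z K ≠ 0 := by
    filter_upwards [hgexp.eventually_const_lt ENNReal.zero_lt_top] with K hK using hK.ne'
  let νF : ℕ → FiniteMeasure ℝ≥0 := fun K => ⟨ν K, hνfin K⟩
  have hlim : Tendsto νF atTop (𝓝 diracZero) := by
    rw [FiniteMeasure.tendsto_iff_forall_integral_tendsto]
    intro k
    change Tendsto (fun K => ∫ p, k p ∂(ν K)) atTop (𝓝 (∫ p, k p ∂(Measure.dirac 0)))
    rw [integral_dirac, Metric.tendsto_atTop']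
    intro ε hε
    obtain ⟨r, hr0, hr⟩ := Metric.continuousAt_iff.mp (k.continuous.continuousAt (x := 0)) (ε / 2) (half_pos hε)
    have hmass : Tendsto (fun K => (Z K)⁻¹ * ENNReal.ofReal (r⁻¹ * Real.exp (c / r))) atTop (𝓝 0) := by
      have h1 : Tendsto (fun K => (Z K)⁻¹) atTop (𝓝 0) := by
        simpa using tendsto_inv_iff.mpr hgexp
      simpa using ENNReal.Tendsto.mul_const h1 (Or.inr ENNReal.ofReal_ne_top)
    have hmass' := hmass.eventually_lt_const
      (show (0 : ℝ≥0∞) < ENNReal.ofReal (ε / (4 * (‖k‖ + 1))) by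
        rw [ENNReal.ofReal_pos]; positivity)
    obtain ⟨K₀, hK₀⟩ := (hmass'.and hZpos).exists_forall_of_atTop
    refine ⟨K₀, fun K hK => ?_⟩
    obtain ⟨h1, h2⟩ := hK₀ K hK.le
    have : IsProbabilityMeasure (ν K) := ⟨hνuniv K h2⟩
    set S : Set ℝ≥0 := {p | r ≤ (p : ℝ)} with hS
    have hSm : MeasurableSet S := measurableSet_le measurable_const measurable_coe_nnreal_real
    have hνS : (ν K).real S ≤ ε / (4 * (‖k‖ + 1)) := by
      refine ENNReal.toReal_le_of_le_ofReal (by positivity) (le_trans ?_ h1.le)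
      simp only [ν, Measure.smul_apply, smul_eq_mul]
      gcongr
      rw [Measure.restrict_apply hSm]
      exact htail r hr0 _ (hSm.inter (measurableSet_fastSpeeds K)) fun p hp => hp.1
    have hbound : ∀ p, |k p - k 0| ≤ ε / 2 + S.indicator (fun _ => 2 * ‖k‖) p := by
      intro p
      by_cases hp : p ∈ S
      · rw [indicator_of_mem hp]
        have h3 := k.norm_coe_le_norm p
        have h4 := k.norm_coe_le_norm 0
        have h5 := norm_sub_le (k p) (k 0)
        rw [Real.norm_eq_abs] at h5
        linarith
      · rw [indicator_of_notMem hp, add_zero]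
        have hp' : (p : ℝ) < r := not_le.mp hp
        have := hr (x := p) (by simpa [NNReal.dist_eq] using hp')
        rw [Real.dist_eq] at this
        exact this.le
    have h6 : ∫ p, k p ∂(ν K) - k 0 = ∫ p, (k p - k 0) ∂(ν K) := by
      rw [integral_sub (k.integrable _) (integrable_const _)]
      simp
    rw [Real.dist_eq, h6]
    have hi : Integrable (fun p => ε / 2 + S.indicator (fun _ => 2 * ‖k‖) p) (ν K) :=
      (integrable_const _).add ((integrable_const _).indicator hSm)
    calc |∫ p, (k p - k 0) ∂(ν K)| ≤ ∫ p, |k p - k 0| ∂(ν K) := abs_integral_le_integral_abs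
      _ ≤ ∫ p, (ε / 2 + S.indicator (fun _ => 2 * ‖k‖) p) ∂(ν K) :=
          integral_mono (((k.integrable _).sub (integrable_const _)).abs) hi hbound
      _ = ε / 2 + (ν K).real S * (2 * ‖k‖) := by
          rw [integral_add (integrable_const _) ((integrable_const _).indicator hSm),
            integral_indicator_const _ hSm]
          simp
      _ ≤ ε / 2 + ε / (4 * (‖k‖ + 1)) * (2 * ‖k‖) := by gcongr
      _ < ε := by
          have hk0 := norm_nonneg k
          have : ε / (4 * (‖k‖ + 1)) * (2 * ‖k‖) < ε / 2 := by
            rw [div_mul_eq_mul_div, div_lt_div_iff₀ (by positivity) two_pos]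
            nlinarith
          linarith
  -- For large `K` the truncated moment of `e^{c/p}` exceeds `1`, the bound on the moment of
  -- `e^{k/p}` for any admissible `k`.
  have hone := hexp.eventually_const_lt (show (1 : ℝ≥0∞) < ∞ from ENNReal.one_lt_top)
  obtain ⟨K, hKU, hKZ, hK1⟩ := ((hlim.eventually hU).and (hZpos.and hone)).exists
  refine ⟨_, hKU, ?_, ?_⟩
  · change ν K {0} = 0
    simp only [ν, Measure.smul_apply, smul_eq_mul]
    rw [Measure.restrict_apply (measurableSet_singleton _),
      measure_mono_null inter_subset_left (hnull g), mul_zero]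
  change dualCost φ (ν K) ≤ _
  refine iSup₂_le fun k hk => ENNReal.ofReal_le_ofReal ?_
  set B := fastSpeeds K with hB
  have hBm := measurableSet_fastSpeeds K
  set r : ℝ := ((K : ℝ) + 1)⁻¹ with hr
  have hr0 : 0 < r := by positivity
  -- integrals over `B`
  have hint : ∀ h : ℝ≥0 → ℝ, Measurable h → (∃ M, ∀ p ∈ B, |h p| ≤ M) →
      Integrable h (φ.restrict B) := by
    rintro h hm ⟨M, hM⟩
    exact Integrable.of_bound hm.aestronglyMeasurable M
      ((ae_restrict_iff' hBm).mpr (ae_of_all _ hM))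
  have hpos : ∀ p ∈ B, (0 : ℝ) < p := fun p hp => hr0.trans_le (hfast K p hp)
  have hden : ∀ p ∈ B, |(p : ℝ)⁻¹ * Real.exp (c / p)| ≤ r⁻¹ * Real.exp (c / r) := fun p hp => by
    rw [abs_of_nonneg (by positivity)]
    exact inv_speed_le hr0 (hfast K p hp) hc.le
  have hi1 : Integrable (fun p : ℝ≥0 => (p : ℝ)⁻¹ * Real.exp (c / p)) (φ.restrict B) :=
    hint _ (by fun_prop) ⟨_, hden⟩
  have hi2 : Integrable (fun p : ℝ≥0 => (p : ℝ)⁻¹ * Real.exp (c / p) * k p) (φ.restrict B) :=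
    hi1.mul_bdd (c := ‖k‖) k.continuous.aestronglyMeasurable
      (ae_of_all _ fun p => k.norm_coe_le_norm p)
  have hexpdiv : ∀ (M : ℝ) (h : ℝ≥0 → ℝ), (∀ p, |h p| ≤ M) → ∀ p ∈ B,
      |Real.exp (h p / p)| ≤ Real.exp (M / r) := fun M h hM p hp => by
    rw [Real.abs_exp]
    refine Real.exp_le_exp.mpr ((div_le_div_of_nonneg_right
      ((le_abs_self _).trans (hM p)) (hpos p hp).le).trans ?_)
    exact div_le_div_of_nonneg_left ((abs_nonneg _).trans (hM 0)) hr0 (hfast K p hp)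
  have hi3 : Integrable (fun p : ℝ≥0 => Real.exp (k p / p)) (φ.restrict B) :=
    hint _ (Real.measurable_exp.comp (measurable_div_speed k))
      ⟨_, hexpdiv ‖k‖ k fun p => k.norm_coe_le_norm p⟩
  have hi4 : Integrable (fun p : ℝ≥0 => Real.exp (c / p)) (φ.restrict B) :=
    hint _ (by fun_prop) ⟨_, hexpdiv c (fun _ => c) fun _ => (abs_of_pos hc).le⟩
  have hk1 : ∫ p in B, Real.exp (k p / p) ∂φ ≤ 1 := by
    rw [integral_eq_lintegral_of_nonneg_ae (ae_of_all _ fun p => (Real.exp_pos _).le)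
      hi3.aestronglyMeasurable]
    refine ENNReal.toReal_le_of_le_ofReal zero_le_one ?_
    rw [ENNReal.ofReal_one]
    exact (setLIntegral_le_lintegral _ _).trans hk
  have hc1 : 1 ≤ ∫ p in B, Real.exp (c / p) ∂φ := by
    rw [integral_eq_lintegral_of_nonneg_ae (ae_of_all _ fun p => (Real.exp_pos _).le)
      hi4.aestronglyMeasurable]
    rw [withDensity_apply _ hBm] at hK1
    rw [← ENNReal.toReal_one]
    refine ENNReal.toReal_mono ?_ hK1.le
    exact (hi4.lintegral_lt_top).ne
  -- Convexity gives `e^{c/p} (k - c)/p ≤ e^{k/p} - e^{c/p}`, and the integral over `B` of the right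
  -- side is at most `1 - 1`.
  have hdiff : ∫ p in B, (p : ℝ)⁻¹ * Real.exp (c / p) * k p ∂φ -
      c * ∫ p in B, (p : ℝ)⁻¹ * Real.exp (c / p) ∂φ ≤ 0 := by
    rw [← integral_const_mul, ← integral_sub hi2 (hi1.const_mul c)]
    calc _ ≤ ∫ p in B, (Real.exp (k p / p) - Real.exp (c / p)) ∂φ := by
          refine setIntegral_mono_on (hi2.sub (hi1.const_mul c)) (hi3.sub hi4) hBm fun p hp => ?_
          have h1 := Real.add_one_le_exp ((k p - c) / p)
          have h2 : Real.exp (k p / p) = Real.exp (c / p) * Real.exp ((k p - c) / p) := by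
            rw [← Real.exp_add]
            congr 1
            ring
          have h3 : (p : ℝ)⁻¹ * Real.exp (c / p) * k p - c * ((p : ℝ)⁻¹ * Real.exp (c / p)) =
              Real.exp (c / p) * ((k p - c) / p) := by
            rw [div_eq_mul_inv]; ring
          rw [h3, h2]
          nlinarith [Real.exp_pos (c / p)]
      _ = ∫ p in B, Real.exp (k p / p) ∂φ - ∫ p in B, Real.exp (c / p) ∂φ := integral_sub hi3 hi4
      _ ≤ 0 := by linarith
  have hZreal : (Z K).toReal = ∫ p in B, (p : ℝ)⁻¹ * Real.exp (c / p) ∂φ := by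
    rw [integral_eq_lintegral_of_nonneg_ae (ae_of_all _ fun p => by positivity)
      hi1.aestronglyMeasurable]
    simp only [hZ]
    rw [withDensity_apply _ hBm]
  have hνint : ∫ p, k p ∂(ν K) = (Z K).toReal⁻¹ *
      ∫ p in B, (p : ℝ)⁻¹ * Real.exp (c / p) * k p ∂φ := by
    simp only [ν]
    rw [integral_smul_measure, setIntegral_withDensity_eq_setIntegral_toReal_smul hgm
      (ae_of_all _ fun p => ENNReal.ofReal_lt_top) _ hBm, ENNReal.toReal_inv, smul_eq_mul]
    congr 1
    refine integral_congr_ae (ae_of_all _ fun p => ?_)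
    simp only [hg, smul_eq_mul]
    rw [ENNReal.toReal_ofReal (by positivity)]
  have hZ0 : 0 < (Z K).toReal := ENNReal.toReal_pos hKZ (hZtop K)
  rw [hνint, inv_mul_le_iff₀ hZ0, hZreal]
  linarith

/-- The atom at `0` is split off and replaced by a nearby measure without atom at `0`, at a cost
slightly above `ξ` per unit of mass; this is possible because every `c > ξ` has an infinite
exponential moment. -/
theorem attainable_dualCost {φ : Measure ℝ≥0} [IsProbabilityMeasure φ] (hφ : φ {0} = 0)
    (ρ : FiniteMeasure ℝ≥0) (h : dualCost φ ρ ≠ ∞) : Attainable φ ρ (dualCost φ ρ).toReal := by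
  by_cases h0 : (ρ : Measure ℝ≥0) {0} = 0
  · exact attainable_of_apply_zero hφ ρ h0 h
  set a := ((ρ : Measure ℝ≥0) {0}).toNNReal with ha
  have ha0 : a ≠ 0 := by
    rw [ha, Ne, ENNReal.toNNReal_eq_zero_iff]
    simp [h0, measure_ne_top]
  let ρ₁ : FiniteMeasure ℝ≥0 := ⟨(ρ : Measure ℝ≥0).restrict {0}ᶜ, inferInstance⟩
  have hsplit : (ρ : Measure ℝ≥0) = (ρ : Measure ℝ≥0).restrict {0}ᶜ + a • Measure.dirac 0 := by
    conv_lhs => rw [← Measure.restrict_compl_add_restrict (μ := (ρ : Measure ℝ≥0))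
      (measurableSet_singleton 0)]
    rw [Measure.restrict_singleton]
    congr 1
    change _ = ((((ρ : Measure ℝ≥0) {0}).toNNReal : ℝ≥0) : ℝ≥0∞) • Measure.dirac (0 : ℝ≥0)
    rw [ENNReal.coe_toNNReal (measure_ne_top _ _)]
  have hsplit' : ρ = ρ₁ + a • diracZero := Subtype.ext hsplit
  have hfin := meanSpeed_lt_top_of_dualCost hφ h
  have hfin₁ : meanSpeed ((ρ : Measure ℝ≥0).restrict {0}ᶜ) < ∞ := by
    rw [hsplit, meanSpeed_add_dirac] at hfin
    exact hfin
  have hcost : dualCost φ ρ = dualCost φ (ρ₁ : Measure ℝ≥0) + a * xi φ := by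
    rw [dualCost_eq_cycleCost _ hφ hfin, dualCost_eq_cycleCost (ρ₁ : Measure ℝ≥0) hφ hfin₁]
    conv_lhs => rw [hsplit]
    rw [cycleCost_add_dirac]
    rfl
  have hxi : xi φ ≠ ∞ := by
    intro hxi
    rw [hcost, hxi, ENNReal.mul_top (by simpa using ha0)] at h
    simp at h
  have hρ₁ : dualCost φ (ρ₁ : Measure ℝ≥0) ≠ ∞ := fun h1 => h (by rw [hcost, h1, top_add])
  refine Attainable.of_approx fun U hU η hη => ?_
  -- For an atom of mass `a` the extra cost is `a η / (a + 1) ≤ η`.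
  set c := (xi φ).toReal + η / (a + 1) with hc
  have ha1 : (0 : ℝ) < a + 1 := by positivity
  have hc0 : 0 < c := add_pos_of_nonneg_of_pos ENNReal.toReal_nonneg (div_pos hη ha1)
  have hinf : ∫⁻ p : ℝ≥0, ENNReal.ofReal (Real.exp (c / p)) ∂φ = ∞ := by
    by_contra hne
    have := le_xi (lt_top_iff_ne_top.mpr hne)
    rw [← ENNReal.ofReal_toReal hxi, ENNReal.ofReal_le_ofReal_iff ENNReal.toReal_nonneg] at this
    have h2 := div_pos hη ha1
    linarith
  have hcont : Continuous fun κ : FiniteMeasure ℝ≥0 => ρ₁ + a • κ :=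
    continuous_const.add (continuous_const_smul a)
  have hU' : (fun κ : FiniteMeasure ℝ≥0 => ρ₁ + a • κ) ⁻¹' U ∈ 𝓝 diracZero := by
    refine hcont.continuousAt ?_
    rw [← hsplit']
    exact hU
  obtain ⟨κ, hκU, hκ0, hκ⟩ := exists_dualCost_le_near_dirac hφ hc0 hinf hU'
  have hle : dualCost φ ((ρ₁ + a • κ : FiniteMeasure ℝ≥0) : Measure ℝ≥0) ≤
      dualCost φ (ρ₁ : Measure ℝ≥0) + a * ENNReal.ofReal c := by
    rw [FiniteMeasure.toMeasure_add, FiniteMeasure.toMeasure_smul]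
    refine (dualCost_add_le _ _ _).trans ?_
    gcongr
    exact (dualCost_smul_le _ _ _).trans (by gcongr)
  have hfin2 : dualCost φ (ρ₁ : Measure ℝ≥0) + a * ENNReal.ofReal c ≠ ∞ :=
    ENNReal.add_ne_top.mpr ⟨hρ₁, ENNReal.mul_ne_top ENNReal.coe_ne_top ENNReal.ofReal_ne_top⟩
  refine ⟨ρ₁ + a • κ, hκU, _, ?_, attainable_of_apply_zero hφ _ ?_ (ne_top_of_le_ne_top hfin2 hle)⟩
  · refine (ENNReal.toReal_mono hfin2 hle).trans ?_
    rw [hcost, ENNReal.toReal_add hρ₁ (ENNReal.mul_ne_top ENNReal.coe_ne_top hxi),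
      ENNReal.toReal_add hρ₁ (ENNReal.mul_ne_top ENNReal.coe_ne_top ENNReal.ofReal_ne_top),
      ENNReal.toReal_mul, ENNReal.toReal_mul, ENNReal.toReal_ofReal hc0.le, ENNReal.coe_toReal, hc]
    have : (a : ℝ) * (η / (a + 1)) ≤ η := by
      rw [← mul_div_assoc, div_le_iff₀ ha1]
      nlinarith
    nlinarith
  · rw [FiniteMeasure.toMeasure_add, FiniteMeasure.toMeasure_smul, Measure.add_apply,
      nnreal_smul_apply, hκ0, mul_zero, add_zero]
    change (ρ : Measure ℝ≥0).restrict {0}ᶜ {0} = 0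
    rw [Measure.restrict_apply (measurableSet_singleton _)]
    simp

/-! ### Lower bounds for the process -/

theorem exists_of_eventually_config {x : Config × unitInterval} {P : Config × unitInterval → Prop}
    (h : ∀ᶠ y in 𝓝 x, P y) : ∃ U ∈ 𝓝 x.1.1.1, ∃ ε > 0, ∀ y : Config × unitInterval,
      y.1.1.1 ∈ U → |(y.1.2 : ℝ) - x.1.2| < ε → |(y.2 : ℝ) - x.2| < ε → P y := by
  obtain ⟨⟨ρ, ℓ⟩, p⟩ := x
  rw [nhds_prod_eq, nhds_prod_eq] at h
  obtain ⟨P₁, h₁, P₂, h₂, h12⟩ := eventually_prod_iff.mp h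
  obtain ⟨P₃, h₃, P₄, h₄, h34⟩ := eventually_prod_iff.mp h₁
  obtain ⟨U, hU, hUP⟩ := mem_nhds_subtype _ _ _ |>.mp h₃
  obtain ⟨ε₁, hε₁, h₁'⟩ := Metric.eventually_nhds_iff.mp h₄
  obtain ⟨ε₂, hε₂, h₂'⟩ := Metric.eventually_nhds_iff.mp h₂
  refine ⟨U, hU, min ε₁ ε₂, lt_min hε₁ hε₂, fun y hy1 hy2 hy3 => ?_⟩
  exact h12 (x := y.1) (h34 (x := y.1.1) (hUP hy1) (y := y.1.2) (h₁' (hy2.trans_le (min_le_left _ _))))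
    (y := y.2) (h₂' (hy3.trans_le (min_le_right _ _)))

theorem mass_cycleFM (w : ℕ → ℝ≥0) {t : ℝ} (ht : 0 < t) (n : ℕ) (T₀ : ℝ) :
    t * ((cycleFM w t n).mass : ℝ) = renewalTime T₀ w n - T₀ := by
  have h2 : ((cycleFM w t n).mass : ℝ≥0∞) = _ :=
    (FiniteMeasure.ennreal_mass).trans (cycleMeasure_univ w t n)
  rw [ENNReal.coe_inj] at h2
  rw [h2, ← sum_inv_eq_renewalTime_sub]
  push_cast
  rw [Real.coe_toNNReal t ht.le, ← mul_assoc, mul_inv_cancel₀ ht.ne', one_mul]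

theorem eventually_mass_lt {ρ : FiniteMeasure ℝ≥0} {θ : ℝ} (hθ : 0 < θ) :
    ∀ᶠ ρ' : FiniteMeasure ℝ≥0 in 𝓝 ρ, |(ρ'.mass : ℝ) - ρ.mass| < θ := by
  have h := (NNReal.continuous_coe.comp (FiniteMeasure.continuous_mass (Ω := ℝ≥0))).tendsto ρ
  exact h.eventually (Metric.ball_mem_nhds _ hθ)

/-- A last cycle with speed in a window of relative width `δ`, after cycles of occupation measure
close to `x.1`, leads to an empirical measure close to `mixture x`. -/
theorem exists_window_subset {T₀ : ℝ} (hT₀ : 0 ≤ T₀) {x : Config} (hr : 0 < restMass x.1)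
    (h0 : (0 : ℝ) < x.2) (h1 : (x.2 : ℝ) < 1) {O : Set (ProbabilityMeasure Phase)} (hO : IsOpen O)
    (hx : mixtureProb x ∈ O) :
    ∃ U ∈ 𝓝 x.1.1, ∃ δ ∈ Ioo (0 : ℝ) 1, ∀ᶠ t : ℝ in atTop, ∀ w Z N, Tracks T₀ w Z →
      cycleFM w t N ∈ U → w N ∈ window δ (x.2 / (restMass x.1 * t)) → Z t ∈ O := by
  have hev := eventually_notMem_of_mixtureProb_notMem (T₀ := T₀) (C := Oᶜ) hO.isClosed_compl
    (x := (x, 0)) (fun h => h hx)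
  obtain ⟨pa, hpa, pb, hpb, hp⟩ := eventually_prod_iff.mp hev
  obtain ⟨U, hU, ε, hε, hUε⟩ := exists_of_eventually_config hpb
  set ℓ : ℝ := (x.2 : ℝ) with hℓ
  set r : ℝ := (restMass x.1 : ℝ) with hrdef
  have hr' : 0 < r := by exact_mod_cast hr
  -- One relative error `θ` is allowed for each of the mass of the cycles, the delay (`T₀ ≤ θ r t`)
  -- and the last speed. The final position then differs from `ℓ` by at most `3 θ`, which is below
  -- both `ε` and `1 - ℓ`.
  set θ : ℝ := min (min ε (1 - ℓ)) 1 / 8 with hθ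
  have hθ0 : 0 < θ := by
    have := sub_pos.mpr h1
    positivity
  have hθε : 8 * θ ≤ ε := by
    rw [hθ]; linarith [min_le_left (min ε (1 - ℓ)) 1, min_le_left ε (1 - ℓ)]
  have hθℓ : 8 * θ ≤ 1 - ℓ := by
    rw [hθ]; linarith [min_le_left (min ε (1 - ℓ)) 1, min_le_right ε (1 - ℓ)]
  have hθ1 : 8 * θ ≤ 1 := by
    rw [hθ]; linarith [min_le_right (min ε (1 - ℓ)) 1]
  refine ⟨U ∩ {ρ' | |(ρ'.mass : ℝ) - x.1.1.mass| < r * θ}, inter_mem hU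
    (eventually_mass_lt (by positivity)), θ, ⟨hθ0, by linarith⟩, ?_⟩
  have hsmall : Tendsto (fun t : ℝ => ℓ / (r * t) * (1 + θ)) atTop (𝓝 (0 * (1 + θ))) := by
    refine Tendsto.mul_const _ ?_
    exact tendsto_const_nhds.div_atTop (tendsto_id.const_mul_atTop hr')
  rw [zero_mul] at hsmall
  filter_upwards [hpa, eventually_gt_atTop 0, hsmall.eventually_lt_const hε,
    eventually_ge_atTop (T₀ / (r * θ))] with t hta ht htε htT
  intro w Z N hZ hcyc hw
  have hT0t : T₀ ≤ t * (r * θ) := (div_le_iff₀ (by positivity)).mp htT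
  have hmass := mass_cycleFM w ht N T₀
  have hm := hcyc.2
  rw [mem_ofPred_eq] at hm
  obtain ⟨hm1, hm2⟩ := abs_lt.mp hm
  set T := renewalTime T₀ w N with hT
  have hrm : r = 1 - x.1.1.mass := coe_restMass x.1
  have hh : t - T = t * (1 - ((cycleFM w t N).mass : ℝ)) - T₀ := by linarith
  have hup : t - T ≤ t * (r * (1 + θ)) := by
    rw [hh]
    have : t * (1 - ((cycleFM w t N).mass : ℝ)) ≤ t * (r * (1 + θ)) :=
      mul_le_mul_of_nonneg_left (by linarith) ht.le
    linarith
  have hlow : t * (r * (1 - 2 * θ)) ≤ t - T := by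
    rw [hh]
    have : t * (r * (1 - θ)) ≤ t * (1 - ((cycleFM w t N).mass : ℝ)) :=
      mul_le_mul_of_nonneg_left (by linarith) ht.le
    nlinarith
  have hh0 : 0 < t - T := lt_of_lt_of_le (mul_pos ht (mul_pos hr' (by linarith))) hlow
  obtain ⟨hw1, hw2⟩ := hw
  have hrt : 0 < r * t := mul_pos hr' ht
  have hw0 : (0 : ℝ) < w N := lt_of_lt_of_le (mul_pos (div_pos h0 hrt) (by linarith)) hw1
  have hpos_up : (t - T) * w N ≤ ℓ * ((1 + θ) * (1 + θ)) := by
    calc (t - T) * w N ≤ t * (r * (1 + θ)) * (ℓ / (r * t) * (1 + θ)) :=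
          mul_le_mul hup hw2.le hw0.le (by positivity)
      _ = _ := by field_simp
  have hpos_low : ℓ * ((1 - 2 * θ) * (1 - θ)) ≤ (t - T) * w N := by
    calc ℓ * ((1 - 2 * θ) * (1 - θ)) = t * (r * (1 - 2 * θ)) * (ℓ / (r * t) * (1 - θ)) := by
          field_simp
      _ ≤ _ := mul_le_mul hlow hw1 (mul_nonneg (div_nonneg h0.le hrt.le) (by linarith)) hh0.le
  have hup' : (t - T) * w N ≤ ℓ + 3 * θ := by nlinarith
  have hlow' : ℓ - 3 * θ ≤ (t - T) * w N := by nlinarith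
  -- The position at time `t` is at most `ℓ + 3 θ < 1`, so the last cycle is not completed.
  have hlt : t < renewalTime T₀ w (N + 1) := by
    rw [renewalTime_succ]
    have : t - T < (w N : ℝ)⁻¹ := by
      rw [lt_inv_comm₀ hh0 hw0, ← one_div, lt_div_iff₀ hh0, mul_comm]
      linarith
    linarith
  obtain ⟨y, hy⟩ := exists_snapshot hT₀ ht (sub_pos.mp hh0).le hlt
  by_contra hcon
  refine hp hta (y := y) (hUε y ?_ ?_ ?_) w Z N hZ hy hcon
  · have : y.1.1.1 = cycleFM w t N := Subtype.ext hy.cycles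
    rw [this]
    exact hcyc.1
  · rw [hy.position, abs_lt]
    constructor <;> linarith
  · rw [hy.speed]
    have : ((0 : unitInterval) : ℝ) = 0 := rfl
    rw [this, sub_zero, abs_of_nonneg (le_min hw0.le zero_le_one)]
    exact (min_le_left _ _).trans_lt (hw2.trans htε)

/-- If the completed cycles take almost all of the time, then the last one does not matter. -/
theorem eventually_mem_of_restMass_eq_zero {T₀ : ℝ} {x : Config} (hr : restMass x.1 = 0)
    {O : Set (ProbabilityMeasure Phase)} (hO : IsOpen O) (hx : mixtureProb x ∈ O) :
    ∀ᶠ z : ℝ × FiniteMeasure ℝ≥0 in atTop ×ˢ 𝓝 x.1.1, ∀ w Z N, Tracks T₀ w Z →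
      cycleFM w z.1 N = z.2 → renewalTime T₀ w N ≤ z.1 → Z z.1 ∈ O := by
  by_contra hcon
  rw [not_eventually] at hcon
  set S : Set (ℝ × FiniteMeasure ℝ≥0) := {z | ¬ ∀ w Z N, Tracks T₀ w Z →
      cycleFM w z.1 N = z.2 → renewalTime T₀ w N ≤ z.1 → Z z.1 ∈ O} with hS
  set F : Filter (ℝ × FiniteMeasure ℝ≥0) := (atTop ×ˢ 𝓝 x.1.1) ⊓ 𝓟 S with hF
  have hne : F.NeBot := frequently_mem_iff_neBot.mp hcon
  have hex : ∀ z ∈ S, ∃ w Z N, Tracks T₀ w Z ∧ cycleFM w z.1 N = z.2 ∧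
      renewalTime T₀ w N ≤ z.1 ∧ Z z.1 ∉ O := by
    intro z hz
    simp only [hS, mem_ofPred_eq] at hz
    push Not at hz
    exact hz
  have : Nonempty (ProbabilityMeasure Phase) := ⟨mixtureProb x⟩
  choose! w Z N hZ hcyc hle hmem using hex
  have hSF : ∀ᶠ z in F, z ∈ S := mem_inf_of_right (mem_principal_self S)
  have hleF : F ≤ atTop ×ˢ 𝓝 x.1.1 := inf_le_left
  have ht : Tendsto (fun z : ℝ × FiniteMeasure ℝ≥0 => z.1) F atTop := tendsto_fst.mono_left hleF
  have hy : Tendsto (fun z : ℝ × FiniteMeasure ℝ≥0 => z.2) F (𝓝 x.1.1) :=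
    tendsto_snd.mono_left hleF
  have htpos : ∀ᶠ z in F, (0 : ℝ) < z.1 := ht.eventually_gt_atTop 0
  have hmass : Tendsto (fun z : ℝ × FiniteMeasure ℝ≥0 => 1 - (z.2.mass : ℝ)) F (𝓝 0) := by
    have h1 := ((NNReal.continuous_coe.comp (FiniteMeasure.continuous_mass (Ω := ℝ≥0))).tendsto
      x.1.1).comp hy
    have h2 : (0 : ℝ) = 1 - x.1.1.mass := by rw [← coe_restMass, hr]; rfl
    rw [h2]
    exact h1.const_sub 1
  have hlim : Tendsto (fun z => Z z z.1) F (𝓝 (mixtureProb x)) := by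
    rw [ProbabilityMeasure.tendsto_iff_forall_integral_tendsto]
    intro f
    change Tendsto _ _ (𝓝 (∫ q, f q ∂(mixture x)))
    rw [integral_mixture, hr, NNReal.coe_zero, zero_mul, add_zero]
    have h1 : Tendsto (fun z : ℝ × FiniteMeasure ℝ≥0 => ∫ p, fullSweep f p ∂(z.2 : Measure ℝ≥0)) F
        (𝓝 (∫ p, fullSweep f p ∂(x.1.1 : Measure ℝ≥0))) :=
      ((FiniteMeasure.continuous_integral_boundedContinuousFunction (fullSweep f)).tendsto _).comp hy
    have h2 : Tendsto (fun z => ∫ q, f q ∂(Z z z.1 : Measure Phase) -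
        ∫ p, fullSweep f p ∂(z.2 : Measure ℝ≥0)) F (𝓝 0) := by
      refine squeeze_zero_norm' (a := fun z => ‖f‖ * (1 - (z.2.mass : ℝ))) ?_
        (by simpa using hmass.const_mul ‖f‖)
      filter_upwards [hSF, htpos] with z hz hz0
      have h3 := (hZ z hz).bound_cycles z.1 hz0 (N z) (hle z hz) f
      rw [← integral_cycleMeasure _ hz0] at h3
      have h4 : (cycleMeasure (w z) z.1 (N z)) = (z.2 : Measure ℝ≥0) := by rw [← hcyc z hz]; rfl
      rw [h4] at h3
      have h5 := mass_cycleFM (w z) hz0 (N z) T₀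
      rw [hcyc z hz] at h5
      have h6 : T₀ + (z.1 - renewalTime T₀ (w z) (N z)) = z.1 * (1 - (z.2.mass : ℝ)) := by linarith
      rw [h6, ← mul_sub, abs_mul, abs_of_pos hz0, mul_left_comm] at h3
      exact le_of_mul_le_mul_left h3 hz0
    have h5 := h2.add h1
    rw [zero_add] at h5
    refine h5.congr fun z => ?_
    ring
  exact hO.isClosed_compl.mem_of_tendsto hlim (hSF.mono hmem) hx

/-! ### Probability of prescribed cycles followed by a prescribed last speed -/

section Lower

variable {Ω' : Type*} [MeasurableSpace Ω'] {ℙ : Measure Ω'} [IsProbabilityMeasure ℙ]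
  {φ : Measure ℝ≥0} {v : ℕ → Ω' → ℝ≥0}

theorem IsIID.measure_fin_mem (hv : IsIID ℙ φ v) {N : ℕ} {A : Set (Fin N → ℝ≥0)}
    (hA : MeasurableSet A) :
    ℙ {ω | (fun i : Fin N => v i ω) ∈ A} = Measure.pi (fun _ : Fin N => φ) A := by
  have h := Measure.map_apply (μ := ℙ) (f := fun ω (i : Fin N) => v i ω)
    (measurable_pi_lambda _ fun i => hv.meas i) hA
  rw [← hv.map_fin N, h]
  rfl

theorem IsIID.measure_fin_mem_inter (hv : IsIID ℙ φ v) {N : ℕ} {A : Set (Fin N → ℝ≥0)}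
    (hA : MeasurableSet A) {W : Set ℝ≥0} (hW : MeasurableSet W) :
    ℙ ({ω | (fun i : Fin N => v i ω) ∈ A} ∩ {ω | v N ω ∈ W}) =
      Measure.pi (fun _ : Fin N => φ) A * φ W := by
  have hind := hv.indep.indepFun_finset (Finset.range N) {N} (by simp) hv.meas
  have h1 : ProbabilityTheory.IndepFun (fun ω (i : Fin N) => v i ω) (v N) ℙ :=
    hind.comp (φ := fun (f : Finset.range N → ℝ≥0) (i : Fin N) =>
        f ⟨i, Finset.mem_range.mpr i.2⟩)
      (ψ := fun f : ({N} : Finset ℕ) → ℝ≥0 => f ⟨N, Finset.mem_singleton_self N⟩)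
      (measurable_pi_lambda _ fun i => measurable_pi_apply _) (measurable_pi_apply _)
  have h2 := h1.measure_inter_preimage_eq_mul A W hA hW
  rw [← hv.measure_fin_mem hA]
  refine h2.trans (congrArg _ ?_)
  rw [← Measure.map_apply (hv.meas N) hW, hv.law_eq]

variable {T₀ : ℝ} {Y : Ω' → ℝ → ProbabilityMeasure Phase}

/-- The first `N` speeds and the next one are independent: the former produce the cycles, and the
latter a last cycle that ends near `ℓ` at time `t`. -/
theorem IsIID.exists_window_le_law (hv : IsIID ℙ φ v) (hT₀ : 0 ≤ T₀)
    (hY : ∀ ω, Tracks T₀ (fun i => v i ω) (Y ω)) {x : Config} (hr : 0 < restMass x.1)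
    (h0 : (0 : ℝ) < x.2) (h1 : (x.2 : ℝ) < 1) {C : ℝ} (hC : Attainable φ x.1.1 C)
    {O : Set (ProbabilityMeasure Phase)} (hO : IsOpen O) (hx : mixtureProb x ∈ O) :
    ∃ δ ∈ Ioo (0 : ℝ) 1, ∀ η > 0, ∀ᶠ t : ℝ in atTop,
      ENNReal.ofReal (Real.exp (-(t * (C + η)))) * φ (window δ (x.2 / (restMass x.1 * t))) ≤
        law ℙ Y t O := by
  obtain ⟨U, hU, δ, hδ, hev⟩ := exists_window_subset hT₀ hr h0 h1 hO hx
  refine ⟨δ, hδ, fun η hη => ?_⟩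
  filter_upwards [hev, hC U hU η hη] with t ht1 ht2
  obtain ⟨N, A, hA, hAU, hbd⟩ := ht2
  calc _ ≤ Measure.pi (fun _ : Fin N => φ) A * φ (window δ (x.2 / (restMass x.1 * t))) := by
        gcongr
    _ = _ := (hv.measure_fin_mem_inter hA (measurableSet_window _ _)).symm
    _ ≤ _ := measure_mono fun ω hω => ht1 _ (Y ω) N (hY ω) (hAU (fun i => v i ω) hω.1) hω.2

/-- If the cycles are to fill all of the time, no room is left for the delay or for fluctuations.
Aiming at `θ ρ` with `θ < 1` close to `1` leaves a small fraction of free time, is no more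
expensive, and makes what happens in that time irrelevant. -/
theorem IsIID.exp_le_law_of_restMass_eq_zero (hv : IsIID ℙ φ v) [IsProbabilityMeasure φ]
    (hφ : φ {0} = 0) (hY : ∀ ω, Tracks T₀ (fun i => v i ω) (Y ω)) {x : Config}
    (hr : restMass x.1 = 0) (hC : dualCost φ (x.1.1 : Measure ℝ≥0) ≠ ∞)
    {O : Set (ProbabilityMeasure Phase)} (hO : IsOpen O) (hx : mixtureProb x ∈ O) {η : ℝ}
    (hη : 0 < η) :
    ∀ᶠ t : ℝ in atTop, ENNReal.ofReal (Real.exp (-(t *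
      ((dualCost φ (x.1.1 : Measure ℝ≥0)).toReal + η)))) ≤ law ℙ Y t O := by
  obtain ⟨pa, hpa, pb, hpb, hp⟩ := eventually_prod_iff.mp
    (eventually_mem_of_restMass_eq_zero (T₀ := T₀) hr hO hx)
  obtain ⟨V, hVp, hV, hxV⟩ := mem_nhds_iff.mp hpb
  have hone : x.1.1.mass = 1 := by
    have := mass_add_restMass x.1
    rwa [hr, add_zero] at this
  obtain ⟨θ, hθV, hθ0, hθ1⟩ : ∃ θ : ℝ≥0, θ • x.1.1 ∈ V ∧ 0 < θ ∧ θ < 1 := by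
    have hcont : Continuous fun θ : ℝ≥0 => θ • x.1.1 := continuous_id.smul continuous_const
    have h1 : ∀ᶠ θ : ℝ≥0 in 𝓝[<] 1, θ • x.1.1 ∈ V := by
      refine nhdsWithin_le_nhds (hcont.continuousAt.eventually_mem ?_)
      rw [one_smul]
      exact hV.mem_nhds hxV
    have : (𝓝[<] (1 : ℝ≥0)).NeBot := nhdsLT_neBot_of_exists_lt ⟨0, zero_lt_one⟩
    obtain ⟨θ, h1, h2⟩ := (h1.and (Ioo_mem_nhdsLT (zero_lt_one (α := ℝ≥0)))).exists
    exact ⟨θ, h1, h2.1, h2.2⟩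
  have hcost : dualCost φ ((θ • x.1.1 : FiniteMeasure ℝ≥0) : Measure ℝ≥0) ≤
      dualCost φ (x.1.1 : Measure ℝ≥0) := by
    rw [FiniteMeasure.toMeasure_smul]
    exact (dualCost_smul_le _ _ _).trans (mul_le_of_le_one_left' (by exact_mod_cast hθ1.le))
  have hatt := attainable_dualCost hφ (θ • x.1.1) (ne_top_of_le_ne_top hC hcost)
  have hmass : (θ • x.1.1).mass = θ := by
    rw [FiniteMeasure.mass, FiniteMeasure.smul_apply, smul_eq_mul]
    change θ * x.1.1.mass = θ
    rw [hone, mul_one]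
  have hθ1' : (0 : ℝ) < 1 - θ := sub_pos.mpr (by exact_mod_cast hθ1)
  filter_upwards [hatt _ (inter_mem (hV.mem_nhds hθV) (eventually_mass_lt (half_pos hθ1'))) η hη,
    hpa, eventually_gt_atTop 0, eventually_ge_atTop (T₀ / ((1 - θ) / 2))] with t ht hta ht0 htT
  obtain ⟨N, A, hA, hAU, hbd⟩ := ht
  calc _ ≤ Measure.pi (fun _ : Fin N => φ) A := by
        refine le_trans (ENNReal.ofReal_le_ofReal (Real.exp_le_exp.mpr (neg_le_neg ?_))) hbd
        have := ENNReal.toReal_mono hC hcost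
        exact mul_le_mul_of_nonneg_left (by linarith) ht0.le
    _ = _ := (hv.measure_fin_mem hA).symm
    _ ≤ _ := measure_mono fun ω hω => ?_
  obtain ⟨h1, h2⟩ := hAU (fun i => v i ω) hω
  refine hp hta (hVp h1) _ (Y ω) N (hY ω) rfl ?_
  have h3 := mass_cycleFM (fun i => v i ω) ht0 N T₀
  rw [mem_ofPred_eq] at h2
  have h4 := (abs_lt.mp h2).2
  rw [hmass] at h4
  have h5 : T₀ ≤ t * ((1 - θ) / 2) := (div_le_iff₀ (half_pos hθ1')).mp htT
  have h6 : t * ((cycleFM (fun i => v i ω) t N).mass : ℝ) ≤ t * (1 - (1 - θ) / 2) :=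
    mul_le_mul_of_nonneg_left (by linarith) ht0.le
  change renewalTime T₀ (fun i => v i ω) N ≤ t
  linarith

end Lower

theorem neg_le_liminf_logRate {E : Type*} {P : ℝ → Set E → ℝ≥0∞} {A : Set E} {a : ℝ}
    (h : ∀ η > 0, ∀ᶠ t : ℝ in atTop, ENNReal.ofReal (Real.exp (-(t * (a + η)))) ≤ P t A) :
    ((-a : ℝ) : EReal) ≤ liminf (fun t => logRate P t A) atTop := by
  have key : ∀ η > 0, ((-(a + η) : ℝ) : EReal) ≤ liminf (fun t => logRate P t A) atTop := by
    intro η hη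
    refine le_liminf_of_le (by isBoundedDefault) ?_
    filter_upwards [h η hη, eventually_gt_atTop 0] with t ht ht0
    refine le_of_eq_of_le ?_ (le_coe_mul_log (inv_nonneg.mpr ht0.le) ht)
    congr 1
    field_simp
  have hlim : Tendsto (fun η : ℝ => ((-(a + η) : ℝ) : EReal)) (𝓝[>] 0) (𝓝 ((-a : ℝ) : EReal)) := by
    rw [EReal.tendsto_coe]
    have h1 : Tendsto (fun η : ℝ => -(a + η)) (𝓝 0) (𝓝 (-(a + 0))) := (tendsto_id.const_add a).neg
    rw [add_zero] at h1
    exact h1.mono_left nhdsWithin_le_nhds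
  exact le_of_tendsto hlim (by filter_upwards [self_mem_nhdsWithin] with η hη using key η hη)

/-! ### The lower bound for configurations and for the process -/

section LDLower

variable {Ω' : Type*} [MeasurableSpace Ω'] {ℙ : Measure Ω'} [IsProbabilityMeasure ℙ]
  {φ : Measure ℝ≥0} [IsProbabilityMeasure φ] {v : ℕ → Ω' → ℝ≥0} {T₀ : ℝ}
  {Y : Ω' → ℝ → ProbabilityMeasure Phase}

theorem eventually_exp_le_measure_window {a : ℝ} {δ : ℝ} (hδ : 0 < δ)
    (ha : ((xiBar φ : ℝ≥0∞) : EReal) < a) {b : ℝ} (hb : 0 < b) :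
    ∀ᶠ t : ℝ in atTop, ENNReal.ofReal (Real.exp (-(b * t * a))) ≤ φ (window δ (1 / (b * t))) := by
  have h1 : ((-a : ℝ) : EReal) < windowRate φ δ := by
    refine lt_of_lt_of_le ?_ (neg_xiBar_le_windowRate φ hδ)
    rw [EReal.coe_neg]
    exact EReal.neg_lt_neg_iff.mpr ha
  have h2 := eventually_lt_of_lt_liminf h1
  have h3 : Tendsto (fun t : ℝ => 1 / (b * t)) atTop (𝓝[>] 0) := by
    refine tendsto_nhdsWithin_iff.mpr ⟨tendsto_const_nhds.div_atTop
      (tendsto_id.const_mul_atTop hb), ?_⟩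
    filter_upwards [eventually_gt_atTop 0] with t ht
    exact one_div_pos.mpr (mul_pos hb ht)
  filter_upwards [h3.eventually h2, eventually_gt_atTop 0] with t ht ht0
  by_contra hcon
  have h4 := coe_mul_log_le (one_div_pos.mpr (mul_pos hb ht0)).le (not_le.mp hcon).le
  have h5 : 1 / (b * t) * -(b * t * a) = -a := by field_simp
  rw [h5] at h4
  exact absurd ht (not_lt.mpr h4)

/-- For positive remaining mass and `0 < ℓ < 1` the cost is that of the cycles plus that of one
speed in a window of centre `ℓ / (r t)`. The two boundary cases, no remaining mass and `ℓ = 0`, are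
treated apart. -/
theorem IsIID.neg_lowerJ_le (hv : IsIID ℙ φ v) (hφ : φ {0} = 0) (hT₀ : 0 ≤ T₀)
    (hY : ∀ ω, Tracks T₀ (fun i => v i ω) (Y ω)) {x : Config} (h1 : (x.2 : ℝ) < 1)
    {O : Set (ProbabilityMeasure Phase)} (hO : IsOpen O) (hx : mixtureProb x ∈ O) :
    -(lowerJ φ x : EReal) ≤ liminf (fun t => logRate (law ℙ Y) t O) atTop := by
  by_cases htop : lowerJ φ x = ∞
  · simp [htop]
  have hx1 : x.2 < 1 := h1
  have hC : dualCost φ (x.1.1 : Measure ℝ≥0) ≠ ∞ := fun h => htop (by rw [lowerJ, h, top_add])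
  have hneg : ∀ a : ℝ, 0 ≤ a → a ≤ (lowerJ φ x).toReal →
      ((-a : ℝ) : EReal) ≤ liminf (fun t => logRate (law ℙ Y) t O) atTop →
      -(lowerJ φ x : EReal) ≤ liminf (fun t => logRate (law ℙ Y) t O) atTop := by
    intro a ha0 ha h
    refine le_trans ?_ h
    rw [EReal.coe_neg, EReal.neg_le_neg_iff, ← EReal.coe_ennreal_toReal htop]
    exact_mod_cast ha
  rcases eq_or_ne (restMass x.1) 0 with hr | hr
  · have hJ : lowerJ φ x = dualCost φ (x.1.1 : Measure ℝ≥0) := by simp [lowerJ, hr]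
    exact hneg _ ENNReal.toReal_nonneg (by rw [hJ]) (neg_le_liminf_logRate fun η hη =>
      hv.exp_le_law_of_restMass_eq_zero hφ hY hr hC hO hx hη)
  have hr0 : 0 < restMass x.1 := pos_iff_ne_zero.mpr hr
  have hr0' : (0 : ℝ) < restMass x.1 := by exact_mod_cast hr0
  have hxiBar : xiBar φ ≠ ∞ := by
    intro h
    refine htop ?_
    rw [lowerJ, if_pos hx1, h, ENNReal.mul_top, add_top]
    exact mul_ne_zero (by simpa using hr) (ENNReal.inv_ne_zero.mpr ENNReal.ofReal_ne_top)
  -- the bound for a configuration with positive position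
  have key : ∀ y : Config, y.1 = x.1 → (0 : ℝ) < y.2 → (y.2 : ℝ) < 1 → mixtureProb y ∈ O →
      ((-((dualCost φ (x.1.1 : Measure ℝ≥0)).toReal + restMass x.1 / y.2 * (xiBar φ).toReal) : ℝ) :
        EReal) ≤ liminf (fun t => logRate (law ℙ Y) t O) atTop := by
    intro y hy hy0 hy1 hyO
    obtain ⟨δ, hδ, hδ'⟩ := hv.exists_window_le_law hT₀ hY (x := y) (by rwa [hy]) hy0 hy1
      (by rw [hy]; exact attainable_dualCost hφ _ hC) hO hyO
    rw [hy] at hδ'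
    set b : ℝ := restMass x.1 / y.2 with hb
    have hb0 : 0 < b := div_pos hr0' hy0
    refine neg_le_liminf_logRate fun η hη => ?_
    have ha : ((xiBar φ : ℝ≥0∞) : EReal) < (((xiBar φ).toReal + η / (2 * b) : ℝ) : EReal) := by
      rw [← EReal.coe_ennreal_toReal hxiBar, EReal.coe_lt_coe_iff]
      linarith [div_pos hη (mul_pos two_pos hb0)]
    filter_upwards [hδ' (η / 2) (half_pos hη), eventually_exp_le_measure_window hδ.1 ha hb0,
      eventually_gt_atTop 0] with t ht1 ht2 ht0
    -- The window at scale `1/(b t)` has probability at least `e^{-b t (ξ̄ + η/(2b))}`; together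
    -- with the cycles the total loss is `η t`.
    have hw : 1 / (b * t) = y.2 / (restMass x.1 * t) := by
      rw [hb]; field_simp
    rw [hw] at ht2
    refine le_trans (le_of_eq_of_le ?_ (mul_le_mul_right ht2 (ENNReal.ofReal (Real.exp
      (-(t * ((dualCost φ (x.1.1 : Measure ℝ≥0)).toReal + η / 2))))))) ht1
    · rw [← ENNReal.ofReal_mul (Real.exp_pos _).le, ← Real.exp_add]
      congr 2
      field_simp
      ring
  -- For `ℓ = 0` and positive remaining mass, finiteness of the cost forces `ξ̄ = 0`; a small
  -- positive `ℓ` is then free of charge and still leads into `O`.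
  rcases eq_or_lt_of_le x.2.2.1 with h0 | h0
  · have hzero : xiBar φ = 0 := by
      by_contra hne
      refine htop ?_
      rw [lowerJ, if_pos hx1, ← h0, ENNReal.ofReal_zero, ENNReal.inv_zero,
        ENNReal.mul_top (by simpa using hr), ENNReal.top_mul hne, add_top]
    have hcont : Continuous fun ℓ : unitInterval => mixtureProb (x.1, ℓ) :=
      continuous_mixtureProb.comp (Continuous.prodMk_right x.1)
    have hev : ∀ᶠ ℓ : unitInterval in 𝓝 0, mixtureProb (x.1, ℓ) ∈ O := by
      refine hcont.continuousAt.eventually_mem (hO.mem_nhds ?_)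
      have : (x.1, (0 : unitInterval)) = x := Prod.ext rfl (Subtype.ext h0)
      rwa [this]
    obtain ⟨ε, hε, hball⟩ := Metric.eventually_nhds_iff.mp hev
    have hm : (0 : ℝ) < min (ε / 2) (1 / 2) := lt_min (half_pos hε) one_half_pos
    have hm1 : min (ε / 2) (1 / 2) ≤ (1 / 2 : ℝ) := min_le_right _ _
    have h := key (x.1, ⟨min (ε / 2) (1 / 2), hm.le, by linarith⟩) rfl hm
      (lt_of_le_of_lt hm1 (by norm_num)) (hball (by
        rw [Subtype.dist_eq, Real.dist_eq]
        change |min (ε / 2) (1 / 2) - 0| < ε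
        rw [sub_zero, abs_of_pos hm]
        exact (min_le_left _ _).trans_lt (half_lt_self hε)))
    rw [hzero, ENNReal.toReal_zero, mul_zero, add_zero] at h
    refine hneg _ ENNReal.toReal_nonneg (ENNReal.toReal_mono htop ?_) h
    rw [lowerJ]
    exact le_self_add
  · refine hneg _ (by positivity) (le_of_eq ?_) (key x rfl h0 h1 hx)
    rw [lowerJ, if_pos hx1, ENNReal.toReal_add hC, ENNReal.toReal_mul, ENNReal.toReal_mul,
      ENNReal.toReal_inv, ENNReal.toReal_ofReal h0.le, ENNReal.coe_toReal, div_eq_mul_inv]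
    refine ENNReal.mul_ne_top (ENNReal.mul_ne_top ENNReal.coe_ne_top ?_) hxiBar
    rw [ENNReal.inv_ne_top]
    exact (ENNReal.ofReal_pos.mpr h0).ne'

theorem IsIID.ldLowerBound (hv : IsIID ℙ φ v) (hφ : φ {0} = 0) (hT₀ : 0 ≤ T₀)
    (hY : ∀ ω, Tracks T₀ (fun i => v i ω) (Y ω)) : LDLowerBound (law ℙ Y) (rateIBar φ) := by
  refine ⟨lowerSemicontinuous_rateIBar hφ (xi_le_xiBar φ), fun O hO => ?_⟩
  by_contra! hcon
  have h1 := EReal.lt_neg_comm.mp hcon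
  have h2 : ∃ μ ∈ O, ∃ r : OmegaData, r.toMeasure = (μ : Measure Phase) ∧
      ((r.lowerCost φ : ℝ≥0∞) : EReal) < -liminf (fun t => logRate (law ℙ Y) t O) atTop := by
    by_contra! hcon2
    refine absurd h1 (not_lt.mpr ?_)
    obtain ⟨s, hs⟩ : ∃ s : ℝ≥0∞, (s : EReal) =
        max 0 (-liminf (fun t => logRate (law ℙ Y) t O) atTop) :=
      ⟨_, EReal.coe_toENNReal (le_max_left _ _)⟩
    refine (le_max_right 0 _).trans ?_
    rw [← hs, EReal.coe_ennreal_le_coe_ennreal_iff]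
    refine le_iInf₂ fun μ hμ => le_iInf₂ fun r hr => ?_
    rw [← EReal.coe_ennreal_le_coe_ennreal_iff, hs]
    exact max_le (EReal.coe_ennreal_nonneg _) (hcon2 μ hμ r hr)
  obtain ⟨μ, hμ, r, hr, hlt⟩ := h2
  rw [← r.lowerJ_config hφ] at hlt
  have hmem : mixtureProb r.config ∈ O := by
    rw [mixtureProb_eq_iff.mpr (r.mixture_config.trans hr)]
    exact hμ
  have h3 := hv.neg_lowerJ_le hφ hT₀ hY (x := r.config) r.ℓ_lt hO hmem
  exact absurd (EReal.lt_neg_comm.mp hlt) (not_lt.mpr h3)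

end LDLower

/-! ### The typical configuration -/

/-- The law of the speed under the typical empirical measure. -/
def typicalSpeed (φ : Measure ℝ≥0) : Measure ℝ≥0 :=
  if meanReturn φ < ∞ then (meanReturn φ)⁻¹ • φ.withDensity (fun p => (p : ℝ≥0∞)⁻¹)
  else Measure.dirac 0

theorem meanReturn_ne_zero (φ : Measure ℝ≥0) [IsProbabilityMeasure φ] : meanReturn φ ≠ 0 := by
  intro h
  rw [meanReturn, lintegral_eq_zero_iff (by fun_prop)] at h
  obtain ⟨p, hp⟩ := h.exists
  simp at hp

instance (φ : Measure ℝ≥0) [IsProbabilityMeasure φ] : IsProbabilityMeasure (typicalSpeed φ) := by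
  unfold typicalSpeed
  split_ifs with h
  · constructor
    rw [Measure.smul_apply, withDensity_apply _ MeasurableSet.univ, Measure.restrict_univ,
      smul_eq_mul]
    exact ENNReal.inv_mul_cancel (meanReturn_ne_zero φ) h.ne
  · infer_instance

theorem meanReturn_lt_top_of_exp {φ : Measure ℝ≥0} [IsProbabilityMeasure φ] (hφ : φ {0} = 0)
    {c : ℝ} (hc : 0 < c) (h : ∫⁻ p : ℝ≥0, ENNReal.ofReal (Real.exp (c / p)) ∂φ < ∞) :
    meanReturn φ < ∞ := by
  have hae : ∀ᵐ p ∂φ, p ∉ ({0} : Set ℝ≥0) := measure_eq_zero_iff_ae_notMem.mp hφ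
  have hle : meanReturn φ ≤ ∫⁻ p : ℝ≥0,
      ENNReal.ofReal c⁻¹ * ENNReal.ofReal (Real.exp (c / p)) ∂φ := by
    refine lintegral_mono_ae ?_
    filter_upwards [hae] with p hp
    have hp' : p ≠ 0 := hp
    rw [← ENNReal.ofReal_mul (inv_nonneg.mpr hc.le), ← ENNReal.coe_inv hp',
      ← ENNReal.ofReal_coe_nnreal]
    refine ENNReal.ofReal_le_ofReal ?_
    rw [NNReal.coe_inv]
    calc (p : ℝ)⁻¹ = c⁻¹ * (c / p) := by field_simp
      _ ≤ _ := mul_le_mul_of_nonneg_left (by linarith [Real.add_one_le_exp (c / p)])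
        (inv_nonneg.mpr hc.le)
  refine hle.trans_lt ?_
  rw [lintegral_const_mul _ (by fun_prop)]
  exact ENNReal.mul_lt_top ENNReal.ofReal_lt_top h

theorem xi_eq_zero_of_meanReturn {φ : Measure ℝ≥0} [IsProbabilityMeasure φ] (hφ : φ {0} = 0)
    (h : ¬ meanReturn φ < ∞) : xi φ = 0 := by
  refine le_antisymm (iSup₂_le fun c hc => ?_) zero_le
  rcases le_or_gt c 0 with h0 | h0
  · rw [ENNReal.ofReal_of_nonpos h0]
  · exact absurd (meanReturn_lt_top_of_exp hφ h0 hc) h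

/-- Integrate `k/p ≤ e^{k/p} - 1` under `φ`. If the mean return time is infinite, the typical speed
is `0`, no positive exponential moment is finite, and `k 0 ≤ ξ = 0`. Hence the typical measure costs
nothing. -/
theorem Admissible.integral_typicalSpeed_nonpos {φ : Measure ℝ≥0} [IsProbabilityMeasure φ]
    (hφ : φ {0} = 0) {k : ℝ≥0 →ᵇ ℝ} (hk : Admissible φ k) : ∫ p, k p ∂(typicalSpeed φ) ≤ 0 := by
  by_cases h : meanReturn φ < ∞
  · have hae : ∀ᵐ p ∂φ, p ∉ ({0} : Set ℝ≥0) := measure_eq_zero_iff_ae_notMem.mp hφ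
    have hfin : ∀ᵐ p : ℝ≥0 ∂φ, (p : ℝ≥0∞)⁻¹ < ∞ := by
      filter_upwards [hae] with p hp
      rw [ENNReal.inv_lt_top]
      exact_mod_cast pos_iff_ne_zero.mpr hp
    rw [typicalSpeed, if_pos h, integral_smul_measure,
      integral_withDensity_eq_integral_toReal_smul (by fun_prop) hfin]
    refine mul_nonpos_of_nonneg_of_nonpos ENNReal.toReal_nonneg ?_
    have hexp : Integrable (fun p : ℝ≥0 => Real.exp (k p / p)) φ := by
      have hm := measurable_div_speed k
      refine (lintegral_ofReal_ne_top_iff_integrable 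
        (Real.measurable_exp.comp hm).aestronglyMeasurable
        (ae_of_all _ fun p => (Real.exp_pos _).le)).mp ?_
      exact (hk.trans_lt ENNReal.one_lt_top).ne
    have hone : ∫ p : ℝ≥0, Real.exp (k p / p) ∂φ ≤ 1 := by
      rw [integral_eq_lintegral_of_nonneg_ae (ae_of_all _ fun p => (Real.exp_pos _).le)
        hexp.aestronglyMeasurable]
      exact ENNReal.toReal_le_of_le_ofReal zero_le_one (by rw [ENNReal.ofReal_one]; exact hk)
    by_cases hint : Integrable (fun p : ℝ≥0 => ((p : ℝ≥0∞)⁻¹).toReal • k p) φ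
    · refine (integral_mono hint (hexp.sub (integrable_const 1)) fun p => ?_).trans ?_
      · have := Real.add_one_le_exp (k p / p)
        simp only [ENNReal.toReal_inv, ENNReal.coe_toReal, smul_eq_mul, Pi.sub_apply]
        rw [div_eq_inv_mul] at this ⊢
        linarith
      · have h1 := integral_sub hexp (integrable_const (1 : ℝ))
        simp only [integral_const, probReal_univ, smul_eq_mul, mul_one] at h1
        exact h1.trans_le (by linarith)
    -- The integral of a nonintegrable function is `0` by convention.
    · rw [integral_undef hint]
  · rw [typicalSpeed, if_neg h, integral_dirac]
    have := hk.zero_le_xi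
    rw [xi_eq_zero_of_meanReturn hφ h] at this
    exact ENNReal.ofReal_eq_zero.mp (le_antisymm this zero_le)

theorem dualCost_typicalSpeed {φ : Measure ℝ≥0} [IsProbabilityMeasure φ] (hφ : φ {0} = 0) :
    dualCost φ (typicalSpeed φ) = 0 :=
  le_antisymm (iSup₂_le fun _ hk =>
    (ENNReal.ofReal_of_nonpos (hk.integral_typicalSpeed_nonpos hφ)).le) zero_le

/-- The centre of the balls which show the optimality of the bounds. -/
theorem exists_config_typical {φ : Measure ℝ≥0} [IsProbabilityMeasure φ] (hφ : φ {0} = 0)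
    {α ℓ : ℝ} (hα : α ∈ Ioo (0 : ℝ) 1) (hℓ : ℓ ∈ Ioo (0 : ℝ) 1) :
    ∃ x : Config, (x.2 : ℝ) = ℓ ∧ (restMass x.1 : ℝ) = 1 - α ∧
      dualCost φ (x.1.1 : Measure ℝ≥0) = 0 ∧
      mixture x = ENNReal.ofReal α • typical φ +
        ENNReal.ofReal (1 - α) • (lam ℓ).prod (Measure.dirac 0) := by
  let γ : FiniteMeasure ℝ≥0 := ⟨typicalSpeed φ, inferInstance⟩
  have hγ : ((α.toNNReal • γ : FiniteMeasure ℝ≥0) : Measure ℝ≥0) = α.toNNReal • typicalSpeed φ := by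
    rw [FiniteMeasure.toMeasure_smul]
    rfl
  have hsum : ((α.toNNReal • γ : FiniteMeasure ℝ≥0) : Measure ℝ≥0) univ + (1 - α).toNNReal = 1 := by
    rw [hγ, nnreal_smul_apply, measure_univ, mul_one, ← ENNReal.coe_add,
      ← Real.toNNReal_add hα.1.le (by linarith [hα.2])]
    simp
  have hmass : (α.toNNReal • γ).mass ≤ 1 := by
    refine ENNReal.coe_le_coe.mp ?_
    rw [FiniteMeasure.ennreal_mass]
    exact le_self_add.trans hsum.le
  have hrest : restMass ⟨α.toNNReal • γ, hmass⟩ = (1 - α).toNNReal := restMass_eq_of_add_eq hsum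
  refine ⟨(⟨α.toNNReal • γ, hmass⟩, ⟨ℓ, hℓ.1.le, hℓ.2.le⟩), rfl, ?_, ?_, ?_⟩
  · rw [hrest, Real.coe_toNNReal _ (by linarith [hα.2])]
  · refine le_antisymm ?_ zero_le
    refine (le_of_eq (congrArg _ hγ)).trans ((dualCost_smul_le _ _ _).trans ?_)
    rw [dualCost_typicalSpeed hφ, mul_zero]
  · rw [mixture, hrest]
    refine congrArg₂ (· + ·) ?_ rfl
    refine (congrArg _ hγ).trans ?_
    rw [prod_nnreal_smul_right]
    rfl

/-! ### The position of the last particle -/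

/-- The function `(q, p) ↦ q ^ k`. -/
def positionPow (k : ℕ) : Phase →ᵇ ℝ :=
  BoundedContinuousFunction.ofNormedAddCommGroup (fun y => (y.1 : ℝ) ^ k)
    ((continuous_subtype_val.comp continuous_fst).pow k) 1 fun y => by
      rw [Real.norm_eq_abs, abs_of_nonneg (pow_nonneg y.1.2.1 k)]
      exact pow_le_one₀ y.1.2.1 y.1.2.2.le

theorem norm_positionPow_le (k : ℕ) : ‖positionPow k‖ ≤ 1 :=
  BoundedContinuousFunction.norm_ofNormedAddCommGroup_le _ zero_le_one _

/-- Multiplied by `k + 1`, the mean of `q^k` is `1` over a completed cycle and `ℓ^k` over one that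
stops at `ℓ`. Moments of the position therefore see only the mass and the end of the last cycle. -/
theorem sweep_positionPow (k : ℕ) (ℓ : unitInterval) (p : ℝ≥0) :
    (k + 1) * sweep (positionPow k) ℓ p = (ℓ : ℝ) ^ k := by
  have h : sweep (positionPow k) ℓ p = ∫ u in (0 : ℝ)..1, ((ℓ : ℝ) * u) ^ k := by
    rw [intervalIntegral.integral_of_le zero_le_one, ← integral_Ico_eq_integral_Ioc,
      ← integral_subtype_comap measurableSet_Ico (fun u => ((ℓ : ℝ) * u) ^ k)]
    rfl
  rw [h]
  simp_rw [mul_pow]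
  rw [intervalIntegral.integral_const_mul, integral_pow]
  field_simp
  simp

theorem integral_positionPow_mixture (k : ℕ) (x : Config) :
    (k + 1) * ∫ y, positionPow k y ∂(mixture x) = 1 - restMass x.1 * (1 - (x.2 : ℝ) ^ k) := by
  have hk : (k : ℝ) + 1 ≠ 0 := by positivity
  have h1 : ∀ p, fullSweep (positionPow k) p = ((k : ℝ) + 1)⁻¹ := fun p => by
    have := sweep_positionPow k 1 p
    rw [fullSweep_apply]
    refine eq_inv_of_mul_eq_one_right (this.trans ?_)
    simp
  rw [integral_mixture]
  simp_rw [h1]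
  rw [integral_const, mul_add, mul_left_comm _ (restMass x.1 : ℝ), sweep_positionPow, coe_restMass,
    measureReal_def, smul_eq_mul]
  have h2 : ((x.1.1 : Measure ℝ≥0) univ).toReal = x.1.1.mass := rfl
  rw [h2]
  field_simp
  ring

theorem abs_integral_positionPow_sub_le {T₀ : ℝ} {w : ℕ → ℝ≥0}
    {Z : ℝ → ProbabilityMeasure Phase} (hZ : Tracks T₀ w Z) (hT₀ : 0 ≤ T₀) {t : ℝ} (ht : 0 < t)
    {n : ℕ} (h1 : renewalTime T₀ w n ≤ t) (h2 : t < renewalTime T₀ w (n + 1)) (k : ℕ) :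
    |(k + 1) * ∫ y, positionPow k y ∂(Z t : Measure Phase) -
      (1 - t⁻¹ * (t - renewalTime T₀ w n) * (1 - ((t - renewalTime T₀ w n) * w n) ^ k))| ≤
      t⁻¹ * ((k + 2) * T₀) := by
  have hp := position_mem h1 (renewalTime_succ T₀ w n ▸ h2)
  have h := hZ.bound_all t ht n h1 h2 (positionPow k) ⟨_, hp.1, hp.2.le⟩ rfl
  have h3 : ∀ p, ((k : ℝ) + 1) * fullSweep (positionPow k) p = 1 := fun p => by
    rw [fullSweep_apply, sweep_positionPow]
    simp
  have h4 : ((k : ℝ) + 1) * ∑ i ∈ Finset.range n, (w i : ℝ)⁻¹ * fullSweep (positionPow k) (w i) =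
      renewalTime T₀ w n - T₀ := by
    rw [← sum_inv_eq_renewalTime_sub, Finset.mul_sum]
    exact Finset.sum_congr rfl fun i _ => by rw [mul_left_comm, h3, mul_one]
  have h5 := sweep_positionPow k ⟨(t - renewalTime T₀ w n) * w n, hp.1, hp.2.le⟩ (w n)
  set s := sweep (positionPow k) ⟨(t - renewalTime T₀ w n) * w n, hp.1, hp.2.le⟩ (w n)
  set A := ∑ i ∈ Finset.range n, (w i : ℝ)⁻¹ * fullSweep (positionPow k) (w i)
  set J := ∫ y, positionPow k y ∂(Z t : Measure Phase)
  have h6 : |t * J - A - (t - renewalTime T₀ w n) * s| ≤ T₀ :=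
    h.trans (mul_le_of_le_one_left hT₀ (norm_positionPow_le k))
  change (↑k + 1) * s = ((t - renewalTime T₀ w n) * w n) ^ k at h5
  rw [← h5]
  -- The error has two sources: the path before `T₀`, with factor `k + 1`, and the gap `T₀` between
  -- `T_n` and the total duration of the cycles.
  have h7 : (k + 1) * J - (1 - t⁻¹ * (t - renewalTime T₀ w n) * (1 - (k + 1) * s)) =
      t⁻¹ * ((k + 1) * (t * J - A - (t - renewalTime T₀ w n) * s) - T₀) := by
    linear_combination t⁻¹ * h4 + (1 - (k + 1) * J) * inv_mul_cancel₀ ht.ne'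
  rw [h7, abs_mul, abs_of_pos (inv_pos.mpr ht)]
  refine mul_le_mul_of_nonneg_left ?_ (inv_pos.mpr ht).le
  refine (abs_sub _ _).trans ?_
  rw [abs_mul, abs_of_nonneg hT₀, abs_of_nonneg (by positivity : (0 : ℝ) ≤ k + 1)]
  have := mul_le_mul_of_nonneg_left h6 (by positivity : (0 : ℝ) ≤ k + 1)
  linarith

/-- If the empirical measure is close to a mixture, the last speed is close to the speed which
it determines. -/
theorem eventually_mem_window {T₀ : ℝ} (hT₀ : 0 ≤ T₀) {x : Config} (hr : 0 < restMass x.1)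
    (h0 : (0 : ℝ) < x.2) (h1 : (x.2 : ℝ) < 1) {δ : ℝ} (hδ : 0 < δ) :
    ∀ᶠ z : ℝ × ProbabilityMeasure Phase in atTop ×ˢ 𝓝 (mixtureProb x), ∀ w Z n, Tracks T₀ w Z →
      renewalTime T₀ w n ≤ z.1 → z.1 < renewalTime T₀ w (n + 1) → Z z.1 = z.2 →
        w n ∈ window δ (x.2 / (restMass x.1 * z.1)) := by
  by_contra hcon
  rw [not_eventually] at hcon
  set S : Set (ℝ × ProbabilityMeasure Phase) := {z | ¬ ∀ w Z n, Tracks T₀ w Z →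
      renewalTime T₀ w n ≤ z.1 → z.1 < renewalTime T₀ w (n + 1) → Z z.1 = z.2 →
        w n ∈ window δ (x.2 / (restMass x.1 * z.1))} with hS
  set F : Filter (ℝ × ProbabilityMeasure Phase) := (atTop ×ˢ 𝓝 (mixtureProb x)) ⊓ 𝓟 S with hF
  have hne : F.NeBot := frequently_mem_iff_neBot.mp hcon
  have hex : ∀ z ∈ S, ∃ w Z n, Tracks T₀ w Z ∧ renewalTime T₀ w n ≤ z.1 ∧
      z.1 < renewalTime T₀ w (n + 1) ∧ Z z.1 = z.2 ∧
        w n ∉ window δ (x.2 / (restMass x.1 * z.1)) := by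
    intro z hz
    simp only [hS, mem_ofPred_eq] at hz
    push Not at hz
    exact hz
  have : Nonempty (ProbabilityMeasure Phase) := ⟨mixtureProb x⟩
  choose! w Z n hZ hle hlt hZz hwin using hex
  have hSF : ∀ᶠ z in F, z ∈ S := mem_inf_of_right (mem_principal_self S)
  have hFle : F ≤ atTop ×ˢ 𝓝 (mixtureProb x) := inf_le_left
  have ht : Tendsto (fun z : ℝ × ProbabilityMeasure Phase => z.1) F atTop :=
    tendsto_fst.mono_left hFle
  have hμ : Tendsto (fun z : ℝ × ProbabilityMeasure Phase => z.2) F (𝓝 (mixtureProb x)) :=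
    tendsto_snd.mono_left hFle
  have htpos : ∀ᶠ z in F, (0 : ℝ) < z.1 := ht.eventually_gt_atTop 0
  have hinv : Tendsto (fun z : ℝ × ProbabilityMeasure Phase => z.1⁻¹) F (𝓝 0) :=
    tendsto_inv_atTop_zero.comp ht
  have hr' : (0 : ℝ) < restMass x.1 := by exact_mod_cast hr
  -- fraction of time in the last cycle, and position at its end
  set β : ℝ × ProbabilityMeasure Phase → ℝ :=
    fun z => z.1⁻¹ * (z.1 - renewalTime T₀ (w z) (n z)) with hβ
  set q : ℝ × ProbabilityMeasure Phase → ℝ :=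
    fun z => (z.1 - renewalTime T₀ (w z) (n z)) * w z (n z) with hq
  -- The cases `k = 1` and `k = 2` are two equations that determine the limits of `β` and `q`.
  have hmom : ∀ k : ℕ, Tendsto (fun z => β z * (1 - q z ^ k)) F
      (𝓝 (restMass x.1 * (1 - (x.2 : ℝ) ^ k))) := by
    intro k
    have h2 : Tendsto (fun z : ℝ × ProbabilityMeasure Phase =>
        (k + 1) * ∫ y, positionPow k y ∂(z.2 : Measure Phase)) F
        (𝓝 (1 - restMass x.1 * (1 - (x.2 : ℝ) ^ k))) := by
      rw [← integral_positionPow_mixture]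
      exact ((ProbabilityMeasure.tendsto_iff_forall_integral_tendsto.mp hμ)
        (positionPow k)).const_mul _
    have h3 : Tendsto (fun z : ℝ × ProbabilityMeasure Phase =>
        (k + 1) * ∫ y, positionPow k y ∂(z.2 : Measure Phase) - (1 - β z * (1 - q z ^ k))) F
        (𝓝 0) := by
      refine squeeze_zero_norm' (a := fun z => z.1⁻¹ * ((k + 2) * T₀)) ?_
        (by simpa using hinv.mul_const ((k + 2) * T₀))
      filter_upwards [hSF, htpos] with z hz hz0
      have h4 := abs_integral_positionPow_sub_le (hZ z hz) hT₀ hz0 (hle z hz) (hlt z hz) k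
      rw [hZz z hz] at h4
      exact h4
    have h5 := (h3.sub h2).const_add 1
    rw [show 1 + (0 - (1 - restMass x.1 * (1 - (x.2 : ℝ) ^ k))) =
      restMass x.1 * (1 - (x.2 : ℝ) ^ k) by ring] at h5
    refine h5.congr fun z => ?_
    ring
  have hA : (restMass x.1 : ℝ) * (1 - x.2) ≠ 0 := (mul_pos hr' (by linarith)).ne'
  have hm1 := hmom 1
  simp only [pow_one] at hm1
  have hne1 : ∀ᶠ z in F, β z * (1 - q z) ≠ 0 := hm1.eventually_ne hA
  -- The quotient of the two moments is `(1 - q²)/(1 - q) = 1 + q`.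
  have hqlim : Tendsto q F (𝓝 (x.2 : ℝ)) := by
    have h2 := ((hmom 2).div hm1 hA).sub_const 1
    rw [show (restMass x.1 * (1 - (x.2 : ℝ) ^ 2)) / (restMass x.1 * (1 - (x.2 : ℝ))) - 1 = x.2 by
      have : 1 - (x.2 : ℝ) ≠ 0 := by linarith
      field_simp
      ring] at h2
    refine h2.congr' ?_
    filter_upwards [hne1] with z hz
    have h3 := left_ne_zero_of_mul hz
    have h4 := right_ne_zero_of_mul hz
    simp only [Pi.div_apply]
    field_simp
    ring
  have hβlim : Tendsto β F (𝓝 (restMass x.1 : ℝ)) := by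
    have h2 := hm1.div (hqlim.const_sub 1) (by linarith : 1 - (x.2 : ℝ) ≠ 0)
    rw [mul_div_cancel_right₀ _ (by linarith : 1 - (x.2 : ℝ) ≠ 0)] at h2
    refine h2.congr' ?_
    filter_upwards [hne1] with z hz
    exact mul_div_cancel_right₀ _ (right_ne_zero_of_mul hz)
  -- Time times speed is `q / β`, the position divided by the fraction of time spent in the last
  -- cycle.
  have hw : Tendsto (fun z => z.1 * w z (n z)) F (𝓝 ((x.2 : ℝ) / restMass x.1)) := by
    refine (hqlim.div hβlim hr'.ne').congr' ?_
    filter_upwards [hne1, htpos] with z hz hz0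
    have h3 := left_ne_zero_of_mul hz
    have h4 : z.1 - renewalTime T₀ (w z) (n z) ≠ 0 := right_ne_zero_of_mul h3
    simp only [Pi.div_apply, hq, hβ]
    field_simp
  have hb : (0 : ℝ) < x.2 / restMass x.1 := div_pos h0 hr'
  have hlow := hw.eventually_const_lt (u := (x.2 : ℝ) / restMass x.1 * (1 - δ))
    (mul_lt_of_lt_one_right hb (by linarith))
  have hupp := hw.eventually_lt_const (u := (x.2 : ℝ) / restMass x.1 * (1 + δ))
    (lt_mul_of_one_lt_right hb (by linarith))
  obtain ⟨z, hz, hz0, hz1, hz2⟩ := (hSF.and (htpos.and (hlow.and hupp))).exists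
  refine hwin z hz ⟨?_, ?_⟩
  · rw [← div_div, div_mul_eq_mul_div, div_le_iff₀ hz0, mul_comm (w z (n z) : ℝ)]
    exact hz1.le
  · rw [← div_div, div_mul_eq_mul_div, lt_div_iff₀ hz0, mul_comm (w z (n z) : ℝ)]
    exact hz2

/-! ### Neighbourhoods of a configuration with an incomplete cycle -/

theorem tendsto_div_mul_atTop {a b : ℝ} (ha : 0 < a) (hb : 0 < b) :
    Tendsto (fun t : ℝ => a / (b * t)) atTop (𝓝[>] 0) := by
  refine tendsto_nhdsWithin_iff.mpr ⟨tendsto_const_nhds.div_atTop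
    (tendsto_id.const_mul_atTop hb), ?_⟩
  filter_upwards [eventually_gt_atTop 0] with t ht
  exact div_pos ha (mul_pos hb ht)

theorem tendsto_div_mul_nhdsGT_zero {a b : ℝ} (ha : 0 < a) (hb : 0 < b) :
    Tendsto (fun ε : ℝ => a / (b * ε)) (𝓝[>] 0) atTop := by
  have h := tendsto_inv_nhdsGT_zero (𝕜 := ℝ) |>.const_mul_atTop (div_pos ha hb)
  refine h.congr fun ε => ?_
  rw [← div_div, div_eq_mul_inv (a / b)]

theorem div_mul_div_mul_cancel {a b t : ℝ} (ha : a ≠ 0) (hb : b ≠ 0) :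
    a / (b * (a / (b * t))) = t := by
  rcases eq_or_ne t 0 with rfl | ht
  · simp
  · field_simp

theorem coe_div_lt_of_lt_mul {a b : ℝ} (hb : 0 < b) {X : ℝ≥0∞}
    (h : (a : EReal) < ((ENNReal.ofReal b * X : ℝ≥0∞) : EReal)) : ((a / b : ℝ) : EReal) < X := by
  by_contra hcon
  rw [not_lt] at hcon
  have h0 : 0 ≤ a / b := EReal.coe_nonneg.mp ((EReal.coe_ennreal_nonneg X).trans hcon)
  have hX : X ≤ ENNReal.ofReal (a / b) := by
    rw [← EReal.coe_ennreal_le_coe_ennreal_iff, EReal.coe_ennreal_ofReal, max_eq_left h0]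
    exact hcon
  refine absurd h (not_lt.mpr ?_)
  have h1 : ENNReal.ofReal b * X ≤ ENNReal.ofReal a := by
    calc ENNReal.ofReal b * X ≤ ENNReal.ofReal b * ENNReal.ofReal (a / b) := by gcongr
      _ = ENNReal.ofReal a := by rw [← ENNReal.ofReal_mul hb.le, mul_div_cancel₀ _ hb.ne']
  refine (EReal.coe_ennreal_le_coe_ennreal_iff.mpr h1).trans_eq ?_
  rw [EReal.coe_ennreal_ofReal, max_eq_left]
  have := mul_nonneg h0 hb.le
  rwa [div_mul_cancel₀ _ hb.ne'] at this

theorem exists_lintegral_exp_of_lt_xi {φ : Measure ℝ≥0} [IsProbabilityMeasure φ] {a : ℝ}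
    (h : (a : EReal) < xi φ) :
    ∃ c, 0 ≤ c ∧ a < c ∧ ∫⁻ p : ℝ≥0, ENNReal.ofReal (Real.exp (c / p)) ∂φ < ∞ := by
  rcases lt_or_ge a 0 with h0 | h0
  · exact ⟨0, le_rfl, h0, lintegral_exp_zero_div_lt_top φ⟩
  · have h1 : ENNReal.ofReal a < xi φ := by
      rw [← EReal.coe_ennreal_lt_coe_ennreal_iff, EReal.coe_ennreal_ofReal, max_eq_left h0]
      exact h
    obtain ⟨c, h2⟩ := lt_iSup_iff.mp h1
    obtain ⟨hc, h3⟩ := lt_iSup_iff.mp h2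
    have h4 := (ENNReal.ofReal_lt_ofReal_iff_of_nonneg h0).mp h3
    exact ⟨c, h0.trans h4.le, h4, hc⟩

section

variable {Ω' : Type*} [MeasurableSpace Ω'] {ℙ : Measure Ω'}
  {φ : Measure ℝ≥0} [IsProbabilityMeasure φ] {v : ℕ → Ω' → ℝ≥0} {T₀ : ℝ}
  {Y : Ω' → ℝ → ProbabilityMeasure Phase}

/-- Near the mixture the last speed lies in the window, but its index is random. Weighting each
cycle by `e^{-η τ}` makes the sum over the index converge, at the price of `e^{η t}`. -/
theorem IsIID.exists_law_le_window (hv : IsIID ℙ φ v) (hφ : φ {0} = 0) (hT₀ : 0 ≤ T₀)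
    (hY : ∀ ω, Tracks T₀ (fun i => v i ω) (Y ω)) {x : Config} (hr : 0 < restMass x.1)
    (h0 : (0 : ℝ) < x.2) (h1 : (x.2 : ℝ) < 1) {δ : ℝ} (hδ : 0 < δ) {η : ℝ} (hη : 0 < η) :
    ∃ U ∈ 𝓝 (mixtureProb x), ∃ K : ℝ≥0, ∀ᶠ t : ℝ in atTop, law ℙ Y t U ≤
      K * ENNReal.ofReal (Real.exp (η * t)) * φ (window δ (x.2 / (restMass x.1 * t))) := by
  obtain ⟨pa, hpa, pb, hpb, hp⟩ := eventually_prod_iff.mp (eventually_mem_window hT₀ hr h0 h1 hδ)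
  have hF := lintegral_exp_sub_lt_one hφ (admissible_zero φ) hη
  set A := ∫⁻ p : ℝ≥0, ENNReal.ofReal (Real.exp (((0 : ℝ≥0 →ᵇ ℝ) p - η) / p)) ∂φ with hA
  have hK : (1 - A)⁻¹ ≠ ∞ := by
    rw [ENNReal.inv_ne_top]
    exact (tsub_pos_of_lt hF).ne'
  refine ⟨{μ | pb μ}, hpb, (1 - A)⁻¹.toNNReal, ?_⟩
  rw [ENNReal.coe_toNNReal hK]
  filter_upwards [hpa, eventually_ge_atTop T₀] with t ht htT
  have hW := measurableSet_window δ (x.2 / (restMass x.1 * t))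
  have hbd := hv.measure_exists_sum_le (g := fun p : ℝ≥0 => ((0 : ℝ≥0 →ᵇ ℝ) p - η) / p)
    (G := (window δ (x.2 / (restMass x.1 * t))).indicator 1)
    (((0 : ℝ≥0 →ᵇ ℝ).continuous.measurable.sub_const η).div measurable_coe_nnreal_real)
    (measurable_one.indicator hW) (-(η * t))
  rw [lintegral_indicator_one hW, neg_neg, mul_right_comm] at hbd
  refine le_trans (measure_mono_ae ?_) hbd
  filter_upwards [hv.ae_exists_renewalTime hφ T₀] with ω hω hmem
  obtain ⟨n, hn1, hn2⟩ := hω t htT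
  refine ⟨n, ?_⟩
  have hwin := hp ht (y := Y ω t) hmem (fun i => v i ω) (Y ω) n (hY ω) hn1 hn2 rfl
  rw [indicator_of_mem hwin, Pi.one_apply, mul_one]
  refine ENNReal.ofReal_le_ofReal (Real.exp_le_exp.mpr ?_)
  have h4 : ∑ i ∈ Finset.range n, ((0 : ℝ≥0 →ᵇ ℝ) (v i ω) - η) / (v i ω : ℝ) =
      -(η * (renewalTime T₀ (fun i => v i ω) n - T₀)) := by
    rw [← sum_inv_eq_renewalTime_sub, Finset.mul_sum, ← Finset.sum_neg_distrib]
    refine Finset.sum_congr rfl fun i _ => ?_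
    rw [BoundedContinuousFunction.coe_zero, Pi.zero_apply, div_eq_mul_inv]
    ring
  rw [h4]
  exact neg_le_neg (mul_le_mul_of_nonneg_left (by linarith) hη.le)

/-- At the scale `ε = ℓ / (r t)` attached to the time `t`, the assumed bound says that the window
has probability at most `e^{-a' t}`. The prefactors are absorbed by the margin `a' - a`, half of it
for the factor `e^{η t}` and half for the constant `K`. -/
theorem IsIID.exists_nhds_logRate_le (hv : IsIID ℙ φ v) (hφ : φ {0} = 0) (hT₀ : 0 ≤ T₀)
    (hY : ∀ ω, Tracks T₀ (fun i => v i ω) (Y ω)) {x : Config} (hr : 0 < restMass x.1)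
    (h0 : (0 : ℝ) < x.2) (h1 : (x.2 : ℝ) < 1) {δ : ℝ} (hδ : 0 < δ) {a a' : ℝ} (ha : a < a') :
    ∃ U ∈ 𝓝 (mixtureProb x), ∀ᶠ t : ℝ in atTop,
      ((x.2 / (restMass x.1 * t) : ℝ) : EReal) *
          ENNReal.log (φ (window δ (x.2 / (restMass x.1 * t)))) <
        ((-(a' / (restMass x.1 / x.2)) : ℝ) : EReal) →
      logRate (law ℙ Y) t U ≤ ((-a : ℝ) : EReal) := by
  obtain ⟨U, hU, K, hK⟩ := hv.exists_law_le_window hφ hT₀ hY hr h0 h1 hδ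
    (half_pos (sub_pos.mpr ha))
  refine ⟨U, hU, ?_⟩
  have hr' : (0 : ℝ) < restMass x.1 := by exact_mod_cast hr
  filter_upwards [hK, eventually_gt_atTop 0, eventually_ge_atTop (K / ((a' - a) / 2))]
    with t ht ht0 htK hlt
  have hε : 0 < (x.2 : ℝ) / (restMass x.1 * t) := div_pos h0 (mul_pos hr' ht0)
  have h2 : φ (window δ (x.2 / (restMass x.1 * t))) ≤ ENNReal.ofReal (Real.exp (-(a' * t))) := by
    by_contra hcon
    refine absurd hlt (not_lt.mpr (le_of_eq_of_le ?_ (le_coe_mul_log hε.le (not_le.mp hcon).le)))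
    congr 1
    field_simp
  have h3 : (K : ℝ) ≤ (a' - a) / 2 * t := by
    rwa [div_le_iff₀ (half_pos (sub_pos.mpr ha)), mul_comm] at htK
  have h4 : law ℙ Y t U ≤ ENNReal.ofReal (Real.exp (-(a * t))) := by
    calc law ℙ Y t U ≤ ENNReal.ofReal (Real.exp K) *
          ENNReal.ofReal (Real.exp ((a' - a) / 2 * t)) * ENNReal.ofReal (Real.exp (-(a' * t))) := by
          refine ht.trans ?_
          gcongr
          rw [← ENNReal.ofReal_coe_nnreal]
          exact ENNReal.ofReal_le_ofReal (by linarith [Real.add_one_le_exp (K : ℝ)])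
      _ = ENNReal.ofReal (Real.exp (K + (a' - a) / 2 * t + -(a' * t))) := by
          rw [← ENNReal.ofReal_mul (Real.exp_pos _).le, ← Real.exp_add,
            ← ENNReal.ofReal_mul (Real.exp_pos _).le, ← Real.exp_add]
      _ ≤ _ := ENNReal.ofReal_le_ofReal (Real.exp_le_exp.mpr (by linarith))
  refine (coe_mul_log_le (inv_nonneg.mpr ht0.le) h4).trans_eq ?_
  congr 1
  field_simp

/-- The probability of a neighbourhood is infinitely often as small as `ξ̄` says. -/
theorem IsIID.frequently_logRate_le (hv : IsIID ℙ φ v) (hφ : φ {0} = 0) (hT₀ : 0 ≤ T₀)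
    (hY : ∀ ω, Tracks T₀ (fun i => v i ω) (Y ω)) {x : Config} (hr : 0 < restMass x.1)
    (h0 : (0 : ℝ) < x.2) (h1 : (x.2 : ℝ) < 1) {a : ℝ}
    (ha : (a : EReal) < ((ENNReal.ofReal (restMass x.1 / x.2) * xiBar φ : ℝ≥0∞) : EReal)) :
    ∃ U ∈ 𝓝 (mixtureProb x), ∃ᶠ t : ℝ in atTop, logRate (law ℙ Y) t U ≤ ((-a : ℝ) : EReal) := by
  have hr' : (0 : ℝ) < restMass x.1 := by exact_mod_cast hr
  obtain ⟨a', ha1, ha2⟩ := EReal.lt_iff_exists_real_btwn.mp ha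
  have h2 := coe_div_lt_of_lt_mul (div_pos hr' h0) ha2
  rw [← EReal.neg_lt_neg_iff, ← EReal.coe_neg] at h2
  obtain ⟨δ, hδ1, hδ2⟩ := (((tendsto_windowRate_xiBar φ).eventually_lt_const h2).and
    self_mem_nhdsWithin).exists
  obtain ⟨U, hU, hev⟩ := hv.exists_nhds_logRate_le hφ hT₀ hY hr h0 h1 hδ2
    (EReal.coe_lt_coe_iff.mp ha1)
  refine ⟨U, hU, ?_⟩
  have hfr : ∃ᶠ ε : ℝ in 𝓝[>] 0, (ε : EReal) * ENNReal.log (φ (window δ ε)) <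
      ((-(a' / (restMass x.1 / x.2)) : ℝ) : EReal) := frequently_lt_of_liminf_lt (h := hδ1)
  -- The map `t ↦ ℓ / (r t)` is an involution that exchanges large times and small windows.
  have hfr' : ∃ᶠ t : ℝ in atTop, ((x.2 / (restMass x.1 * t) : ℝ) : EReal) *
        ENNReal.log (φ (window δ (x.2 / (restMass x.1 * t)))) <
      ((-(a' / (restMass x.1 / x.2)) : ℝ) : EReal) := by
    refine (tendsto_div_mul_nhdsGT_zero h0 hr').frequently (hfr.mono fun ε hε => ?_)
    rwa [div_mul_div_mul_cancel h0.ne' hr'.ne']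
  exact (hfr'.and_eventually hev).mono fun t ht => ht.2 ht.1

/-- The probability of a neighbourhood is always at most what `ξ` says. -/
theorem IsIID.eventually_logRate_le (hv : IsIID ℙ φ v) (hφ : φ {0} = 0) (hT₀ : 0 ≤ T₀)
    (hY : ∀ ω, Tracks T₀ (fun i => v i ω) (Y ω)) {x : Config} (hr : 0 < restMass x.1)
    (h0 : (0 : ℝ) < x.2) (h1 : (x.2 : ℝ) < 1) {a : ℝ}
    (ha : (a : EReal) < ((ENNReal.ofReal (restMass x.1 / x.2) * xi φ : ℝ≥0∞) : EReal)) :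
    ∃ U ∈ 𝓝 (mixtureProb x), ∀ᶠ t : ℝ in atTop, logRate (law ℙ Y) t U ≤ ((-a : ℝ) : EReal) := by
  have hr' : (0 : ℝ) < restMass x.1 := by exact_mod_cast hr
  obtain ⟨a', ha1, ha2⟩ := EReal.lt_iff_exists_real_btwn.mp ha
  obtain ⟨c, hc0, hac, hc⟩ := exists_lintegral_exp_of_lt_xi
    (coe_div_lt_of_lt_mul (div_pos hr' h0) ha2)
  have hlim : Tendsto (fun δ : ℝ => c / (1 + δ)) (𝓝[>] 0) (𝓝 c) := by
    have h2 : Tendsto (fun δ : ℝ => c / (1 + δ)) (𝓝 0) (𝓝 (c / (1 + 0))) :=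
      tendsto_const_nhds.div (tendsto_id.const_add (1 : ℝ)) (by norm_num)
    rw [add_zero, div_one] at h2
    exact h2.mono_left nhdsWithin_le_nhds
  -- With `δ` so small that `c/(1+δ)` still exceeds the required exponent, Markov's inequality
  -- controls all sufficiently small windows.
  obtain ⟨δ, hδ1, hδ2⟩ := ((hlim.eventually_const_lt hac).and (Ioo_mem_nhdsGT one_pos)).exists
  obtain ⟨U, hU, hev⟩ := hv.exists_nhds_logRate_le hφ hT₀ hY hr h0 h1 hδ2.1
    (EReal.coe_lt_coe_iff.mp ha1)
  refine ⟨U, hU, ?_⟩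
  have h3 := eventually_lt_of_limsup_lt ((limsup_window_le φ hc0 hδ2.1 hδ2.2 hc).trans_lt
    (EReal.coe_lt_coe_iff.mpr (neg_lt_neg hδ1)))
  filter_upwards [(tendsto_div_mul_atTop h0 hr').eventually h3, hev] with t ht1 ht2
  exact ht2 ht1

end

/-! ### Balls for the Prohorov distance -/

section Ball

variable {φ : Measure ℝ≥0} {α ℓ : ℝ} {x : Config}

theorem sharpBall_eq_preimage (hx : mixture x = ENNReal.ofReal α • typical φ +
    ENNReal.ofReal (1 - α) • (lam ℓ).prod (Measure.dirac 0)) (δ : ℝ) :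
    sharpBall φ α ℓ δ = LevyProkhorov.probabilityMeasureHomeomorph ⁻¹'
      Metric.ball (LevyProkhorov.probabilityMeasureHomeomorph (mixtureProb x)) δ := by
  ext μ
  rw [sharpBall, ← hx]
  rfl

theorem isOpen_sharpBall (hx : mixture x = ENNReal.ofReal α • typical φ +
    ENNReal.ofReal (1 - α) • (lam ℓ).prod (Measure.dirac 0)) (δ : ℝ) :
    IsOpen (sharpBall φ α ℓ δ) := by
  rw [sharpBall_eq_preimage hx]
  exact Metric.isOpen_ball.preimage (Homeomorph.continuous _)

theorem mem_sharpBall (hx : mixture x = ENNReal.ofReal α • typical φ +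
    ENNReal.ofReal (1 - α) • (lam ℓ).prod (Measure.dirac 0)) {δ : ℝ} (hδ : 0 < δ) :
    mixtureProb x ∈ sharpBall φ α ℓ δ := by
  rw [sharpBall_eq_preimage hx]
  exact Metric.mem_ball_self hδ

theorem exists_sharpBall_subset (hx : mixture x = ENNReal.ofReal α • typical φ +
    ENNReal.ofReal (1 - α) • (lam ℓ).prod (Measure.dirac 0))
    {U : Set (ProbabilityMeasure Phase)} (hU : U ∈ 𝓝 (mixtureProb x)) :
    ∃ δ > 0, sharpBall φ α ℓ δ ⊆ U := by
  simp_rw [sharpBall_eq_preimage hx]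
  rw [← LevyProkhorov.probabilityMeasureHomeomorph.symm_apply_apply (mixtureProb x)] at hU
  have h := LevyProkhorov.probabilityMeasureHomeomorph.symm.continuous.continuousAt.preimage_mem_nhds
    hU
  obtain ⟨δ, hδ, hsub⟩ := Metric.mem_nhds_iff.mp h
  refine ⟨δ, hδ, fun μ hμ => ?_⟩
  have := hsub hμ
  rwa [mem_preimage, Homeomorph.symm_apply_apply] at this

theorem sharpBall_mono {δ δ' : ℝ} (h : δ ≤ δ') : sharpBall φ α ℓ δ ⊆ sharpBall φ α ℓ δ' :=
  fun _ hμ => lt_of_lt_of_le hμ h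

end Ball

/-! ### Selection -/

/-- Helly's selection theorem for monotone functions with values in `[-∞, ∞]`. -/
theorem exists_subseq_tendsto_of_monotone (F : ℕ → ℝ → EReal) (hF : ∀ k, Monotone (F k)) :
    ∃ n : ℕ → ℕ, StrictMono n ∧ ∃ L : ℝ → EReal, ∀ s,
      Tendsto (fun k => F (n k) s) atTop (𝓝 (L s)) := by
  -- A cluster point exists in the compact product space of all functions, which is not metrizable;
  -- sequences are extracted only after restriction to a countable set.
  obtain ⟨L, hL⟩ : ∃ L, MapClusterPt L atTop F := exists_clusterPt_of_compactSpace _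
  have hmono : Monotone L := by
    intro a b hab
    have hcl : IsClosed {f : ℝ → EReal | f a ≤ f b} :=
      isClosed_le (continuous_apply a) (continuous_apply b)
    exact hcl.mem_of_mapClusterPt hL (Eventually.of_forall fun k => hF k hab)
  -- The monotone `L` has countably many discontinuities, which are added to the rationals. At any
  -- other point the values are squeezed between those at nearby rationals.
  set D : Set ℝ := range ((↑) : ℚ → ℝ) ∪ {s | ¬ ContinuousAt L s} with hD
  have hcount : D.Countable := (countable_range _).union hmono.countable_not_continuousAt
  have : Countable D := hcount.to_subtype
  have hL' : MapClusterPt (fun d : D => L d) atTop fun k (d : D) => F k d :=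
    MapClusterPt.continuousAt_comp (f := fun (f : ℝ → EReal) (d : D) => f d)
      (Continuous.continuousAt (by fun_prop)) hL
  obtain ⟨n, hn, hlim⟩ := hL'.tendsto_subseq
  have hlim' := tendsto_pi_nhds.mp hlim
  refine ⟨n, hn, L, fun s => ?_⟩
  by_cases hs : s ∈ D
  · exact hlim' ⟨s, hs⟩
  have hcont : ContinuousAt L s := by
    by_contra h
    exact hs (Or.inr h)
  refine tendsto_order.mpr ⟨fun a ha => ?_, fun a ha => ?_⟩
  · obtain ⟨ε, hε, hball⟩ := Metric.eventually_nhds_iff.mp (hcont.eventually_const_lt ha)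
    obtain ⟨q, hq1, hq2⟩ := exists_rat_btwn (sub_lt_self s hε)
    have hq : a < L q := hball (by rw [Real.dist_eq, abs_lt]; constructor <;> linarith)
    filter_upwards [(hlim' ⟨q, Or.inl ⟨q, rfl⟩⟩).eventually_const_lt hq] with k hk
    exact lt_of_lt_of_le hk (hF _ hq2.le)
  · obtain ⟨ε, hε, hball⟩ := Metric.eventually_nhds_iff.mp (hcont.eventually_lt_const ha)
    obtain ⟨q, hq1, hq2⟩ := exists_rat_btwn (lt_add_of_pos_right s hε)
    have hq : L q < a := hball (by rw [Real.dist_eq, abs_lt]; constructor <;> linarith)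
    filter_upwards [(hlim' ⟨q, Or.inl ⟨q, rfl⟩⟩).eventually_lt_const hq] with k hk
    exact lt_of_le_of_lt (hF _ hq1.le) hk

/-! ### Windows with large probability -/

theorem exp_neg_le_inv {y : ℝ} (hy : 0 < y) : Real.exp (-y) ≤ y⁻¹ := by
  rw [Real.exp_neg]
  exact inv_anti₀ hy (by linarith [Real.add_one_le_exp y])

/-- Suppose that all small windows have probability at most `e^{-c/ε}`. With `θ = 1 - δ`, the
windows at scales `ε₀ θ^j` cover `]0, ε₀[`, and `e^{b/p} ≤ e^{b/(θ ε)}` on the window at scale `ε`.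
For `ξ < b < c θ` the sum over `j` of `e^{-(c - b/θ)/(ε₀ θ^j)}` converges, so `φ(e^{b/p}) < ∞`,
against the definition of `ξ`. -/
theorem frequently_exp_lt_measure_window {φ : Measure ℝ≥0} [IsProbabilityMeasure φ] {δ : ℝ}
    (hδ : δ ∈ Ioo (0 : ℝ) 1) {c : ℝ} (hc : xi φ < ENNReal.ofReal (c * (1 - δ))) :
    ∃ᶠ ε : ℝ in 𝓝[>] 0, ENNReal.ofReal (Real.exp (-(c / ε))) < φ (window δ ε) := by
  intro hcon
  simp only [not_lt] at hcon
  obtain ⟨ε₀, hε₀, hsmall⟩ := mem_nhdsGT_iff_exists_Ioc_subset.mp hcon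
  have hε₀' : (0 : ℝ) < ε₀ := hε₀
  set θ := 1 - δ with hθ
  have hθ0 : 0 < θ := by linarith [hδ.2]
  have hθ1 : θ < 1 := by linarith [hδ.1]
  obtain ⟨b, hb1, hb2⟩ := ENNReal.lt_iff_exists_nnreal_btwn.mp hc
  have hbc : (b : ℝ) < c * θ := by
    rw [← ENNReal.ofReal_coe_nnreal] at hb2
    exact (ENNReal.ofReal_lt_ofReal_iff_of_nonneg b.coe_nonneg).mp hb2
  have hd : 0 < c - b / θ := by
    rw [sub_pos, div_lt_iff₀ hθ0]
    exact hbc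
  refine absurd hb1 (not_lt.mpr ?_)
  rw [← ENNReal.ofReal_coe_nnreal]
  refine le_xi ?_
  have hε : ∀ j : ℕ, ε₀ * θ ^ j ∈ Ioc 0 ε₀ := fun j =>
    ⟨by positivity, mul_le_of_le_one_right hε₀'.le (pow_le_one₀ hθ0.le hθ1.le)⟩
  have hpt : ∀ p : ℝ≥0, ENNReal.ofReal (Real.exp (b / p)) ≤
      ENNReal.ofReal (Real.exp (b / ε₀)) + ∑' j : ℕ, (window δ (ε₀ * θ ^ j)).indicator
        (fun _ => ENNReal.ofReal (Real.exp (b / θ / (ε₀ * θ ^ j)))) p := by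
    intro p
    rcases eq_or_ne p 0 with rfl | hp
    · refine le_add_right (ENNReal.ofReal_le_ofReal (Real.exp_le_exp.mpr ?_))
      rw [NNReal.coe_zero, div_zero]
      positivity
    have hp' : (0 : ℝ) < p := by exact_mod_cast pos_iff_ne_zero.mpr hp
    rcases le_or_gt ε₀ p with h | h
    · exact le_add_right (ENNReal.ofReal_le_ofReal (Real.exp_le_exp.mpr
        (div_le_div_of_nonneg_left b.coe_nonneg hε₀' h)))
    · obtain ⟨j, hj1, hj2⟩ := exists_nat_pow_near_of_lt_one (div_pos hp' hε₀')
        ((div_le_one hε₀').mpr h.le) hθ0 hθ1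
      rw [lt_div_iff₀ hε₀'] at hj1
      rw [div_le_iff₀ hε₀'] at hj2
      have hmem : p ∈ window δ (ε₀ * θ ^ j) := by
        constructor
        · rw [← hθ]
          refine le_trans (le_of_eq ?_) hj1.le
          ring
        · refine lt_of_le_of_lt hj2 ?_
          rw [mul_comm (θ ^ j)]
          exact lt_mul_of_one_lt_right (hε j).1 (by linarith [hδ.1])
      refine le_add_left (le_trans ?_ (ENNReal.le_tsum j))
      rw [indicator_of_mem hmem]
      refine ENNReal.ofReal_le_ofReal (Real.exp_le_exp.mpr ?_)
      rw [div_div]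
      refine div_le_div_of_nonneg_left b.coe_nonneg (mul_pos hθ0 (hε j).1) ?_
      refine le_trans (le_of_eq ?_) hj1.le
      ring
  refine lt_of_le_of_lt (lintegral_mono hpt) ?_
  rw [lintegral_add_left measurable_const, lintegral_const, measure_univ, mul_one,
    lintegral_tsum fun j => (measurable_const.indicator (measurableSet_window _ _)).aemeasurable]
  refine ENNReal.add_lt_top.mpr ⟨ENNReal.ofReal_lt_top, ?_⟩
  -- The crude bound `e^{-y} ≤ y⁻¹` already yields a geometric series.
  have hterm : ∀ j : ℕ, ∫⁻ p, (window δ (ε₀ * θ ^ j)).indicator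
      (fun _ => ENNReal.ofReal (Real.exp (b / θ / (ε₀ * θ ^ j)))) p ∂φ ≤
        ENNReal.ofReal (ε₀ / (c - b / θ) * θ ^ j) := by
    intro j
    rw [lintegral_indicator_const (measurableSet_window _ _)]
    calc _ ≤ ENNReal.ofReal (Real.exp (b / θ / (ε₀ * θ ^ j))) *
          ENNReal.ofReal (Real.exp (-(c / (ε₀ * θ ^ j)))) := by
          gcongr
          exact hsmall (hε j)
      _ = ENNReal.ofReal (Real.exp (-((c - b / θ) / (ε₀ * θ ^ j)))) := by
          rw [← ENNReal.ofReal_mul (Real.exp_pos _).le, ← Real.exp_add]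
          congr 2
          ring
      _ ≤ _ := by
          refine ENNReal.ofReal_le_ofReal ((exp_neg_le_inv (div_pos hd (hε j).1)).trans_eq ?_)
          rw [inv_div]
          ring
  refine lt_of_le_of_lt (ENNReal.tsum_le_tsum hterm) ?_
  have hsum : Summable fun j : ℕ => ε₀ / (c - b / θ) * θ ^ j :=
    (summable_geometric_of_lt_one hθ0.le hθ1).mul_left _
  rw [← ENNReal.ofReal_tsum_of_nonneg (fun j => by positivity) hsum]
  exact ENNReal.ofReal_lt_top

theorem window_mono {δ δ' ε : ℝ} (hε : 0 ≤ ε) (h : δ ≤ δ') : window δ ε ⊆ window δ' ε :=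
  fun _ hp => ⟨(mul_le_mul_of_nonneg_left (by linarith) hε).trans hp.1,
    hp.2.trans_le (mul_le_mul_of_nonneg_left (by linarith) hε)⟩

/-- A sequence of windows which shrink to `0` and whose probabilities realize `ξ`. -/
theorem exists_seq_measure_window {φ : Measure ℝ≥0} [IsProbabilityMeasure φ] (h : xi φ ≠ ∞) :
    ∃ ε : ℕ → ℝ, (∀ k, 0 < ε k) ∧ Tendsto ε atTop (𝓝 0) ∧ ∀ δ > 0, ∀ a : ℝ, (xi φ).toReal < a →
      ∀ᶠ k in atTop, ENNReal.ofReal (Real.exp (-(a / ε k))) ≤ φ (window δ (ε k)) := by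
  -- Diagonal choice: the relative width `1/(k+2)`, below `1` already for `k = 0`, and the slack
  -- `1/(k+1)` in the exponent both vanish. One sequence of scales thus serves every `δ`, since
  -- windows grow with `δ`.
  have hδ : ∀ k : ℕ, 1 / ((k : ℝ) + 2) ∈ Ioo (0 : ℝ) 1 := fun k =>
    ⟨by positivity, by rw [div_lt_one (by positivity)]; linarith [k.cast_nonneg (α := ℝ)]⟩
  have hex : ∀ k : ℕ, ∃ ε : ℝ, (0 < ε ∧ ε < 1 / ((k : ℝ) + 1)) ∧
      ENNReal.ofReal (Real.exp (-(((xi φ).toReal + 1 / ((k : ℝ) + 1)) / (1 - 1 / ((k : ℝ) + 2)) / ε)))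
        < φ (window (1 / ((k : ℝ) + 2)) ε) := by
    intro k
    have h1 := frequently_exp_lt_measure_window (φ := φ) (hδ k)
      (c := ((xi φ).toReal + 1 / ((k : ℝ) + 1)) / (1 - 1 / ((k : ℝ) + 2))) (by
        rw [div_mul_cancel₀ _ (by linarith [(hδ k).2])]
        nth_rewrite 1 [← ENNReal.ofReal_toReal h]
        rw [ENNReal.ofReal_lt_ofReal_iff_of_nonneg ENNReal.toReal_nonneg]
        exact lt_add_of_pos_right _ (by positivity))
    obtain ⟨ε, h2, h3⟩ := (h1.and_eventually (Ioo_mem_nhdsGT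
      (by positivity : (0 : ℝ) < 1 / ((k : ℝ) + 1)))).exists
    exact ⟨ε, h3, h2⟩
  choose ε hε1 hε2 using hex
  have hε0 : Tendsto ε atTop (𝓝 0) := squeeze_zero (fun k => (hε1 k).1.le) (fun k => (hε1 k).2.le)
    tendsto_one_div_add_atTop_nhds_zero_nat
  refine ⟨ε, fun k => (hε1 k).1, hε0, fun δ hδ0 a ha => ?_⟩
  have h2 : Tendsto (fun k : ℕ => 1 / ((k : ℝ) + 2)) atTop (𝓝 0) :=
    tendsto_const_nhds.div_atTop (tendsto_atTop_add_const_right _ _ tendsto_natCast_atTop_atTop)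
  have hlim : Tendsto (fun k : ℕ => ((xi φ).toReal + 1 / ((k : ℝ) + 1)) / (1 - 1 / ((k : ℝ) + 2)))
      atTop (𝓝 (((xi φ).toReal + 0) / (1 - 0))) :=
    (tendsto_one_div_add_atTop_nhds_zero_nat.const_add _).div (h2.const_sub 1) (by norm_num)
  rw [add_zero, sub_zero, div_one] at hlim
  filter_upwards [hlim.eventually_lt_const ha, h2.eventually_lt_const hδ0] with k hk1 hk2
  calc ENNReal.ofReal (Real.exp (-(a / ε k))) ≤ _ := by
        refine ENNReal.ofReal_le_ofReal (Real.exp_le_exp.mpr (neg_le_neg ?_))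
        exact div_le_div_of_nonneg_right hk1.le (hε1 k).1.le
    _ ≤ φ (window (1 / ((k : ℝ) + 2)) (ε k)) := (hε2 k).le
    _ ≤ _ := measure_mono (window_mono (hε1 k).1.le hk2.le)

/-! ### Optimality of the bounds -/

theorem logRate_law_mono {Ω' E : Type*} [MeasurableSpace Ω'] {ℙ : Measure Ω'} {Y : Ω' → ℝ → E}
    {t : ℝ} (ht : 0 ≤ t) {A B : Set E} (h : A ⊆ B) :
    logRate (law ℙ Y) t A ≤ logRate (law ℙ Y) t B :=
  mul_le_mul_of_nonneg_left (ENNReal.log_monotone (measure_mono fun _ hω => h hω))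
    (EReal.coe_nonneg.mpr (inv_nonneg.mpr ht))

theorem tendsto_sharpValue {L : ℝ → EReal} {α ℓ : ℝ} {X : ℝ≥0∞}
    (hlow : ∀ δ > 0, sharpValue α ℓ X ≤ L δ)
    (hupp : ∀ a : ℝ, (a : EReal) < ((ENNReal.ofReal ((1 - α) / ℓ) * X : ℝ≥0∞) : EReal) →
      ∃ δ₀ > 0, ∀ δ ∈ Ioc 0 δ₀, L δ ≤ ((-a : ℝ) : EReal)) :
    Tendsto L (𝓝[>] 0) (𝓝 (sharpValue α ℓ X)) := by
  refine tendsto_order.mpr ⟨fun c hc => ?_, fun c hc => ?_⟩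
  · filter_upwards [self_mem_nhdsWithin] with δ hδ
    exact hc.trans_le (hlow δ hδ)
  · obtain ⟨a, ha1, ha2⟩ := EReal.lt_iff_exists_real_btwn.mp hc
    obtain ⟨δ₀, hδ₀, h⟩ := hupp (-a) (by
      rw [EReal.coe_neg, EReal.neg_lt_comm]
      exact ha1)
    filter_upwards [Ioc_mem_nhdsGT hδ₀] with δ hδ
    have := h δ hδ
    rw [neg_neg] at this
    exact this.trans_lt ha2

theorem sharpValue_eq_neg_lowerJ {φ : Measure ℝ≥0} {α ℓ : ℝ} {x : Config} (hr : (restMass x.1 : ℝ) = 1 - α)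
    (h0 : (x.2 : ℝ) = ℓ) (hℓ : ℓ ∈ Ioo (0 : ℝ) 1) (hx : dualCost φ (x.1.1 : Measure ℝ≥0) = 0) :
    sharpValue α ℓ (xiBar φ) = -(lowerJ φ x : EReal) := by
  have h1 : x.2 < 1 := by
    have : (x.2 : ℝ) < 1 := h0 ▸ hℓ.2
    exact this
  rw [sharpValue, lowerJ, hx, zero_add, if_pos h1, ← ENNReal.ofReal_coe_nnreal, hr, h0,
    ← ENNReal.ofReal_inv_of_pos hℓ.1, ← ENNReal.ofReal_mul' (inv_nonneg.mpr hℓ.1.le), div_eq_mul_inv]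

section

variable {Ω' : Type*} [MeasurableSpace Ω'] {ℙ : Measure Ω'}
  {φ : Measure ℝ≥0} [IsProbabilityMeasure φ] {v : ℕ → Ω' → ℝ≥0} {T₀ : ℝ}
  {Y : Ω' → ℝ → ProbabilityMeasure Phase}

/-- For each radius the times are chosen to realize the liminf. The large deviations lower bound
gives one inequality; smallness of the window probabilities infinitely often gives the other, for
small radii. -/
theorem IsIID.lowerOptimal [IsProbabilityMeasure ℙ] (hv : IsIID ℙ φ v) (hφ : φ {0} = 0) (hT₀ : 0 ≤ T₀)
    (hY : ∀ ω, Tracks T₀ (fun i => v i ω) (Y ω)) : LowerOptimal φ (law ℙ Y) := by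
  intro α hα ℓ hℓ
  obtain ⟨x, hxℓ, hxr, hxd, hx⟩ := exists_config_typical hφ hα hℓ
  have hr : 0 < restMass x.1 := by
    rw [← NNReal.coe_pos, hxr]
    linarith [hα.2]
  have h0 : (0 : ℝ) < x.2 := hxℓ ▸ hℓ.1
  have h1 : (x.2 : ℝ) < 1 := hxℓ ▸ hℓ.2
  have hseq : ∀ δ : ℝ, ∃ s : ℕ → ℝ,
      Tendsto ((fun t => logRate (law ℙ Y) t (sharpBall φ α ℓ δ)) ∘ s) atTop
        (𝓝 (liminf (fun t => logRate (law ℙ Y) t (sharpBall φ α ℓ δ)) atTop)) ∧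
      Tendsto s atTop atTop := fun δ => exists_seq_tendsto_liminf
  choose s hs1 hs2 using hseq
  refine ⟨s, fun δ _ => hs2 δ, _, fun δ _ => hs1 δ, tendsto_sharpValue (fun δ hδ => ?_)
    fun a ha => ?_⟩
  · rw [sharpValue_eq_neg_lowerJ hxr hxℓ hℓ hxd]
    exact hv.neg_lowerJ_le hφ hT₀ hY h1 (isOpen_sharpBall hx δ) (mem_sharpBall hx hδ)
  · rw [← hxr, ← hxℓ] at ha
    obtain ⟨U, hU, hfr⟩ := hv.frequently_logRate_le hφ hT₀ hY hr h0 h1 ha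
    obtain ⟨δ₀, hδ₀, hsub⟩ := exists_sharpBall_subset hx hU
    refine ⟨δ₀, hδ₀, fun δ hδ => liminf_le_of_frequently_le ?_⟩
    refine (hfr.and_eventually (eventually_ge_atTop 0)).mono fun t ht => ?_
    exact (logRate_law_mono ht.2 ((sharpBall_mono hδ.2).trans hsub)).trans ht.1

/-- Along a suitable sequence of times, the probability of an open set is as large as `ξ` says. -/
theorem IsIID.exists_seq_neg_le_logRate [IsProbabilityMeasure ℙ] (hv : IsIID ℙ φ v) (hT₀ : 0 ≤ T₀)
    (hY : ∀ ω, Tracks T₀ (fun i => v i ω) (Y ω)) {x : Config} (hr : 0 < restMass x.1)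
    (h0 : (0 : ℝ) < x.2) (h1 : (x.2 : ℝ) < 1) (hC : Attainable φ x.1.1 0) (hξ : xi φ ≠ ∞) :
    ∃ t : ℕ → ℝ, (∀ k, 0 < t k) ∧ Tendsto t atTop atTop ∧
      ∀ O : Set (ProbabilityMeasure Phase), IsOpen O → mixtureProb x ∈ O →
        ∀ a : ℝ, (restMass x.1 : ℝ) / x.2 * (xi φ).toReal < a →
          ∀ᶠ k in atTop, ((-a : ℝ) : EReal) ≤ logRate (law ℙ Y) (t k) O := by
  have hr' : (0 : ℝ) < restMass x.1 := by exact_mod_cast hr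
  obtain ⟨ε, hε, hε0, hwin⟩ := exists_seq_measure_window hξ
  -- The times at which the speed required of the last cycle is centred at `ε k`.
  set t : ℕ → ℝ := fun k => x.2 / (restMass x.1 * ε k) with ht
  have htpos : ∀ k, 0 < t k := fun k => div_pos h0 (mul_pos hr' (hε k))
  have htlim : Tendsto t atTop atTop := (tendsto_div_mul_nhdsGT_zero h0 hr').comp
    (tendsto_nhdsWithin_iff.mpr ⟨hε0, Eventually.of_forall hε⟩)
  refine ⟨t, htpos, htlim, fun O hO hxO a ha => ?_⟩
  obtain ⟨δ, hδ, hlaw⟩ := hv.exists_window_le_law hT₀ hY hr h0 h1 hC hO hxO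
  have hb : (0 : ℝ) < restMass x.1 / x.2 := div_pos hr' h0
  obtain ⟨a', ha1, ha2⟩ := exists_between ha
  have h2 : (xi φ).toReal < a' / (restMass x.1 / x.2) := by
    rwa [lt_div_iff₀ hb, mul_comm]
  filter_upwards [htlim.eventually (hlaw (a - a') (sub_pos.mpr ha2)), hwin δ hδ.1 _ h2]
    with k hk1 hk2
  rw [show (x.2 : ℝ) / (restMass x.1 * t k) = ε k from
    div_mul_div_mul_cancel h0.ne' hr'.ne', zero_add] at hk1
  have h3 : ENNReal.ofReal (Real.exp (-(t k * a))) ≤ law ℙ Y (t k) O := by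
    refine le_trans (le_trans (le_of_eq ?_) (mul_le_mul_right hk2 _)) hk1
    rw [← ENNReal.ofReal_mul (Real.exp_pos _).le, ← Real.exp_add]
    have h4 : a' / (restMass x.1 / x.2) / ε k = t k * a' := by
      rw [ht]
      have := (hε k).ne'
      field_simp
    rw [h4]
    congr 2
    ring
  refine le_of_eq_of_le ?_ (le_coe_mul_log (inv_nonneg.mpr (htpos k).le) h3)
  congr 1
  have := (htpos k).ne'
  field_simp

/-- The same times must serve all radii. They come from windows with large probability, and a
subsequence makes the rates converge for all radii at once. -/
theorem IsIID.upperOptimal [IsProbabilityMeasure ℙ] (hv : IsIID ℙ φ v) (hφ : φ {0} = 0) (hT₀ : 0 ≤ T₀)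
    (hY : ∀ ω, Tracks T₀ (fun i => v i ω) (Y ω)) (hξ : xi φ ≠ ∞) : UpperOptimal φ (law ℙ Y) := by
  intro α hα ℓ hℓ
  obtain ⟨x, hxℓ, hxr, hxd, hx⟩ := exists_config_typical hφ hα hℓ
  have hr : 0 < restMass x.1 := by
    rw [← NNReal.coe_pos, hxr]
    linarith [hα.2]
  have h0 : (0 : ℝ) < x.2 := hxℓ ▸ hℓ.1
  have h1 : (x.2 : ℝ) < 1 := hxℓ ▸ hℓ.2
  have hC : Attainable φ x.1.1 0 := by
    have := attainable_dualCost hφ x.1.1 (by rw [hxd]; exact ENNReal.zero_ne_top)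
    rwa [hxd, ENNReal.toReal_zero] at this
  obtain ⟨t, htpos, htlim, hlow⟩ := hv.exists_seq_neg_le_logRate hT₀ hY hr h0 h1 hC hξ
  -- The rates increase with the radius, so Helly's theorem handles uncountably many radii.
  obtain ⟨n, hn, L, hL⟩ := exists_subseq_tendsto_of_monotone
    (fun k δ => logRate (law ℙ Y) (t k) (sharpBall φ α ℓ δ))
    fun k _ _ hδ => logRate_law_mono (htpos k).le (sharpBall_mono hδ)
  have htn : Tendsto (fun k => t (n k)) atTop atTop := htlim.comp hn.tendsto_atTop
  refine ⟨fun k => t (n k), htn, L, fun δ _ => hL δ, tendsto_sharpValue (fun δ hδ => ?_)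
    fun a ha => ?_⟩
  · refine le_of_forall_lt fun c hc => ?_
    obtain ⟨a, ha1, ha2⟩ := EReal.lt_iff_exists_real_btwn.mp hc
    refine ha1.trans_le (ge_of_tendsto (hL δ) (?_))
    have h2 : (restMass x.1 : ℝ) / x.2 * (xi φ).toReal < -a := by
      have hb : 0 ≤ (1 - α) / ℓ := div_nonneg (by linarith [hα.2]) hℓ.1.le
      have hfin : ENNReal.ofReal ((1 - α) / ℓ) * xi φ ≠ ∞ :=
        ENNReal.mul_ne_top ENNReal.ofReal_ne_top hξ
      rw [sharpValue, ← EReal.coe_ennreal_toReal hfin, ENNReal.toReal_mul,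
        ENNReal.toReal_ofReal hb, ← EReal.coe_neg, EReal.coe_lt_coe_iff] at ha2
      rw [hxr, hxℓ]
      linarith
    have h3 := hlow _ (isOpen_sharpBall hx δ) (mem_sharpBall hx hδ) (-a) h2
    rw [neg_neg] at h3
    exact hn.tendsto_atTop.eventually h3
  · rw [← hxr, ← hxℓ] at ha
    obtain ⟨U, hU, hev⟩ := hv.eventually_logRate_le hφ hT₀ hY hr h0 h1 ha
    obtain ⟨δ₀, hδ₀, hsub⟩ := exists_sharpBall_subset hx hU
    refine ⟨δ₀, hδ₀, fun δ hδ => le_of_tendsto (hL δ) ?_⟩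
    filter_upwards [htn.eventually hev] with k hk
    exact (logRate_law_mono (htpos _).le ((sharpBall_mono hδ.2).trans hsub)).trans hk

/-! ### The large deviations principle -/

theorem rateIBar_eq_rateI_of_eq {φ : Measure ℝ≥0} (h : xi φ = xiBar φ) :
    rateIBar φ = rateI φ := by
  funext μ
  refine iInf_congr fun r => iInf_congr fun _ => ?_
  rw [OmegaData.lowerCost, OmegaData.upperCost, ← h, add_mul, add_assoc]

theorem rateI_mixtureProb_le {φ : Measure ℝ≥0} [IsProbabilityMeasure φ] (hφ : φ {0} = 0)
    (x : Config) : rateI φ (mixtureProb x) ≤ upperJ φ x := by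
  rw [rateI_eq φ hφ]
  exact iInf₂_le (f := fun (y : Config) (_ : mixtureProb y = mixtureProb x) => upperJ φ y) x rfl

/-- If `ξ < ξ̄`, a configuration of cost `ξ` has a neighbourhood whose probability is infinitely
often below `e^{-a t}` for some `a > ξ`, which is incompatible with the lower bound. -/
theorem IsIID.xi_eq_xiBar_of_ldLowerBound (hv : IsIID ℙ φ v) (hφ : φ {0} = 0) (hT₀ : 0 ≤ T₀)
    (hY : ∀ ω, Tracks T₀ (fun i => v i ω) (Y ω)) (h : LDLowerBound (law ℙ Y) (rateI φ)) :
    xi φ = xiBar φ := by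
  refine le_antisymm (xi_le_xiBar φ) ?_
  by_contra! hlt
  -- With `α = ℓ = 1/2` the factor `(1 - α)/ℓ` equals `1`.
  have hhalf : (1 / 2 : ℝ) ∈ Ioo (0 : ℝ) 1 := by norm_num
  obtain ⟨x, hxℓ, hxr, hxd, hx⟩ := exists_config_typical hφ hhalf hhalf
  have hr : 0 < restMass x.1 := by
    rw [← NNReal.coe_pos, hxr]
    norm_num
  have h0 : (0 : ℝ) < x.2 := hxℓ ▸ hhalf.1
  have h1 : (x.2 : ℝ) < 1 := hxℓ ▸ hhalf.2
  have hb : (restMass x.1 : ℝ) / x.2 = 1 := by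
    rw [hxr, hxℓ]
    norm_num
  have hJ : upperJ φ x = xi φ := by
    rw [upperJ, hxd, zero_add, ← ENNReal.ofReal_coe_nnreal, ← ENNReal.ofReal_inv_of_pos h0,
      ← ENNReal.ofReal_mul' (inv_nonneg.mpr h0.le), ← div_eq_mul_inv, hb, ENNReal.ofReal_one,
      one_mul]
  obtain ⟨a, ha1, ha2⟩ := EReal.lt_iff_exists_real_btwn.mp
    (EReal.coe_ennreal_lt_coe_ennreal_iff.mpr hlt)
  obtain ⟨U, hU, hfr⟩ := hv.frequently_logRate_le hφ hT₀ hY hr h0 h1 (a := a) (by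
    rwa [hb, ENNReal.ofReal_one, one_mul])
  obtain ⟨O, hOU, hO, hxO⟩ := mem_nhds_iff.mp hU
  have h2 : liminf (fun t => logRate (law ℙ Y) t O) atTop ≤ ((-a : ℝ) : EReal) := by
    refine liminf_le_of_frequently_le ?_
    refine (hfr.and_eventually (eventually_ge_atTop 0)).mono fun t ht => ?_
    exact (logRate_law_mono ht.2 hOU).trans ht.1
  have h3 : (⨅ u ∈ O, rateI φ u) ≤ xi φ :=
    (iInf₂_le (f := fun u (_ : u ∈ O) => rateI φ u) _ hxO).trans
      ((rateI_mixtureProb_le hφ x).trans_eq hJ)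
  have h4 := (h.2 O hO).trans h2
  rw [EReal.coe_neg, EReal.neg_le_neg_iff] at h4
  exact absurd ha1 (not_lt.mpr (h4.trans (EReal.coe_ennreal_le_coe_ennreal_iff.mpr h3)))

theorem IsIID.ldp_iff [IsProbabilityMeasure ℙ] (hv : IsIID ℙ φ v) (hφ : φ {0} = 0) (hT₀ : 0 ≤ T₀)
    (hY : ∀ ω, Tracks T₀ (fun i => v i ω) (Y ω)) :
    LDP (law ℙ Y) (rateI φ) ↔ xi φ = xiBar φ := by
  refine ⟨fun h => hv.xi_eq_xiBar_of_ldLowerBound hφ hT₀ hY h.2, fun h =>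
    ⟨hv.ldUpperBound hφ hT₀ hY, ?_⟩⟩
  have := hv.ldLowerBound hφ hT₀ hY
  rwa [rateIBar_eq_rateI_of_eq h] at this

theorem IsIID.largeDeviations [IsProbabilityMeasure ℙ] (hv : IsIID ℙ φ v) (hφ : φ {0} = 0) (hT₀ : 0 ≤ T₀)
    (hY : ∀ ω, Tracks T₀ (fun i => v i ω) (Y ω)) :
    LDUpperBound (law ℙ Y) (rateI φ) ∧ LDLowerBound (law ℙ Y) (rateIBar φ) ∧
      (LDP (law ℙ Y) (rateI φ) ↔ xi φ = xiBar φ) ∧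
      (xi φ < xiBar φ → UpperOptimal φ (law ℙ Y) ∧ LowerOptimal φ (law ℙ Y)) :=
  ⟨hv.ldUpperBound hφ hT₀ hY, hv.ldLowerBound hφ hT₀ hY, hv.ldp_iff hφ hT₀ hY,
    fun h => ⟨hv.upperOptimal hφ hT₀ hY h.ne_top, hv.lowerOptimal hφ hT₀ hY⟩⟩

end

end HotBox

end

theorem theorem1 {Ω' : Type*} [MeasurableSpace Ω'] (ℙ : Measure Ω') [IsProbabilityMeasure ℙ]
    (φ : Measure ℝ≥0) [IsProbabilityMeasure φ] (hφ : φ {0} = 0)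
    (v : ℕ → Ω' → ℝ≥0) (hv_meas : ∀ i, Measurable (v i)) (hv_law : ∀ i, ℙ.map (v i) = φ)
    (hv_indep : ProbabilityTheory.iIndepFun v ℙ) :
    HotBox.IsGood (HotBox.rateI φ) ∧
    (∀ (q₀ : Set.Ico (0 : ℝ) 1) (p₀ : ℝ≥0), 0 < p₀ →
      HotBox.LDUpperBound (HotBox.delayedLaw ℙ v q₀ p₀) (HotBox.rateI φ) ∧
      HotBox.LDLowerBound (HotBox.delayedLaw ℙ v q₀ p₀) (HotBox.rateIBar φ) ∧
      (HotBox.LDP (HotBox.delayedLaw ℙ v q₀ p₀) (HotBox.rateI φ) ↔ HotBox.xi φ = HotBox.xiBar φ) ∧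
      (HotBox.xi φ < HotBox.xiBar φ →
        HotBox.UpperOptimal φ (HotBox.delayedLaw ℙ v q₀ p₀) ∧
        HotBox.LowerOptimal φ (HotBox.delayedLaw ℙ v q₀ p₀))) ∧
    (HotBox.LDUpperBound (HotBox.undelayedLaw ℙ v) (HotBox.rateI φ) ∧
      HotBox.LDLowerBound (HotBox.undelayedLaw ℙ v) (HotBox.rateIBar φ) ∧
      (HotBox.LDP (HotBox.undelayedLaw ℙ v) (HotBox.rateI φ) ↔ HotBox.xi φ = HotBox.xiBar φ) ∧
      (HotBox.xi φ < HotBox.xiBar φ →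
        HotBox.UpperOptimal φ (HotBox.undelayedLaw ℙ v) ∧
        HotBox.LowerOptimal φ (HotBox.undelayedLaw ℙ v))) := by
  have hv : HotBox.IsIID ℙ φ v := ⟨hv_meas, hv_law, hv_indep⟩
  refine ⟨(HotBox.isGood_rateI φ hφ).1, fun q₀ p₀ _ => ?_, ?_⟩
  · exact hv.largeDeviations hφ (div_nonneg (sub_nonneg.mpr q₀.2.2.le) p₀.coe_nonneg)
      fun ω => HotBox.tracks_empirical q₀ p₀ _
  · exact hv.largeDeviations hφ le_rfl fun ω => HotBox.tracks_undelayedEmpirical _
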